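/- Let $-\infty\le a<b\le+\infty$. **The space $\mathrm{SBV}(a,b)$.** A function $\phi:(a,b)\to\mathbb C$ is a simple step function if there is a finite $C\subset(a,b)$ such that $\phi$ is constant on each connected component of $(a,b)\setminus C$. On the space $\mathcal S$ of simple step functions, $\|\phi\|=\operatorname{var}\phi+|\phi(a^+)+\phi(b^-)|$ is a norm, where $\operatorname{var}$ is the total variation; $X=\mathrm{SBV}(a,b)$ is the completion of $\mathcal S$. **The system and its transfer operator.** Let $d\ge 0$, let $a=c_0<c_1<\dots<c_{d+1}=b$, and for $k=0,\dots,d$ put $I_k=(c_k,c_{k+1})$. Let $f_k:I_k\to(a,b)$ be continuous and strictly monotone, let $s_k=+1$ if $f_k$ is increasing and $s_k=-1$ if it is decreasing, and let $g_k\in\mathbb C$. The Ruelle transfer operator $L=\sum_{k=0}^d L_k$ is the bounded operator on $X$ determined by $L_k\phi(y)=g_k\,\phi(f_k^{-1}(y))\,\chi_{f_k(I_k)}(y)$, $y\in(a,b)$, $\phi\in\mathcal S$. **Point germs.** Let $\widehat I=[a^+,b^-]$ be the set of point germs $\hat u=u^\epsilon$, $\epsilon=\pm1$, consisting of $u^+$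 for $a\le u<b$ and $u^-$ for $a<u\le b$. Germs are compared with points by $x<x^+<y^-<y$ for $x<y$. For $\hat u=u^\epsilon\in\widehat I_k=[c_k^+,c_{k+1}^-]$ put $\hat f(\hat u)=(u')^{s_k\epsilon}$, where $u'=f_k(u^\epsilon)$ is the one-sided limit of $f_k$ at $u$, and put $s(\hat u)=s_k$, $g(\hat u)=g_k$. This defines $\hat f:\widehat I\to\widehat I$ and $s,g$ on $\widehat I$. Write $g^{(n)}(\hat u)=\prod_{i=0}^{n-1}g(\hat f^i\hat u)$, $s^{(n)}(\hat u)=\prod_{i=0}^{n-1}s(\hat f^i\hat u)$ and $\|g^{(n)}\|_\infty=\sup_{\hat u\in\widehat I}|g^{(n)}(\hat u)|$. **The Milnor–Thurston determinant.** For $0\le k\le d$ let $\sigma_{c_k}(\hat u)=\tfrac12$ if $\hat u>c_k$ and $-\tfrac12$ if $\hat u<c_k$, and let $$\Theta_{c_k}(\hat u,t)=\sum_{n\ge0}t^n\,s^{(n)}(\hat u)\,g^{(n)}(\hat u)\,\sigma_{c_k}(\hat f^n\hat u).$$ Let $M(t)=(M_{jk}(t))_{0\le j,k\le d}$ with $M_{0k}(t)=\Theta_{c_k}(a^+,t)+\Theta_{c_k}(b^-,t)$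 and $M_{jk}(t)=\Theta_{c_k}(c_j^+,t)-\Theta_{c_k}(c_j^-,t)$ for $j\ge1$, and let $d_{\mathrm{MT}}(t)=\det M(t)$. **Theorem.** The limit $\rho_\infty=\lim_{n\to\infty}\|g^{(n)}\|_\infty^{1/n}$ exists, and: 1. Every point $\lambda$ of the spectrum of $L$ on $X$ with $|\lambda|>\rho_\infty$ is an isolated point of the spectrum and an eigenvalue of $L$ of finite algebraic multiplicity. 2. For every $\lambda\in\mathbb C$ with $|\lambda|>\rho_\infty$, the function $d_{\mathrm{MT}}$ is analytic at $t=1/\lambda$, and $\lambda$ is an eigenvalue of $L$ if and only if $d_{\mathrm{MT}}(1/\lambda)=0$. 3. In that case the algebraic multiplicity of $\lambda$ equals the order of the zero of $d_{\mathrm{MT}}$ at $t=1/\lambda$. Here the algebraic multiplicity of an isolated point $\lambda$ of the spectrum is the dimension of the range of the Riesz projection $\frac1{2\pi i}\oint_{|\zeta-\lambda|=r}(\zeta-L)^{-1}\,d\zeta$, for any $r>0$ such that $\lambda$ is the only spectral point in $|\zeta-\lambda|\le r$. -/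

import Mathlib

open Set Filter Topology

noncomputable section

/-! ### Simple step functions and the space `SBV(a,b)`

Throughout, `-∞ ≤ a < b ≤ +∞` are extended reals.  A point `x : EReal` with `a < x < b` is
automatically a real number, so `Set.Ioo a b` is the usual open interval `(a,b)` of reals. -/

namespace Rugh

/-- The total variation of `φ : (a,b) → ℂ`. -/
def variation {a b : EReal} (φ : Ioo a b → ℂ) : ℝ := (eVariationOn φ univ).toReal

/-- The boundary value `∂φ = φ(a⁺) + φ(b⁻)`. In the type `Ioo a b`, which has neither a smallest nor
a largest element, `x → a⁺` is the filter `atBot` and `x → b⁻` is the filter `atTop`. -/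
def boundary {a b : EReal} (φ : Ioo a b → ℂ) : ℂ := limUnder atBot φ + limUnder atTop φ

/-- `φ` is a simple step function: for some finite `C ⊂ (a,b)` it is constant on the connected
components of `(a,b) \ C`, i.e. on every interval that does not meet `C`. -/
def IsSimpleStep {a b : EReal} (φ : Ioo a b → ℂ) : Prop :=
  ∃ C : Set (Ioo a b), C.Finite ∧ ∀ x y, x ≤ y → Disjoint (Icc x y) C → φ x = φ y

/-- The simple step functions form a subspace of all functions on `(a,b)`. -/
def simpleStepSubmodule (a b : EReal) : Submodule ℂ (Ioo a b → ℂ) where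
  carrier := {φ | IsSimpleStep φ}
  zero_mem' := ⟨∅, finite_empty, fun _ _ _ _ => rfl⟩
  add_mem' := by
    rintro φ ψ ⟨C, hC, h⟩ ⟨D, hD, h'⟩
    refine ⟨C ∪ D, hC.union hD, fun x y hxy hd => ?_⟩
    rw [disjoint_union_right] at hd
    simp [h x y hxy hd.1, h' x y hxy hd.2]
  smul_mem' := by
    rintro c φ ⟨C, hC, h⟩
    exact ⟨C, hC, fun x y hxy hd => by simp [h x y hxy hd]⟩

/-- The space `𝒮(a,b)` of simple step functions (a type of its own, so that it does not inherit the
topology of pointwise convergence). -/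
def SimpleStep (a b : EReal) : Type := simpleStepSubmodule a b

instance (a b : EReal) : AddCommGroup (SimpleStep a b) :=
  inferInstanceAs (AddCommGroup (simpleStepSubmodule a b))

instance (a b : EReal) : Module ℂ (SimpleStep a b) :=
  inferInstanceAs (Module ℂ (simpleStepSubmodule a b))

/-- The underlying function of a simple step function. -/
def SimpleStep.fn {a b : EReal} (φ : SimpleStep a b) : Ioo a b → ℂ := φ.1

section StepFacts

variable {a b : EReal}

theorem SimpleStep.fn_add (φ ψ : SimpleStep a b) : (φ + ψ).fn = φ.fn + ψ.fn := rfl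

theorem SimpleStep.fn_smul (c : ℂ) (φ : SimpleStep a b) : (c • φ).fn = c • φ.fn := rfl

theorem SimpleStep.fn_zero : (0 : SimpleStep a b).fn = 0 := rfl

theorem SimpleStep.ext {φ ψ : SimpleStep a b} (h : φ.fn = ψ.fn) : φ = ψ := Subtype.ext h

theorem SimpleStep.isSimpleStep (φ : SimpleStep a b) : IsSimpleStep φ.fn := φ.2

theorem IsSimpleStep.boundedVariationOn {φ : Ioo a b → ℂ} (h : IsSimpleStep φ) :
    BoundedVariationOn φ univ := by
  classical
  obtain ⟨C, hC, h⟩ := h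
  set F := hC.toFinset
  let N : Ioo a b → ℕ := fun y => (F.filter (· < y)).card + (F.filter (· ≤ y)).card
  have hN : Monotone N := by
    intro x y hxy
    refine add_le_add (Finset.card_le_card fun c hc => ?_) (Finset.card_le_card fun c hc => ?_)
    · simp only [Finset.mem_filter] at hc ⊢
      exact ⟨hc.1, hc.2.trans_le hxy⟩
    · simp only [Finset.mem_filter] at hc ⊢
      exact ⟨hc.1, hc.2.trans hxy⟩
  have key : ∀ x y, x < y → N x = N y → φ x = φ y := by
    intro x y hxy he
    refine h x y hxy.le (Set.disjoint_left.2 fun c hc hcC => ?_)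
    have h1 : (F.filter (· < x)) ⊆ (F.filter (· < y)) := fun c hc => by
      simp only [Finset.mem_filter] at hc ⊢
      exact ⟨hc.1, hc.2.trans hxy⟩
    have h2 : (F.filter (· ≤ x)) ⊆ (F.filter (· ≤ y)) := fun c hc => by
      simp only [Finset.mem_filter] at hc ⊢
      exact ⟨hc.1, hc.2.trans hxy.le⟩
    have k1 := Finset.card_le_card h1
    have k2 := Finset.card_le_card h2
    have e1 := Finset.eq_of_subset_of_card_le h1 (by simp only [N] at he; omega)
    have e2 := Finset.eq_of_subset_of_card_le h2 (by simp only [N] at he; omega)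
    have hcF : c ∈ F := by simpa [F] using hcC
    rcases hc.1.eq_or_lt with rfl | hlt
    · have : x ∈ F.filter (· < y) := by simp [hcF, hxy]
      rw [← e1] at this
      simp at this
    · have : c ∈ F.filter (· ≤ y) := by simp [hcF, hc.2]
      rw [← e2] at this
      simp only [Finset.mem_filter] at this
      exact absurd this.2 (not_le.2 hlt)
  have hfac : Function.FactorsThrough φ N := by
    intro x y he
    rcases lt_trichotomy x y with hl | rfl | hl
    · exact key x y hl he
    · rfl
    · exact (key y x hl he.symm).symm
  have hcomp : φ = Function.extend N φ (fun _ => 0) ∘ N := (hfac.extend_comp _).symm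
  have hfin : (Set.Iic (F.card + F.card)).Finite := Set.finite_Iic _
  have : Finite (Set.Iic (F.card + F.card)) := hfin
  have hb := BoundedVariationOn.of_finite (Function.extend N φ (fun _ => 0))
    (Set.Iic (F.card + F.card))
  rw [hcomp]
  refine ne_top_of_le_ne_top hb
    (eVariationOn.comp_le_of_monotoneOn _ N (hN.monotoneOn _) fun y _ => ?_)
  exact add_le_add (Finset.card_filter_le _ _) (Finset.card_filter_le _ _)

/-- The norm `‖φ‖ = var φ + |∂φ|` on simple step functions. -/
instance : Norm (SimpleStep a b) := ⟨fun φ => variation φ.fn + ‖boundary φ.fn‖⟩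

theorem SimpleStep.norm_def (φ : SimpleStep a b) : ‖φ‖ = variation φ.fn + ‖boundary φ.fn‖ := rfl

theorem norm_sub_le_variation {φ : Ioo a b → ℂ} (h : BoundedVariationOn φ univ) (x y : Ioo a b) :
    ‖φ x - φ y‖ ≤ variation φ := by
  rw [← dist_eq_norm]
  exact h.dist_le (mem_univ x) (mem_univ y)

/-- Bounded variation is measured by a monotone function with values in `[0, var φ]`. -/
theorem exists_increments {φ : Ioo a b → ℂ} (hφ : BoundedVariationOn φ univ) :
    ∃ W : Ioo a b → ℝ, (∀ x, 0 ≤ W x) ∧ (∀ x, W x ≤ variation φ) ∧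
      ∀ x y, x ≤ y → ‖φ y - φ x‖ ≤ W y - W x := by
  have hb : ∀ s, eVariationOn φ s ≠ ⊤ := fun s => hφ.mono (subset_univ s)
  refine ⟨fun x => (eVariationOn φ (Iic x)).toReal, fun x => ENNReal.toReal_nonneg,
    fun x => ENNReal.toReal_mono hφ (eVariationOn.mono φ (subset_univ _)), fun x y hxy => ?_⟩
  have h1 : eVariationOn φ (Iic x) + eVariationOn φ (Icc x y) ≤ eVariationOn φ (Iic y) := by
    refine (eVariationOn.add_le_union φ fun p hp q hq => le_trans hp hq.1).trans
      (eVariationOn.mono φ ?_)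
    rintro z (hz | hz)
    · exact le_trans hz hxy
    · exact hz.2
  have h2 := ENNReal.toReal_mono (hb _) h1
  rw [ENNReal.toReal_add (hb _) (hb _)] at h2
  have h3 := (hφ.mono (subset_univ (Icc x y))).dist_le (right_mem_Icc.2 hxy) (left_mem_Icc.2 hxy)
  rw [dist_eq_norm] at h3
  linarith

variable [hab : Fact (a < b)]

instance : Nonempty (Ioo a b) := (nonempty_Ioo.2 hab.out).to_subtype

theorem IsSimpleStep.exists_eventually_atBot {φ : Ioo a b → ℂ} (h : IsSimpleStep φ) :
    ∃ c, Tendsto φ atBot (𝓝 c) := by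
  obtain ⟨C, hC, h⟩ := h
  obtain ⟨m, hm⟩ := hC.bddBelow
  obtain ⟨x, hx⟩ := exists_lt m
  refine ⟨φ x, tendsto_const_nhds.congr' ?_⟩
  filter_upwards [eventually_le_atBot x] with y hy
  refine (h y x hy (Set.disjoint_left.2 fun c hc hcC => ?_)).symm
  exact absurd (hm hcC) (not_le.2 (hc.2.trans_lt hx))

theorem IsSimpleStep.exists_eventually_atTop {φ : Ioo a b → ℂ} (h : IsSimpleStep φ) :
    ∃ c, Tendsto φ atTop (𝓝 c) := by
  obtain ⟨C, hC, h⟩ := h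
  obtain ⟨m, hm⟩ := hC.bddAbove
  obtain ⟨x, hx⟩ := exists_gt m
  refine ⟨φ x, tendsto_const_nhds.congr' ?_⟩
  filter_upwards [eventually_ge_atTop x] with y hy
  refine (h x y hy (Set.disjoint_left.2 fun c hc hcC => ?_))
  exact absurd (hm hcC) (not_le.2 (hx.trans_le hc.1))

theorem IsSimpleStep.boundary_add {φ ψ : Ioo a b → ℂ} (h : IsSimpleStep φ) (h' : IsSimpleStep ψ) :
    boundary (φ + ψ) = boundary φ + boundary ψ := by
  obtain ⟨c, hc⟩ := h.exists_eventually_atBot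
  obtain ⟨c', hc'⟩ := h'.exists_eventually_atBot
  obtain ⟨e, he⟩ := h.exists_eventually_atTop
  obtain ⟨e', he'⟩ := h'.exists_eventually_atTop
  have h1 : Tendsto (φ + ψ) atBot (𝓝 (c + c')) := hc.add hc'
  have h2 : Tendsto (φ + ψ) atTop (𝓝 (e + e')) := he.add he'
  rw [boundary, boundary, boundary, hc.limUnder_eq, hc'.limUnder_eq, he.limUnder_eq,
    he'.limUnder_eq, h1.limUnder_eq, h2.limUnder_eq]
  ring

theorem IsSimpleStep.boundary_smul {φ : Ioo a b → ℂ} (h : IsSimpleStep φ) (t : ℂ) :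
    boundary (t • φ) = t * boundary φ := by
  obtain ⟨c, hc⟩ := h.exists_eventually_atBot
  obtain ⟨e, he⟩ := h.exists_eventually_atTop
  have h1 : Tendsto (t • φ) atBot (𝓝 (t * c)) := hc.const_smul t
  have h2 : Tendsto (t • φ) atTop (𝓝 (t * e)) := he.const_smul t
  rw [boundary, boundary, hc.limUnder_eq, he.limUnder_eq, h1.limUnder_eq, h2.limUnder_eq]
  ring

/-- A function whose increments are dominated by those of a function with values in `[0, C]` has
variation at most `C`. -/
theorem variation_le_of_increments {φ : Ioo a b → ℂ} (W : Ioo a b → ℝ) (C : ℝ)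
    (h0 : ∀ x, 0 ≤ W x) (hC : ∀ x, W x ≤ C)
    (h : ∀ x y, x ≤ y → ‖φ y - φ x‖ ≤ W y - W x) : variation φ ≤ C := by
  have hC0 : 0 ≤ C := (h0 (Classical.arbitrary _)).trans (hC _)
  refine ENNReal.toReal_le_of_le_ofReal hC0 (iSup_le ?_)
  rintro ⟨n, u, hu, -⟩
  have h1 : ∀ i ∈ Finset.range n, edist (φ (u (i + 1))) (φ (u i)) ≤
      ENNReal.ofReal (W (u (i + 1)) - W (u i)) := fun i _ => by
    rw [edist_dist, dist_eq_norm]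
    exact ENNReal.ofReal_le_ofReal (h _ _ (hu (Nat.le_succ i)))
  refine (Finset.sum_le_sum h1).trans ?_
  rw [← ENNReal.ofReal_sum_of_nonneg fun i _ =>
    (norm_nonneg _).trans (h _ _ (hu (Nat.le_succ i))), Finset.sum_range_sub (fun i => W (u i))]
  exact ENNReal.ofReal_le_ofReal (by linarith [h0 (u 0), hC (u n)])

theorem variation_add_le {φ ψ : Ioo a b → ℂ} (h : BoundedVariationOn φ univ)
    (h' : BoundedVariationOn ψ univ) : variation (φ + ψ) ≤ variation φ + variation ψ := by
  obtain ⟨W, h0, h1, h2⟩ := exists_increments h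
  obtain ⟨V, g0, g1, g2⟩ := exists_increments h'
  refine variation_le_of_increments (fun x => W x + V x) _ (fun x => add_nonneg (h0 x) (g0 x))
    (fun x => add_le_add (h1 x) (g1 x)) fun x y hxy => ?_
  have := norm_add_le (φ y - φ x) (ψ y - ψ x)
  have e : (φ + ψ) y - (φ + ψ) x = (φ y - φ x) + (ψ y - ψ x) := by
    simp only [Pi.add_apply]; ring
  rw [e]
  linarith [h2 x y hxy, g2 x y hxy]

theorem variation_smul_le {φ : Ioo a b → ℂ} (h : BoundedVariationOn φ univ) (t : ℂ) :
    variation (t • φ) ≤ ‖t‖ * variation φ := by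
  obtain ⟨W, h0, h1, h2⟩ := exists_increments h
  refine variation_le_of_increments (fun x => ‖t‖ * W x) _ (fun x => by have := h0 x; positivity)
    (fun x => by have := h1 x; gcongr) fun x y hxy => ?_
  have e : (t • φ) y - (t • φ) x = t * (φ y - φ x) := by
    simp only [Pi.smul_apply, smul_eq_mul]; ring
  rw [e, norm_mul, ← mul_sub]
  have := h2 x y hxy
  gcongr

theorem variation_smul {φ : Ioo a b → ℂ} (h : IsSimpleStep φ) (t : ℂ) :
    variation (t • φ) = ‖t‖ * variation φ := by
  rcases eq_or_ne t 0 with rfl | ht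
  · have h1 := variation_smul_le h.boundedVariationOn 0
    have h2 : 0 ≤ variation ((0 : ℂ) • φ) := ENNReal.toReal_nonneg
    simp only [norm_zero, zero_mul] at h1 ⊢
    exact le_antisymm h1 h2
  refine le_antisymm (variation_smul_le h.boundedVariationOn t) ?_
  have h1 : BoundedVariationOn (t • φ) univ :=
    IsSimpleStep.boundedVariationOn ((simpleStepSubmodule a b).smul_mem t h)
  have h2 := variation_smul_le h1 t⁻¹
  rw [inv_smul_smul₀ ht, norm_inv] at h2
  have : 0 < ‖t‖ := norm_pos_iff.2 ht
  calc ‖t‖ * variation φ ≤ ‖t‖ * (‖t‖⁻¹ * variation (t • φ)) := by gcongr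
    _ = variation (t • φ) := by field_simp

theorem SimpleStep.norm_apply_le (φ : SimpleStep a b) (x : Ioo a b) : ‖φ.fn x‖ ≤ ‖φ‖ := by
  obtain ⟨c, hc⟩ := φ.isSimpleStep.exists_eventually_atBot
  obtain ⟨e, he⟩ := φ.isSimpleStep.exists_eventually_atTop
  have hb := φ.isSimpleStep.boundedVariationOn
  have h1 : ‖φ.fn x - c‖ ≤ variation φ.fn :=
    le_of_tendsto (tendsto_const_nhds.sub hc).norm
      (Eventually.of_forall fun y => norm_sub_le_variation hb x y)
  have h2 : ‖φ.fn x - e‖ ≤ variation φ.fn :=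
    le_of_tendsto (tendsto_const_nhds.sub he).norm
      (Eventually.of_forall fun y => norm_sub_le_variation hb x y)
  have h3 : boundary φ.fn = c + e := by rw [boundary, hc.limUnder_eq, he.limUnder_eq]
  have h4 : 2 * φ.fn x = (φ.fn x - c) + (φ.fn x - e) + boundary φ.fn := by rw [h3]; ring
  have h5 : 2 * ‖φ.fn x‖ = ‖2 * φ.fn x‖ := by simp
  rw [h4] at h5
  rw [SimpleStep.norm_def]
  have h6 := norm_add₃_le (a := φ.fn x - c) (b := φ.fn x - e) (c := boundary φ.fn)
  have h7 := norm_nonneg (boundary φ.fn)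
  linarith

theorem SimpleStep.normCore (a b : EReal) [Fact (a < b)] :
    NormedSpace.Core ℂ (SimpleStep a b) where
  norm_nonneg φ := add_nonneg ENNReal.toReal_nonneg (norm_nonneg _)
  norm_smul t φ := by
    simp only [SimpleStep.norm_def, SimpleStep.fn_smul, variation_smul φ.isSimpleStep,
      φ.isSimpleStep.boundary_smul, norm_mul]
    ring
  norm_triangle φ ψ := by
    simp only [SimpleStep.norm_def, SimpleStep.fn_add, φ.isSimpleStep.boundary_add ψ.isSimpleStep]
    have h1 := variation_add_le φ.isSimpleStep.boundedVariationOn ψ.isSimpleStep.boundedVariationOn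
    have h2 := norm_add_le (boundary φ.fn) (boundary ψ.fn)
    linarith
  norm_eq_zero_iff φ := by
    constructor
    · intro h
      refine SimpleStep.ext (funext fun x => ?_)
      have := SimpleStep.norm_apply_le φ x
      rw [h] at this
      simpa [SimpleStep.fn_zero] using this
    · rintro rfl
      have h1 := variation_smul (φ := (0 : SimpleStep a b).fn) (SimpleStep.isSimpleStep 0) 0
      have h2 := IsSimpleStep.boundary_smul (φ := (0 : SimpleStep a b).fn)
        (SimpleStep.isSimpleStep 0) 0
      rw [zero_smul] at h1 h2
      rw [SimpleStep.norm_def, SimpleStep.fn_zero, h1, h2]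
      simp

instance : NormedAddCommGroup (SimpleStep a b) :=
  NormedAddCommGroup.ofCore (SimpleStep.normCore a b)

instance : NormedSpace ℂ (SimpleStep a b) := NormedSpace.ofCore (SimpleStep.normCore a b)

end StepFacts

/-- The Banach space `X = SBV(a,b)` of step functions of bounded variation: the completion of the
space of simple step functions for the norm `var φ + |∂φ|`. -/
abbrev SBV (a b : EReal) [Fact (a < b)] : Type := UniformSpace.Completion (SimpleStep a b)

/-! ### Monotone branches and their transfer operators -/

/-- A triple `(I, f, g)`: a non-empty open interval `I = (lo, hi) ⊂ (a,b)`, a continuous strictly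
monotone map `f : I → (a,b)` (given by a function on `EReal`, of which only the values on `I`
matter), and a constant weight `g ∈ ℂ`. -/
structure Branch (a b : EReal) where
  lo : EReal
  hi : EReal
  lo_lt_hi : lo < hi
  le_lo : a ≤ lo
  hi_le : hi ≤ b
  f : EReal → EReal
  mapsTo : MapsTo f (Ioo lo hi) (Ioo a b)
  continuousOn : ContinuousOn f (Ioo lo hi)
  strict : StrictMonoOn f (Ioo lo hi) ∨ StrictAntiOn f (Ioo lo hi)
  g : ℂ

namespace Branch

variable {a b : EReal} (B : Branch a b)

open Classical in
/-- The function `y ↦ g · φ(f⁻¹ y) · χ_{f(I)}(y)` on `(a,b)`. -/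
def transferFun (φ : Ioo a b → ℂ) (y : Ioo a b) : ℂ :=
  if h : ∃ x : Ioo a b, (x : EReal) ∈ Ioo B.lo B.hi ∧ B.f x = y then B.g * φ h.choose else 0

theorem injOn : InjOn B.f (Ioo B.lo B.hi) := B.strict.elim (·.injOn) (·.injOn)

theorem transferFun_of_mem (φ : Ioo a b → ℂ) {x y : Ioo a b} (hx : (x : EReal) ∈ Ioo B.lo B.hi)
    (hxy : B.f x = y) : B.transferFun φ y = B.g * φ x := by
  have h : ∃ x : Ioo a b, (x : EReal) ∈ Ioo B.lo B.hi ∧ B.f x = y := ⟨x, hx, hxy⟩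
  rw [transferFun, dif_pos h]
  have : h.choose = x := Subtype.ext
    (B.injOn h.choose_spec.1 hx (h.choose_spec.2.trans hxy.symm))
  rw [this]

theorem transferFun_of_notMem (φ : Ioo a b → ℂ) {y : Ioo a b}
    (h : ¬ ∃ x : Ioo a b, (x : EReal) ∈ Ioo B.lo B.hi ∧ B.f x = y) : B.transferFun φ y = 0 := by
  rw [transferFun, dif_neg h]

theorem transferFun_add (φ ψ : Ioo a b → ℂ) :
    B.transferFun (φ + ψ) = B.transferFun φ + B.transferFun ψ := by
  funext y
  by_cases h : ∃ x : Ioo a b, (x : EReal) ∈ Ioo B.lo B.hi ∧ B.f x = y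
  · obtain ⟨x, hx, hxy⟩ := h
    simp only [Pi.add_apply, B.transferFun_of_mem _ hx hxy]
    ring
  · simp only [Pi.add_apply, B.transferFun_of_notMem _ h, add_zero]

theorem transferFun_smul (t : ℂ) (φ : Ioo a b → ℂ) :
    B.transferFun (t • φ) = t • B.transferFun φ := by
  funext y
  by_cases h : ∃ x : Ioo a b, (x : EReal) ∈ Ioo B.lo B.hi ∧ B.f x = y
  · obtain ⟨x, hx, hxy⟩ := h
    simp only [Pi.smul_apply, smul_eq_mul, B.transferFun_of_mem _ hx hxy]
    ring
  · simp only [Pi.smul_apply, smul_eq_mul, B.transferFun_of_notMem _ h, mul_zero]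

/-- The image `f(I)` as a subset of `(a,b)`. -/
def image : Set (Ioo a b) := {y | ∃ x : Ioo a b, (x : EReal) ∈ Ioo B.lo B.hi ∧ B.f x = y}

theorem mem_image_iff (y : Ioo a b) : y ∈ B.image ↔ (y : EReal) ∈ B.f '' Ioo B.lo B.hi := by
  constructor
  · rintro ⟨x, hx, hxy⟩
    exact ⟨x, hx, hxy⟩
  · rintro ⟨x, hx, hxy⟩
    exact ⟨⟨x, B.le_lo.trans_lt hx.1, hx.2.trans_le B.hi_le⟩, hx, hxy⟩

theorem image_ordConnected : B.image.OrdConnected := by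
  have h : (B.f '' Ioo B.lo B.hi).OrdConnected :=
    (isPreconnected_Ioo.image _ B.continuousOn).ordConnected
  refine ⟨fun y hy z hz w hw => ?_⟩
  rw [mem_image_iff] at hy hz ⊢
  exact h.out hy hz hw

theorem isSimpleStep_transferFun {φ : Ioo a b → ℂ} (h : IsSimpleStep φ) :
    IsSimpleStep (B.transferFun φ) := by
  obtain ⟨C, hC, h⟩ := h
  set U : Set EReal := B.f '' Ioo B.lo B.hi with hU
  have hfin : ((B.f '' (Subtype.val '' C)) ∪ {sSup U, sInf U}).Finite :=
    ((hC.image _).image _).union (by simp)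
  refine ⟨Subtype.val ⁻¹' ((B.f '' (Subtype.val '' C)) ∪ {sSup U, sInf U}),
    hfin.preimage Subtype.val_injective.injOn, fun y z hyz hd => ?_⟩
  have hmem : ∀ w : EReal, (y : EReal) ≤ w → w ≤ z → w ∉ B.f '' (Subtype.val '' C) ∧
      w ≠ sSup U ∧ w ≠ sInf U := by
    intro w h1 h2
    have hw : w ∈ Ioo a b := ⟨y.2.1.trans_le h1, h2.trans_lt z.2.2⟩
    have := Set.disjoint_left.1 hd (show (⟨w, hw⟩ : Ioo a b) ∈ Icc y z from ⟨h1, h2⟩)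
    rw [mem_preimage, mem_union, not_or] at this
    exact ⟨this.1, fun e => this.2 (Or.inl e), fun e => this.2 (Or.inr e)⟩
  by_cases hy : y ∈ B.image <;> by_cases hz : z ∈ B.image
  · obtain ⟨x, hx, hxy⟩ := hy
    obtain ⟨x', hx', hxz⟩ := hz
    rw [B.transferFun_of_mem φ hx hxy, B.transferFun_of_mem φ hx' hxz]
    congr 1
    rcases B.strict with hm | hm
    · have hle : (x : EReal) ≤ x' := (hm.le_iff_le hx hx').1 (by rw [hxy, hxz]; exact hyz)
      refine h x x' hle (Set.disjoint_left.2 fun c hc hcC => ?_)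
      have hcI : (c : EReal) ∈ Ioo B.lo B.hi := ⟨hx.1.trans_le hc.1, lt_of_le_of_lt hc.2 hx'.2⟩
      refine (hmem (B.f c) ?_ ?_).1 (mem_image_of_mem _ (mem_image_of_mem _ hcC))
      · rw [← hxy]; exact (hm.le_iff_le hx hcI).2 hc.1
      · rw [← hxz]; exact (hm.le_iff_le hcI hx').2 hc.2
    · have hle : (x' : EReal) ≤ x := (hm.le_iff_ge hx hx').1 (by rw [hxy, hxz]; exact hyz)
      refine (h x' x hle (Set.disjoint_left.2 fun c hc hcC => ?_)).symm
      have hcI : (c : EReal) ∈ Ioo B.lo B.hi := ⟨hx'.1.trans_le hc.1, lt_of_le_of_lt hc.2 hx.2⟩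
      refine (hmem (B.f c) ?_ ?_).1 (mem_image_of_mem _ (mem_image_of_mem _ hcC))
      · rw [← hxy]; exact (hm.le_iff_ge hx hcI).2 hc.2
      · rw [← hxz]; exact (hm.le_iff_ge hcI hx').2 hc.1
  · exfalso
    refine (hmem (sSup U) (le_sSup ((B.mem_image_iff y).1 hy)) (sSup_le fun w hw => ?_)).2.1 rfl
    by_contra hlt
    have hoc : U.OrdConnected := (isPreconnected_Ioo.image _ B.continuousOn).ordConnected
    exact hz ((B.mem_image_iff z).2 (hoc.out ((B.mem_image_iff y).1 hy) hw
      ⟨hyz, (not_le.1 hlt).le⟩))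
  · exfalso
    refine (hmem (sInf U) (le_sInf fun w hw => ?_) (sInf_le ((B.mem_image_iff z).1 hz))).2.2 rfl
    by_contra hlt
    have hoc : U.OrdConnected := (isPreconnected_Ioo.image _ B.continuousOn).ordConnected
    exact hy ((B.mem_image_iff y).2 (hoc.out hw ((B.mem_image_iff z).1 hz)
      ⟨(not_le.1 hlt).le, hyz⟩))
  · rw [B.transferFun_of_notMem φ hy, B.transferFun_of_notMem φ hz]

/-- `L_k` on simple step functions. -/
def stepTransfer : SimpleStep a b →ₗ[ℂ] SimpleStep a b where
  toFun φ := ⟨B.transferFun φ.fn, B.isSimpleStep_transferFun φ.isSimpleStep⟩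
  map_add' φ ψ := SimpleStep.ext (B.transferFun_add φ.fn ψ.fn)
  map_smul' t φ := SimpleStep.ext (B.transferFun_smul t φ.fn)

theorem norm_transferFun_le [Fact (a < b)] (φ : SimpleStep a b) (y : Ioo a b) :
    ‖B.transferFun φ.fn y‖ ≤ ‖B.g‖ * ‖φ‖ := by
  by_cases h : y ∈ B.image
  · obtain ⟨x, hx, hxy⟩ := h
    rw [B.transferFun_of_mem _ hx hxy, norm_mul]
    have := φ.norm_apply_le x
    gcongr
  · rw [B.transferFun_of_notMem _ h, norm_zero]
    positivity

theorem exists_transfer_increments [Fact (a < b)] (φ : SimpleStep a b) :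
    ∃ V : Ioo a b → ℝ, (∀ y, 0 ≤ V y) ∧ (∀ y, V y ≤ ‖B.g‖ * ‖φ‖) ∧
      ∀ y ∈ B.image, ∀ z ∈ B.image, y ≤ z →
        ‖B.transferFun φ.fn z - B.transferFun φ.fn y‖ ≤ V z - V y := by
  classical
  obtain ⟨W, h0, h1, h2⟩ := exists_increments φ.isSimpleStep.boundedVariationOn
  have hv : variation φ.fn ≤ ‖φ‖ := by
    rw [SimpleStep.norm_def]; linarith [norm_nonneg (boundary φ.fn)]
  have hvn : 0 ≤ ‖φ‖ := norm_nonneg φ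
  have hg := norm_nonneg B.g
  let p : Ioo a b → Ioo a b := fun y => if h : y ∈ B.image then h.choose else y
  have hp1 : ∀ y ∈ B.image, (p y : EReal) ∈ Ioo B.lo B.hi ∧ B.f (p y) = y := fun y hy => by
    simp only [p, dif_pos hy]; exact hy.choose_spec
  rcases B.strict with hm | hm
  · refine ⟨fun y => ‖B.g‖ * W (p y), fun y => mul_nonneg hg (h0 _),
      fun y => mul_le_mul_of_nonneg_left ((h1 _).trans hv) hg, fun y hy z hz hyz => ?_⟩
    obtain ⟨a1, a2⟩ := hp1 y hy
    obtain ⟨b1, b2⟩ := hp1 z hz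
    have hle : p y ≤ p z := (hm.le_iff_le a1 b1).1 (by rw [a2, b2]; exact hyz)
    rw [B.transferFun_of_mem _ a1 a2, B.transferFun_of_mem _ b1 b2, ← mul_sub, norm_mul, ← mul_sub]
    exact mul_le_mul_of_nonneg_left (h2 _ _ hle) hg
  · refine ⟨fun y => ‖B.g‖ * (‖φ‖ - W (p y)),
      fun y => mul_nonneg hg (by linarith [h1 (p y)]),
      fun y => mul_le_mul_of_nonneg_left (by linarith [h0 (p y)]) hg, fun y hy z hz hyz => ?_⟩
    obtain ⟨a1, a2⟩ := hp1 y hy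
    obtain ⟨b1, b2⟩ := hp1 z hz
    have hle : p z ≤ p y := (hm.le_iff_ge a1 b1).1 (by rw [a2, b2]; exact hyz)
    rw [B.transferFun_of_mem _ a1 a2, B.transferFun_of_mem _ b1 b2, ← mul_sub, norm_mul, ← mul_sub,
      norm_sub_rev]
    refine mul_le_mul_of_nonneg_left ((h2 _ _ hle).trans (by linarith)) hg

theorem variation_transferFun_le [Fact (a < b)] (φ : SimpleStep a b) :
    variation (B.transferFun φ.fn) ≤ 3 * (‖B.g‖ * ‖φ‖) := by
  classical
  obtain ⟨V, h0, h1, h2⟩ := B.exists_transfer_increments φ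
  have hn := B.norm_transferFun_le φ
  set K := ‖B.g‖ * ‖φ‖ with hK
  have hK0 : 0 ≤ K := by positivity
  have hoc := B.image_ordConnected
  let W : Ioo a b → ℝ := fun y =>
    if y ∈ B.image then K + V y else if ∃ x ∈ B.image, x ≤ y then 3 * K else 0
  refine variation_le_of_increments W _ (fun y => ?_) (fun y => ?_) fun y z hyz => ?_
  · simp only [W]
    split_ifs <;> linarith [h0 y]
  · simp only [W]
    split_ifs <;> linarith [h1 y]
  · by_cases hy : y ∈ B.image
    · by_cases hz : z ∈ B.image
      · simp only [W, if_pos hy, if_pos hz]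
        linarith [h2 y hy z hz hyz]
      · simp only [W, if_pos hy, if_neg hz, if_pos (⟨y, hy, hyz⟩ : ∃ x ∈ B.image, x ≤ z)]
        rw [B.transferFun_of_notMem _ hz, zero_sub, norm_neg]
        linarith [hn y, h1 y]
    · by_cases hz : z ∈ B.image
      · have hno : ¬ ∃ x ∈ B.image, x ≤ y := by
          rintro ⟨x, hx, hxy⟩
          exact hy (hoc.out hx hz ⟨hxy, hyz⟩)
        simp only [W, if_neg hy, if_pos hz, if_neg hno]
        rw [B.transferFun_of_notMem _ hy, sub_zero]
        linarith [hn z, h0 z]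
      · rw [B.transferFun_of_notMem _ hy, B.transferFun_of_notMem _ hz, sub_zero, norm_zero]
        simp only [W, if_neg hy, if_neg hz]
        by_cases hx : ∃ x ∈ B.image, x ≤ y
        · obtain ⟨x, hx, hxy⟩ := hx
          rw [if_pos (⟨x, hx, hxy.trans hyz⟩ : ∃ x ∈ B.image, x ≤ z),
            if_pos (⟨x, hx, hxy⟩ : ∃ x ∈ B.image, x ≤ y), sub_self]
        · rw [if_neg hx, sub_zero]
          split_ifs <;> positivity

theorem norm_stepTransfer_le [Fact (a < b)] (φ : SimpleStep a b) :
    ‖B.stepTransfer φ‖ ≤ (5 * ‖B.g‖) * ‖φ‖ := by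
  have h : IsSimpleStep (B.transferFun φ.fn) := (B.stepTransfer φ).isSimpleStep
  obtain ⟨c, hc⟩ := h.exists_eventually_atBot
  obtain ⟨e, he⟩ := h.exists_eventually_atTop
  have hn := B.norm_transferFun_le φ
  have h1 : ‖c‖ ≤ ‖B.g‖ * ‖φ‖ := le_of_tendsto hc.norm (Eventually.of_forall hn)
  have h2 : ‖e‖ ≤ ‖B.g‖ * ‖φ‖ := le_of_tendsto he.norm (Eventually.of_forall hn)
  have h3 : boundary (B.transferFun φ.fn) = c + e := by
    rw [boundary, hc.limUnder_eq, he.limUnder_eq]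
  have h4 : ‖B.stepTransfer φ‖ =
      variation (B.transferFun φ.fn) + ‖boundary (B.transferFun φ.fn)‖ := rfl
  rw [h4, h3]
  linarith [norm_add_le c e, B.variation_transferFun_le φ]

/-- The bounded operator `L_k` on `SBV(a,b)`: the continuous extension of
`φ ↦ g · (φ ∘ f⁻¹) · χ_{f(I)}` from simple step functions to their completion. -/
def transfer [Fact (a < b)] : SBV a b →L[ℂ] SBV a b :=
  ((UniformSpace.Completion.toComplL (𝕜 := ℂ) (E := SimpleStep a b)).comp
      (B.stepTransfer.mkContinuous (5 * ‖B.g‖) B.norm_stepTransfer_le)).extend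
    (UniformSpace.Completion.toComplL (𝕜 := ℂ) (E := SimpleStep a b))

theorem transfer_coe [Fact (a < b)] (φ : SimpleStep a b) :
    B.transfer (φ : SBV a b) = ((B.stepTransfer φ : SimpleStep a b) : SBV a b) := by
  have h := ContinuousLinearMap.extend_eq
    ((UniformSpace.Completion.toComplL (𝕜 := ℂ) (E := SimpleStep a b)).comp
      (B.stepTransfer.mkContinuous (5 * ‖B.g‖) B.norm_stepTransfer_le))
    (e := UniformSpace.Completion.toComplL (𝕜 := ℂ) (E := SimpleStep a b))
    UniformSpace.Completion.denseRange_coe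
    (UniformSpace.Completion.isUniformInducing_coe (SimpleStep a b)) φ
  exact h

end Branch

/-! ### Point germs -/

/-- A point germ `x^ε` with base point `x` and direction `ε = ±1`. -/
@[ext] structure PointGerm where
  base : EReal
  dir : ℤˣ

namespace PointGerm

/-- `x < û`, for a base point `x` and a germ `û`. -/
def Above (u : PointGerm) (x : EReal) : Prop := x < u.base ∨ (u.base = x ∧ u.dir = 1)

/-- `û < x`, for a germ `û` and a base point `x`. -/
def Below (u : PointGerm) (x : EReal) : Prop := u.base < x ∨ (u.base = x ∧ u.dir = -1)

open Classical in
/-- `σ_x(û)`, equal to `+1/2` if `û > x` and to `-1/2` if `û < x`. -/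
def sigma (x : EReal) (u : PointGerm) : ℂ := if u.Above x then 1 / 2 else -(1 / 2)

/-- The germs lying in the open interval `(p,q)`, i.e. `[p⁺, q⁻]`. -/
def interval (p q : EReal) : Set PointGerm := {u | u.Above p ∧ u.Below q}

end PointGerm

namespace Branch

variable {a b : EReal} (B : Branch a b)

open Classical in
/-- The sign of monotonicity `s ∈ {±1}` of `f`. -/
def sign : ℤˣ := if StrictMonoOn B.f (Ioo B.lo B.hi) then 1 else -1

/-- The action `f̂(u^ε) = (f(u^ε))^{s ε}` on germs, where `f(u^±)` are the one-sided limits. -/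
def germMap (u : PointGerm) : PointGerm where
  base := if u.dir = 1 then Function.rightLim B.f u.base else Function.leftLim B.f u.base
  dir := B.sign * u.dir

end Branch

/-! ### Piecewise monotone systems -/

/-- Cutting points `a = c_0 < c_1 < ⋯ < c_{d+1} = b` together with a triple `(I_k, f_k, g_k)` on each
interval `I_k = (c_k, c_{k+1})`, `k = 0, …, d`. -/
structure MonotoneSystem (a b : EReal) (d : ℕ) where
  cut : Fin (d + 2) → EReal
  strictMono : StrictMono cut
  cut_zero : cut 0 = a
  cut_last : cut (Fin.last (d + 1)) = b
  branch : Fin (d + 1) → Branch a b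
  lo_eq : ∀ k, (branch k).lo = cut k.castSucc
  hi_eq : ∀ k, (branch k).hi = cut k.succ

namespace MonotoneSystem

variable {a b : EReal} {d : ℕ} (F : MonotoneSystem a b d)

/-- The Ruelle transfer operator `L = ∑_k L_k` on `SBV(a,b)`. -/
def transfer [Fact (a < b)] : SBV a b →L[ℂ] SBV a b := ∑ k, (F.branch k).transfer

/-- `û ∈ Î_k = [c_k⁺, c_{k+1}⁻]`. For each `û ∈ [a⁺, b⁻]` there is exactly one such `k`. -/
def InPiece (k : Fin (d + 1)) (u : PointGerm) : Prop :=
  u ∈ PointGerm.interval (F.branch k).lo (F.branch k).hi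

open Classical in
/-- The map `f̂` on germs, equal to `f̂_k` on `Î_k` (germs outside `[a⁺, b⁻]` are left fixed). -/
def germMap (u : PointGerm) : PointGerm :=
  if h : ∃ k, F.InPiece k u then (F.branch h.choose).germMap u else u

open Classical in
/-- The weight `g(û) = g_k` for `û ∈ Î_k`. -/
def weight (u : PointGerm) : ℂ := ∑ k, if F.InPiece k u then (F.branch k).g else 0

open Classical in
/-- The sign `s(û) = s_k` for `û ∈ Î_k`. -/
def sign (u : PointGerm) : ℂ :=
  ∑ k, if F.InPiece k u then (((F.branch k).sign : ℤ) : ℂ) else 0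

/-- `g^{(n)}(û) = g(f̂^{n-1} û) ⋯ g(û)`. -/
def weightProd (n : ℕ) (u : PointGerm) : ℂ :=
  ∏ i ∈ Finset.range n, F.weight (F.germMap^[i] u)

/-- `s^{(n)}(û) = s(f̂^{n-1} û) ⋯ s(û)`. -/
def signProd (n : ℕ) (u : PointGerm) : ℂ :=
  ∏ i ∈ Finset.range n, F.sign (F.germMap^[i] u)

/-- The uniform norm `‖g^{(n)}‖_∞` over the germs in `[a⁺, b⁻]`. -/
def weightNorm (n : ℕ) : ℝ := ⨆ u : PointGerm.interval a b, ‖F.weightProd n u‖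

/-- The kneading coordinate
`Θ_{c_k}(û, t) = ∑_{n ≥ 0} tⁿ (sg)^{(n)}(û) σ_{c_k}(f̂ⁿ û)`, for `k = 0, …, d`. -/
def kneading (k : Fin (d + 1)) (u : PointGerm) (t : ℂ) : ℂ :=
  ∑' n : ℕ, t ^ n * (F.signProd n u * F.weightProd n u) *
    PointGerm.sigma (F.cut k.castSucc) (F.germMap^[n] u)

/-- The kneading matrix `M_{jk}(t) = Δ_{c_j} Θ_{c_k}(·, t)`, `0 ≤ j, k ≤ d`, with
`Δ_{c_j} H = H(c_j⁺) - H(c_j⁻)` for `j ≥ 1` and `Δ_{c_0} H = H(a⁺) + H(b⁻)`. -/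
def kneadingMatrix (t : ℂ) : Matrix (Fin (d + 1)) (Fin (d + 1)) ℂ := Matrix.of fun j k =>
  if j = 0 then F.kneading k ⟨a, 1⟩ t + F.kneading k ⟨b, -1⟩ t
  else F.kneading k ⟨F.cut j.castSucc, 1⟩ t - F.kneading k ⟨F.cut j.castSucc, -1⟩ t

/-- The Milnor–Thurston determinant. -/
def mtDet (t : ℂ) : ℂ := (F.kneadingMatrix t).det

end MonotoneSystem

/-! ### Isolated eigenvalues and algebraic multiplicity -/

section Spectral

variable {X : Type*} [NormedAddCommGroup X] [NormedSpace ℂ X]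

/-- `(2πi)⁻¹ ∮_{|ζ - z| = r} (ζ - T)⁻¹ dζ`: if `z` is the only point of the spectrum of `T` in the
closed disk of radius `r`, this is the Riesz projection of `T` at `z`. -/
def rieszProjection (T : X →L[ℂ] X) (z : ℂ) (r : ℝ) : X →L[ℂ] X :=
  (2 * Real.pi * Complex.I : ℂ)⁻¹ • ∮ ζ in C(z, r), resolvent T ζ

/-- `z` is an isolated point of the spectrum of `T` (or a point of the resolvent set) and the range
of the Riesz projection of `T` at `z` has finite dimension `m`. -/
def HasAlgebraicMultiplicity (T : X →L[ℂ] X) (z : ℂ) (m : ℕ) : Prop :=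
  ∃ r : ℝ, 0 < r ∧ spectrum ℂ T ∩ Metric.closedBall z r ⊆ {z} ∧
    Module.rank ℂ (LinearMap.range (rieszProjection T z r : X →ₗ[ℂ] X)) = m

/-- `z` is an eigenvalue of `T`. -/
def IsEigenvalue (T : X →L[ℂ] X) (z : ℂ) : Prop := Module.End.HasEigenvalue (T : X →ₗ[ℂ] X) z

/-- `z` is an eigenvalue of `T`, an isolated point of the spectrum, and of finite algebraic
multiplicity. -/
def IsIsolatedEigenvalueOfFiniteMultiplicity (T : X →L[ℂ] X) (z : ℂ) : Prop :=
  IsEigenvalue T z ∧ (∃ r : ℝ, 0 < r ∧ spectrum ℂ T ∩ Metric.ball z r = {z}) ∧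
    ∃ m : ℕ, HasAlgebraicMultiplicity T z m

end Spectral

end Rugh

end

/-! A step function is recorded by its jumps. Let `p = ofJumps : ℓ¹(Î) → X` send δ_v to the step
equal to -1/2 before v and 1/2 after v. Reading off jumps, with ∂φ stored at a⁺, gives `jumps` with
p ∘ `jumps` = 1. The only redundancy is that a⁺ and b⁻ both give constants: p kills δ_{a⁺} + δ_{b⁻}.

On jumps, L is almost a weighted shift. A branch carries a jump at v ∈ Î_k to f̂v with factor s g;
this is the operator P = `transport`. Truncating φ to I_k also creates jumps at the two end germs of
I_k. Regrouped by cutting points, these form K = ∑_j ℓ_j ⊗ P e_j, where ℓ_j(δ_v) = -σ_{c_j}(v) and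
e_j = δ_{c_j⁺} - δ_{c_j⁻} (for j = 0, the sum of the two end germs). Thus L p = p (P + K). Since
ℓ_i(e_j) = -1 for i = j and 0 otherwise, P + K kills every e_j, in particular the vector e_0 killed
by p. With T = (P + K) ∘ `jumps` this yields L = p T and T p = P + K, so L and P + K share their
non-zero eigenvalues and generalised eigenspaces.

P^n maps each basis vector to a multiple of a basis vector, so ‖P^n‖ = ‖g^{(n)}‖_∞, and Gelfand's
formula makes ρ_∞ the spectral radius of P. For |t| ρ_∞ < 1 the inverse R of 1 - tP is a Neumann
series, and -ℓ_k(R δ_v) = Θ_{c_k}(v, t). From t R P = R - 1 and the values ℓ_i(e_j), the kneading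
matrix is exactly the transpose of 1 - t (ℓ_i(R P e_j)). Hence d_MT is the perturbation determinant
D of P + K: it is analytic and D(0) = 1, so its zeros are isolated. Where D ≠ 0, the Woodbury
formula inverts 1 - t(P + K); where D = 0, a null vector of the matrix gives an eigenvector.

For multiplicities, the explicit inverse shows that the resolvent of L has at most a pole at z =
1/t₀, so the Riesz projection has range ker (L - z)^k, of the same dimension m as E = ker (P + K -
z)^k. Subtracting z times a projection onto E removes the eigenvalue. The new determinant D' does
not vanish at t₀, and D = (1 - tz)^m D' because P + K - z is nilpotent on E; this is
`analyticOrderAt_det_perturbationMatrix`. -/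

noncomputable section


namespace Rugh

/-! ### Finite rank perturbations -/

section FiniteRank

variable {Y : Type*} [NormedAddCommGroup Y] [NormedSpace ℂ Y]
variable {ι : Type*} [Fintype ι]

/-- The finite rank operator `y ↦ ∑ i, l i y • w i`. -/
def finiteRank (l : ι → Y →L[ℂ] ℂ) (w : ι → Y) : Y →L[ℂ] Y := ∑ i, (l i).smulRight (w i)

theorem finiteRank_apply (l : ι → Y →L[ℂ] ℂ) (w : ι → Y) (y : Y) :
    finiteRank l w y = ∑ i, l i y • w i := by
  simp [finiteRank]

/-- The matrix `1 - t (l_i (R w_j))`. -/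
def perturbationMatrix [DecidableEq ι] (R : Y →L[ℂ] Y) (l : ι → Y →L[ℂ] ℂ) (w : ι → Y) (t : ℂ) : Matrix ι ι ℂ :=
  1 - t • Matrix.of fun i j => l i (R (w j))

theorem perturbationMatrix_mulVec [DecidableEq ι] (R : Y →L[ℂ] Y) (l : ι → Y →L[ℂ] ℂ) (w : ι → Y) (t : ℂ)
    (x : ι → ℂ) (i : ι) : (perturbationMatrix R l w t).mulVec x i =
      x i - t * ∑ j, x j * l i (R (w j)) := by
  rw [perturbationMatrix, Matrix.sub_mulVec, Matrix.one_mulVec, Matrix.smul_mulVec]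
  simp only [Pi.sub_apply, Pi.smul_apply, smul_eq_mul, Matrix.mulVec, dotProduct, Matrix.of_apply,
    mul_comm]

/-- `R + t ∑ N_{pq} (R w_p) ⊗ (l_q R)`, the inverse of `1 - t (P + ∑ l_i ⊗ w_i)` if `R` is the
inverse of `1 - t P` and `N` that of the perturbation matrix. -/
def perturbedInverse (R : Y →L[ℂ] Y) (l : ι → Y →L[ℂ] ℂ) (w : ι → Y) (t : ℂ) (N : Matrix ι ι ℂ) :
    Y →L[ℂ] Y :=
  R + t • ∑ p, ∑ q, N p q • ((l q).comp R).smulRight (R (w p))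

theorem perturbedInverse_apply (R : Y →L[ℂ] Y) (l : ι → Y →L[ℂ] ℂ) (w : ι → Y) (t : ℂ)
    (N : Matrix ι ι ℂ) (y : Y) : perturbedInverse R l w t N y =
      R y + t • ∑ p, (N.mulVec fun q => l q (R y)) p • R (w p) := by
  simp [perturbedInverse, Matrix.mulVec, dotProduct,
    Finset.sum_smul, mul_smul]

/-- Woodbury formula. Multiplying 1 - t(P + K) by R leaves y - t ∑ l_i(y) R w_i, and the functionals
l turn this into the perturbation matrix times (l_i y). So N recovers (l_i y), and the correction
term cancels the excess. -/
theorem perturbedInverse_mul [DecidableEq ι] {P R : Y →L[ℂ] Y} {l : ι → Y →L[ℂ] ℂ} {w : ι → Y} {t : ℂ}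
    {N : Matrix ι ι ℂ} (hR : R * (1 - t • P) = 1) (hN : N * perturbationMatrix R l w t = 1) :
    perturbedInverse R l w t N * (1 - t • (P + finiteRank l w)) = 1 := by
  ext y
  have h1 : R ((1 - t • (P + finiteRank l w)) y) = y - t • ∑ i, l i y • R (w i) := by
    have h := DFunLike.congr_fun hR y
    simp only [mul_apply_eq_comp, one_apply_eq_self,
      _root_.sub_apply, _root_.smul_apply] at h
    have e : (1 - t • (P + finiteRank l w)) y = (y - t • P y) - t • ∑ i, l i y • w i := by
      simp only [one_apply_eq_self, _root_.sub_apply,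
        _root_.smul_apply, _root_.add_apply, finiteRank_apply, smul_add]
      abel
    rw [e, map_sub, h, map_smul, map_sum]
    simp
  have h2 : (fun q => l q (y - t • ∑ i, l i y • R (w i))) =
      (perturbationMatrix R l w t).mulVec fun q => l q y := by
    funext q
    rw [perturbationMatrix_mulVec]
    simp
  rw [mul_apply_eq_comp, perturbedInverse_apply, h1, h2, Matrix.mulVec_mulVec, hN,
    Matrix.one_mulVec]
  simp

/-- The space may be infinite-dimensional, so the right inverse needs its own argument: here N
applied to (l_i (R y)) is the vector of values of the l_i on the candidate inverse of y. -/
theorem mul_perturbedInverse [DecidableEq ι] {P R : Y →L[ℂ] Y} {l : ι → Y →L[ℂ] ℂ} {w : ι → Y} {t : ℂ}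
    {N : Matrix ι ι ℂ} (hR : (1 - t • P) * R = 1) (hN : perturbationMatrix R l w t * N = 1) :
    (1 - t • (P + finiteRank l w)) * perturbedInverse R l w t N = 1 := by
  ext y
  have h (z : Y) : R z - t • P (R z) = z := by
    have h := DFunLike.congr_fun hR z
    simpa using h
  set x : ι → ℂ := fun q => l q (R y) with hx
  have h1 (i : ι) : l i (perturbedInverse R l w t N y) = N.mulVec x i := by
    have e := congrFun (congrArg (fun A => Matrix.mulVec A x) hN) i
    simp only [← Matrix.mulVec_mulVec, perturbationMatrix_mulVec, Matrix.one_mulVec] at e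
    rw [perturbedInverse_apply]
    simp only [map_add, map_smul, map_sum, smul_eq_mul, ← hx]
    linear_combination -e
  have h2 : (1 - t • P) (perturbedInverse R l w t N y) = y + t • ∑ p, N.mulVec x p • w p := by
    rw [← mul_apply_eq_comp]
    have e : (1 - t • P) (perturbedInverse R l w t N y) = ((1 - t • P) * R) y +
        t • ∑ p, N.mulVec x p • ((1 - t • P) * R) (w p) := by
      rw [perturbedInverse_apply]
      simp only [map_add, map_smul, map_sum, mul_apply_eq_comp, ← hx]
    rw [mul_apply_eq_comp, e, hR]
    simp
  have e : (1 - t • (P + finiteRank l w)) (perturbedInverse R l w t N y) =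
      (1 - t • P) (perturbedInverse R l w t N y) -
        t • ∑ i, l i (perturbedInverse R l w t N y) • w i := by
    simp only [one_apply_eq_self, _root_.sub_apply,
      _root_.smul_apply, _root_.add_apply, finiteRank_apply, smul_add]
    abel
  rw [mul_apply_eq_comp, e, h2]
  simp [h1]

/-- If the perturbation determinant vanishes at `t`, then `1 - t (P + K)` has a kernel. -/
theorem exists_fixed_of_det_eq_zero [DecidableEq ι] {P R : Y →L[ℂ] Y} {l : ι → Y →L[ℂ] ℂ} {w : ι → Y} {t : ℂ}
    (hR : (1 - t • P) * R = 1) (h0 : (perturbationMatrix R l w t).det = 0) :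
    ∃ v : Y, v ≠ 0 ∧ t • (P + finiteRank l w) v = v := by
  obtain ⟨c, hc, hMc⟩ := Matrix.exists_mulVec_eq_zero_iff.2 h0
  have h1 (i : ι) : c i = t * ∑ j, c j * l i (R (w j)) := by
    have := congrFun hMc i
    rw [perturbationMatrix_mulVec] at this
    exact sub_eq_zero.1 this
  -- The null vector c is recovered from v as t l_i(v) = c_i, so v ≠ 0, and both t K v and (1 - tP)
  -- v equal ∑ c_j w_j.
  set v : Y := ∑ j, c j • R (w j) with hv
  have h2 (i : ι) : t * l i v = c i := by
    rw [h1 i, hv]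
    simp
  refine ⟨v, fun h => hc (funext fun i => ?_), ?_⟩
  · rw [← h2 i, h]
    simp
  · have h3 : (1 - t • P) v = ∑ j, c j • w j := by
      have h (z : Y) : (1 - t • P) (R z) = z := DFunLike.congr_fun hR z
      rw [hv, map_sum]
      simp only [map_smul, h]
    have h4 : t • finiteRank l w v = ∑ j, c j • w j := by
      rw [finiteRank_apply, Finset.smul_sum]
      simp only [smul_smul, h2]
    rw [_root_.add_apply, smul_add, h4, ← h3]
    simp

/-- The eigenspaces of a finite rank perturbation away from the spectrum of `P`. -/
theorem finite_ker_one_sub_smul {P R : Y →L[ℂ] Y} (l : ι → Y →L[ℂ] ℂ) (w : ι → Y) {t : ℂ}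
    (hR : R * (1 - t • P) = 1) :
    ∃ V : Submodule ℂ Y, FiniteDimensional ℂ V ∧
      ∀ y, t • (P + finiteRank l w) y = y → y ∈ V := by
  refine ⟨Submodule.span ℂ (range fun i => R (w i)),
    FiniteDimensional.span_of_finite ℂ (finite_range _), fun y hy => ?_⟩
  have h1 : (1 - t • P) y = t • ∑ i, l i y • w i := by
    rw [_root_.add_apply, smul_add, finiteRank_apply] at hy
    simp only [one_apply_eq_self, _root_.sub_apply,
      _root_.smul_apply]
    nth_rw 1 [← hy]
    abel
  -- Applying R to (1 - tP) y = t K y confines y to the span of the finitely many R w_i.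
  have h2 : y = t • ∑ i, l i y • R (w i) := by
    have h := DFunLike.congr_fun hR y
    rw [mul_apply_eq_comp, h1] at h
    simpa using h.symm
  rw [h2]
  exact Submodule.smul_mem _ _ (Submodule.sum_mem _ fun i _ => Submodule.smul_mem _ _
    (Submodule.subset_span (mem_range_self i)))

end FiniteRank

end Rugh


/-! ### Order of vanishing of the perturbation determinant -/

namespace Rugh

/-- The characteristic polynomial differs from X^n by a nilpotent, and ℂ[X] is reduced, so the two
coincide; evaluate at s. -/
theorem det_smul_one_sub_of_isNilpotent {n : Type*} [Fintype n] [DecidableEq n]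
    {M : Matrix n n ℂ} (hM : IsNilpotent M) (s : ℂ) :
    (s • (1 : Matrix n n ℂ) - M).det = s ^ Fintype.card n := by
  have h := (Matrix.isNilpotent_charpoly_sub_pow_of_isNilpotent hM).eq_zero
  have h2 := congrArg (Polynomial.eval s) (sub_eq_zero.1 h)
  rw [Matrix.eval_charpoly] at h2
  simpa [Matrix.smul_one_eq_diagonal] using h2

section Order

variable {Y : Type*} [NormedAddCommGroup Y] [NormedSpace ℂ Y]
variable {ι : Type*} [DecidableEq ι]

/-- Deflation by a finite-dimensional invariant subspace: adding the rank `m` operator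
`-c ∑ v_i ⊗ u_i` to `P + K` multiplies the perturbation determinant by `det (1 + t c N)`, where `N`
is the matrix of `v_i (S u_j)`, `S` the inverse of `1 - t (P + K)`. -/
theorem det_perturbationMatrix_sumElim [Fintype ι] {κ : Type*} [Fintype κ] [DecidableEq κ] (R : Y →L[ℂ] Y)
    (l : ι → Y →L[ℂ] ℂ) (w : ι → Y) (v : κ → Y →L[ℂ] ℂ) (u : κ → Y) (t c : ℂ)
    (hD : IsUnit (perturbationMatrix R l w t).det) :
    (perturbationMatrix R (Sum.elim l v) (Sum.elim w fun i => -(c • u i)) t).det =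
      (perturbationMatrix R l w t).det *
        (1 + (t * c) • Matrix.of fun i j =>
          v i (perturbedInverse R l w t (perturbationMatrix R l w t)⁻¹ (u j))).det := by
  set A := perturbationMatrix R l w t with hA
  let _ : Invertible A := Matrix.invertibleOfIsUnitDet A hD
  have e : perturbationMatrix R (Sum.elim l v) (Sum.elim w fun i => -(c • u i)) t =
      Matrix.fromBlocks A (Matrix.of fun i j => t * c * l i (R (u j)))
        (Matrix.of fun i j => -(t * v i (R (w j))))
        (1 + (t * c) • Matrix.of fun i j => v i (R (u j))) := by
    ext (i | i) (j | j) <;> simp [perturbationMatrix, hA, Matrix.one_apply, mul_assoc]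
  -- The Schur complement of the block A supplies precisely the correction by which
  -- `perturbedInverse` differs from R.
  rw [e, Matrix.det_fromBlocks₁₁]
  congr 2
  ext i j
  simp only [Matrix.sub_apply, Matrix.add_apply, Matrix.smul_apply, Matrix.of_apply, smul_eq_mul,
    Matrix.mul_apply, perturbedInverse_apply, map_add, map_smul, map_sum, Matrix.mulVec, dotProduct,
    Matrix.invOf_eq_nonsing_inv, Finset.sum_mul, Finset.mul_sum, mul_add]
  rw [add_sub_assoc, sub_eq_add_neg, ← Finset.sum_neg_distrib, Finset.sum_comm]
  congr 2
  refine Finset.sum_congr rfl fun p _ => ?_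
  rw [← Finset.sum_neg_distrib]
  refine Finset.sum_congr rfl fun q _ => ?_
  ring

/-- Analyticity of the perturbation determinant. -/
theorem analyticAt_perturbationMatrix {R : ℂ → Y →L[ℂ] Y} {t₀ : ℂ} (hR : AnalyticAt ℂ R t₀)
    (l : ι → Y →L[ℂ] ℂ) (w : ι → Y) (i j : ι) :
    AnalyticAt ℂ (fun t => perturbationMatrix (R t) l w t i j) t₀ := by
  have h : AnalyticAt ℂ (fun t => l i (R t (w j))) t₀ :=
    ((l i).comp (ContinuousLinearMap.apply ℂ Y (w j))).analyticAt _ |>.comp hR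
  simp only [perturbationMatrix, Matrix.sub_apply, Matrix.smul_apply, Matrix.of_apply, smul_eq_mul]
  exact analyticAt_const.sub (analyticAt_id.mul h)

theorem analyticAt_det {n : Type*} [Fintype n] [DecidableEq n] {A : ℂ → Matrix n n ℂ} {t₀ : ℂ}
    (h : ∀ i j, AnalyticAt ℂ (fun t => A t i j) t₀) : AnalyticAt ℂ (fun t => (A t).det) t₀ := by
  simp only [Matrix.det_apply']
  exact Finset.analyticAt_fun_sum _ fun σ _ => analyticAt_const.mul
    (Finset.analyticAt_fun_prod _ fun i _ => h _ _)

theorem analyticAt_adjugate {n : Type*} [Fintype n] [DecidableEq n] {A : ℂ → Matrix n n ℂ} {t₀ : ℂ}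
    (h : ∀ i j, AnalyticAt ℂ (fun t => A t i j) t₀) (i j : n) :
    AnalyticAt ℂ (fun t => (A t).adjugate i j) t₀ := by
  simp only [Matrix.adjugate_apply]
  refine analyticAt_det fun p q => ?_
  by_cases hp : p = j
  · subst hp
    simpa using analyticAt_const
  · simpa [Matrix.updateRow_ne hp] using h p q

/-- Let `1 - t P` be invertible near `t₀ = 1 / z`, and let the perturbation determinant of
`P + K` be non-zero in a punctured neighbourhood of `t₀`. If the kernels of the powers of
`P + K - z` are stationary from `k` on, then the order of the determinant at `t₀` is their
dimension. -/
theorem analyticOrderAt_det_perturbationMatrix [Fintype ι] {P : Y →L[ℂ] Y} {R : ℂ → Y →L[ℂ] Y}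
    {l : ι → Y →L[ℂ] ℂ} {w : ι → Y} {z t₀ : ℂ} (hz : t₀ * z = 1) (hR : AnalyticAt ℂ R t₀)
    (hR1 : ∀ᶠ t in 𝓝 t₀, R t * (1 - t • P) = 1) (hR2 : ∀ᶠ t in 𝓝 t₀, (1 - t • P) * R t = 1)
    (hD : ∀ᶠ t in 𝓝[≠] t₀, (perturbationMatrix (R t) l w t).det ≠ 0) {k : ℕ}
    (hfin : FiniteDimensional ℂ
      (LinearMap.ker ((P + finiteRank l w - z • (1 : Y →L[ℂ] Y)) ^ k).toLinearMap))
    (hstab : ∀ y, ((P + finiteRank l w - z • (1 : Y →L[ℂ] Y)) ^ (k + 1)) y = 0 →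
      ((P + finiteRank l w - z • (1 : Y →L[ℂ] Y)) ^ k) y = 0) :
    analyticOrderAt (fun t => (perturbationMatrix (R t) l w t).det) t₀ =
      (Module.finrank ℂ
        (LinearMap.ker ((P + finiteRank l w - z • (1 : Y →L[ℂ] Y)) ^ k).toLinearMap) : ℕ) := by
  set A : Y →L[ℂ] Y := P + finiteRank l w with hAdef
  set B : Y →L[ℂ] Y := A - z • 1 with hBdef
  set E : Submodule ℂ Y := LinearMap.ker (B ^ k).toLinearMap with hE
  have hz0 : z ≠ 0 := right_ne_zero_of_mul_eq_one hz
  have memE (y : Y) : y ∈ E ↔ (B ^ k) y = 0 := by rw [hE, LinearMap.mem_ker]; rfl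
  have hBE : ∀ y ∈ E, B y ∈ E := fun y hy => by
    rw [memE, ← mul_apply_eq_comp, ← pow_succ, pow_succ', mul_apply_eq_comp, (memE y).1 hy,
      map_zero]
  have hAB (y : Y) : A y = B y + z • y := by simp [hBdef]
  have hAE : ∀ y ∈ E, A y ∈ E := fun y hy => by
    rw [hAB]; exact E.add_mem (hBE y hy) (E.smul_mem _ hy)
  -- A continuous projection onto E; its coordinates v_i and the basis u_i of E express z times the
  -- projection as a rank m operator.
  obtain ⟨p, hp⟩ := Submodule.ClosedComplemented.of_finiteDimensional E
  set m := Module.finrank ℂ E with hm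
  let bE := Module.finBasis ℂ E
  let u : Fin m → Y := fun i => (bE i : Y)
  let v : Fin m → Y →L[ℂ] ℂ := fun i => (LinearMap.toContinuousLinearMap (bE.coord i)).comp p
  have hvE (i) (y : E) : v i y = bE.repr y i := by simp [v, hp]
  let N0 : Matrix (Fin m) (Fin m) ℂ := LinearMap.toMatrix bE bE
    (B.toLinearMap.restrict hBE)
  have hN0 : IsNilpotent N0 := by
    have h1 : (B.toLinearMap.restrict hBE) ^ k = 0 := by
      rw [Module.End.pow_restrict]
      refine LinearMap.ext fun y => Subtype.ext ?_
      have h2 : (B.toLinearMap ^ k) (y : Y) = 0 := by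
        rw [← ContinuousLinearMap.toLinearMap_pow]
        exact (memE y).1 y.2
      exact h2
    refine ⟨k, ?_⟩
    change (LinearMap.toMatrix bE bE (B.toLinearMap.restrict hBE)) ^ k = 0
    rw [LinearMap.toMatrix_pow, h1, map_zero]
  have hBu (j) : B (u j) = ∑ i, N0 i j • u i := by
    have h1 := bE.sum_repr ((B.toLinearMap.restrict hBE) (bE j))
    have h2 := congrArg Subtype.val h1
    simp only [Submodule.coe_sum, Submodule.coe_smul] at h2
    simp only [N0, LinearMap.toMatrix_apply, u]
    exact h2.symm
  set D : ℂ → ℂ := fun t => (perturbationMatrix (R t) l w t).det with hDdef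
  set D' : ℂ → ℂ := fun t => (perturbationMatrix (R t) (Sum.elim l v)
    (Sum.elim w fun i => -(z • u i)) t).det with hD'
  have hD'an : AnalyticAt ℂ D' t₀ := analyticAt_det fun i j => analyticAt_perturbationMatrix hR _ _ i j
  have hDan : AnalyticAt ℂ D t₀ := analyticAt_det fun i j => analyticAt_perturbationMatrix hR _ _ i j
  -- Off t₀ the inverse S of 1 - tA exists. On E the operator 1 - tA has matrix C = (1 - tz) - t N0
  -- with N0 nilpotent, so det C = (1 - tz)^m, and S has matrix Q inverse to C. Then (1 + tz Q) C =
  -- C + tz = 1 - t N0 has determinant 1.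
  have hpunct : ∀ᶠ t in 𝓝[≠] t₀, D t = (1 - t * z) ^ m * D' t := by
    filter_upwards [hD, hR1.filter_mono nhdsWithin_le_nhds, self_mem_nhdsWithin] with t ht hRt htt
    have hu : IsUnit (perturbationMatrix (R t) l w t).det := isUnit_iff_ne_zero.2 ht
    have hs : 1 - t * z ≠ 0 := by
      intro h
      apply htt
      have : t * z = t₀ * z := by rw [hz]; linear_combination -h
      exact mul_right_cancel₀ hz0 this
    simp only [hD', hDdef]
    rw [det_perturbationMatrix_sumElim _ _ _ _ _ _ _ hu]
    set S := perturbedInverse (R t) l w t (perturbationMatrix (R t) l w t)⁻¹ with hS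
    have hSA := perturbedInverse_mul hRt (Matrix.nonsing_inv_mul _ hu)
    rw [← hAdef] at hSA
    set Q : Matrix (Fin m) (Fin m) ℂ := Matrix.of fun i j => v i (S (u j)) with hQ
    set C : Matrix (Fin m) (Fin m) ℂ := (1 - t * z) • 1 - t • N0 with hC
    have hQC : Q * C = 1 := by
      ext i j
      have h1 : (1 - t • A) (u j) = ∑ q, C q j • u q := by
        have : ∑ q, C q j • u q = (1 - t * z) • u j - t • B (u j) := by
          rw [hBu]
          simp [hC, sub_smul, Finset.sum_sub_distrib, Matrix.one_apply, mul_smul,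
            Finset.smul_sum, ite_smul]
        rw [this, sub_apply, smul_apply, one_apply_eq_self, hAB, smul_add, sub_smul, one_smul,
          smul_smul]
        abel
      have h2 := DFunLike.congr_fun hSA (u j)
      rw [mul_apply_eq_comp, h1, one_apply_eq_self] at h2
      have h3 := congrArg (v i) h2
      simp only [map_sum, map_smul, smul_eq_mul] at h3
      have h4 : v i (u j) = (1 : Matrix (Fin m) (Fin m) ℂ) i j := by
        simp only [u]
        rw [hvE, Module.Basis.repr_self, Finsupp.single_apply, Matrix.one_apply]
        simp only [eq_comm]
      rw [Matrix.mul_apply, ← h4, ← h3]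
      exact Finset.sum_congr rfl fun q _ => mul_comm _ _
    have hdC : C.det = (1 - t * z) ^ m := by
      rw [hC, det_smul_one_sub_of_isNilpotent (hN0.smul t), Fintype.card_fin]
    have hdet : (1 + (t * z) • Q).det * C.det = 1 := by
      rw [← Matrix.det_mul, add_mul, smul_mul_assoc, hQC, one_mul, hC]
      have : (1 - t * z) • (1 : Matrix (Fin m) (Fin m) ℂ) - t • N0 + (t * z) • 1 =
          (1 : ℂ) • 1 - t • N0 := by
        rw [sub_smul]; abel
      rw [this, det_smul_one_sub_of_isNilpotent (hN0.smul t), one_pow]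
    rw [hdC] at hdet
    linear_combination -(perturbationMatrix (R t) l w t).det * hdet
  -- S need not exist at t₀ itself; both sides are analytic there, so the identity extends to a full
  -- neighbourhood.
  have hall : ∀ᶠ t in 𝓝 t₀, D t = (1 - t * z) ^ m * D' t := by
    refine (AnalyticAt.frequently_eq_iff_eventually_eq hDan
      (((analyticAt_const.sub (analyticAt_id.mul analyticAt_const)).pow m).mul hD'an)).1
      hpunct.frequently
  -- Otherwise the deflated operator fixes z y for some y ≠ 0 in the sense A y - z p y = z y, that
  -- is B y = z p y ∈ E. Stationarity puts y in E, where p y = y, so B y = z y and B^k y = z^k y ≠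
  -- 0: a contradiction.
  have hne : D' t₀ ≠ 0 := by
    intro h0
    obtain ⟨y, hy0, hy⟩ := exists_fixed_of_det_eq_zero hR2.self_of_nhds h0
    have hK : (P + finiteRank (Sum.elim l v) (Sum.elim w fun i => -(z • u i))) y =
        A y - z • (p y : Y) := by
      have h1 : (p y : Y) = ∑ i, v i y • u i := by
        have h1 := congrArg Subtype.val (bE.sum_repr (p y))
        simp only [Submodule.coe_sum, Submodule.coe_smul] at h1
        rw [← h1]
        rfl
      rw [_root_.add_apply, finiteRank_apply, Fintype.sum_sum_type, hAdef, _root_.add_apply,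
        finiteRank_apply, h1, Finset.smul_sum]
      simp only [Sum.elim_inl, Sum.elim_inr, smul_neg, Finset.sum_neg_distrib, smul_comm z]
      abel
    rw [hK] at hy
    have hBy : B y = z • (p y : Y) := by
      have h2 := congrArg (fun x => z • x) hy
      simp only [smul_smul, mul_comm z, hz, one_smul] at h2
      rw [hAB] at h2
      have h3 : B y - z • (p y : Y) = 0 := by
        have : B y - z • (p y : Y) = (B y + z • y - z • (p y : Y)) - z • y := by abel
        rw [this, h2, sub_self]
      exact sub_eq_zero.1 h3
    have hyE : y ∈ E := by
      rw [memE]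
      refine hstab y ?_
      rw [pow_succ, mul_apply_eq_comp, hBy, map_smul, (memE _).1 (p y).2, smul_zero]
    have hBy' : B y = z • y := by
      rw [hBy, hp ⟨y, hyE⟩]
    have hpow (n : ℕ) : (B ^ n) y = z ^ n • y := by
      induction n with
      | zero => simp
      | succ n ih => rw [pow_succ, mul_apply_eq_comp, hBy', map_smul, ih, smul_smul, pow_succ']
    have := (memE y).1 hyE
    rw [hpow] at this
    exact (smul_ne_zero (pow_ne_zero k hz0) hy0) this
  refine (hDan.analyticOrderAt_eq_natCast).2 ⟨fun t => (-z) ^ m * D' t,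
    analyticAt_const.mul hD'an, mul_ne_zero (pow_ne_zero _ (neg_ne_zero.2 hz0)) hne, ?_⟩
  filter_upwards [hall] with t ht
  rw [ht, smul_eq_mul, ← mul_assoc, ← mul_pow]
  congr 2
  linear_combination -hz

end Order

end Rugh


namespace Rugh

/-! ### Riesz projections at poles of the resolvent -/

section Riesz

theorem map_circleIntegral {E F : Type*} [NormedAddCommGroup E] [NormedSpace ℂ E] [CompleteSpace E]
    [NormedAddCommGroup F] [NormedSpace ℂ F] [CompleteSpace F] (A : E →L[ℂ] F) {f : ℂ → E} {c : ℂ}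
    {r : ℝ} (hf : CircleIntegrable f c r) : A (∮ z in C(c, r), f z) = ∮ z in C(c, r), A (f z) := by
  rw [circleIntegral, circleIntegral, ← A.intervalIntegral_comp_comm hf.out]
  simp only [map_smul]

variable {X : Type*} [NormedAddCommGroup X] [NormedSpace ℂ X]

theorem continuousOn_resolvent [CompleteSpace X] (T : X →L[ℂ] X) : ContinuousOn (resolvent T) (resolventSet ℂ T) :=
  fun _ hk => (spectrum.hasDerivAt_resolvent_const_left hk).continuousAt.continuousWithinAt

theorem circleIntegrable_resolvent [CompleteSpace X] {T : X →L[ℂ] X} {z : ℂ} {r : ℝ} (hr : 0 < r)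
    (hres : ∀ ζ ∈ Metric.closedBall z r, ζ ≠ z → ζ ∈ resolventSet ℂ T) :
    CircleIntegrable (resolvent T) z r :=
  ((continuousOn_resolvent T).mono fun ζ hζ => hres ζ (Metric.sphere_subset_closedBall hζ)
    (Metric.ne_of_mem_sphere hζ hr.ne')).circleIntegrable hr.le

/-- `(ζ - z)^k (ζ - T)⁻¹ = (T - z)^k (ζ - T)⁻¹ + ∑ (ζ - z)^i (T - z)^{k-1-i}`. -/
theorem sub_pow_smul_resolvent (T : X →L[ℂ] X) {z ζ : ℂ} (k : ℕ) (hζ : ζ ∈ resolventSet ℂ T) :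
    (ζ - z) ^ k • resolvent T ζ = (T - z • 1) ^ k * resolvent T ζ +
      ∑ i ∈ Finset.range k, (ζ - z) ^ i • (T - z • (1 : X →L[ℂ] X)) ^ (k - 1 - i) := by
  have hc : Commute ((ζ - z) • (1 : X →L[ℂ] X)) (T - z • 1) :=
    (Commute.one_left _).smul_left _
  have h1 := hc.geom_sum₂_mul k
  have h2 : (ζ - z) • (1 : X →L[ℂ] X) - (T - z • 1) = algebraMap ℂ _ ζ - T := by
    rw [Algebra.algebraMap_eq_smul_one, sub_smul]; abel
  have h3 : (algebraMap ℂ (X →L[ℂ] X) ζ - T) * resolvent T ζ = 1 :=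
    Ring.mul_inverse_cancel _ hζ
  rw [h2] at h1
  have h4 := congrArg (· * resolvent T ζ) h1
  simp only [mul_assoc, h3, mul_one, sub_mul, smul_pow, one_pow, smul_mul_assoc, one_mul] at h4
  rw [h4]
  abel

/-- The Riesz projection fixes the generalised eigenvectors. -/
theorem rieszProjection_apply_of_pow_apply_eq_zero [CompleteSpace X] {T : X →L[ℂ] X} {z : ℂ} {r : ℝ} (hr : 0 < r)
    (hres : ∀ ζ ∈ Metric.closedBall z r, ζ ≠ z → ζ ∈ resolventSet ℂ T) {k : ℕ} {v : X}
    (hv : ((T - z • (1 : X →L[ℂ] X)) ^ k) v = 0) : rieszProjection T z r v = v := by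
  set B : X →L[ℂ] X := T - z • 1 with hB
  have hint := circleIntegrable_resolvent hr hres
  have h1 : (∮ ζ in C(z, r), resolvent T ζ) v = ∮ ζ in C(z, r), resolvent T ζ v :=
    map_circleIntegral (ContinuousLinearMap.apply ℂ X v) hint
  -- Since B^k v = 0, the resolvent applied to v is a finite Laurent sum with exponents i - k for i
  -- < k; only i = k - 1 has a residue, and its coefficient is v.
  have h2 : (∮ ζ in C(z, r), resolvent T ζ v) =
      ∮ ζ in C(z, r), ∑ i ∈ Finset.range k, (ζ - z) ^ ((i : ℤ) - k) • (B ^ (k - 1 - i)) v := by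
    refine circleIntegral.integral_congr hr.le fun ζ hζ => ?_
    have hne : ζ ≠ z := Metric.ne_of_mem_sphere hζ hr.ne'
    have hne' : ζ - z ≠ 0 := sub_ne_zero.2 hne
    have hζr := hres ζ (Metric.sphere_subset_closedBall hζ) hne
    have hcomm : B ^ k * resolvent T ζ = resolvent T ζ * B ^ k := by
      have h0 : Commute B (algebraMap ℂ (X →L[ℂ] X) ζ - T) := by
        rw [hB]
        refine Commute.sub_left ?_ ((Commute.one_left _).smul_left _)
        exact Commute.sub_right (Algebra.commutes ζ T).symm (Commute.refl T)
      have hζu : IsUnit (algebraMap ℂ (X →L[ℂ] X) ζ - T) := hζr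
      obtain ⟨u, hu⟩ := hζu
      rw [resolvent, ← hu, Ring.inverse_unit]
      rw [← hu] at h0
      exact h0.units_inv_right.pow_left k
    have h3 := DFunLike.congr_fun (sub_pow_smul_resolvent (z := z) T k hζr) v
    rw [← hB, hcomm, _root_.add_apply, mul_apply_eq_comp, hv, map_zero, zero_add,
      _root_.smul_apply, _root_.sum_apply] at h3
    have h4 := congrArg (fun x => (ζ - z) ^ (-(k : ℤ)) • x) h3
    simp only [smul_smul, Finset.smul_sum, _root_.smul_apply] at h4
    rw [← zpow_natCast, ← zpow_add₀ hne', neg_add_cancel, zpow_zero, one_smul] at h4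
    simp only [h4]
    refine Finset.sum_congr rfl fun i _ => ?_
    rw [← zpow_natCast, ← zpow_add₀ hne']
    congr 2
    ring
  have hzp (n : ℤ) (x : X) : CircleIntegrable (fun ζ => (ζ - z) ^ n • x) z r := by
    refine ContinuousOn.circleIntegrable hr.le (ContinuousOn.smul (ContinuousOn.zpow₀
      (by fun_prop) n fun ζ hζ => Or.inl (sub_ne_zero.2 (Metric.ne_of_mem_sphere hζ hr.ne')))
      continuousOn_const)
  have h5 : (∮ ζ in C(z, r), resolvent T ζ v) = (2 * Real.pi * Complex.I : ℂ) • v := by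
    rw [h2, circleIntegral.integral_fun_sum fun i _ => hzp _ _]
    simp only [circleIntegral.integral_smul_const]
    rcases Nat.eq_zero_or_pos k with rfl | hk
    · have : v = 0 := by simpa using hv
      simp [this]
    · rw [Finset.sum_eq_single (k - 1)]
      · have e : ((k - 1 : ℕ) : ℤ) - k = -1 := by omega
        rw [e]
        simp only [zpow_neg_one]
        rw [circleIntegral.integral_sub_center_inv _ hr.ne']
        simp
      · intro i hi hik
        rw [circleIntegral.integral_sub_zpow_of_ne, zero_smul]
        rw [Finset.mem_range] at hi
        omega
      · intro h
        exact absurd (Finset.mem_range.2 (Nat.sub_lt hk one_pos)) h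
  rw [rieszProjection, _root_.smul_apply, h1, h5, smul_smul, inv_mul_cancel₀, one_smul]
  simp [Real.pi_ne_zero]

/-- If the resolvent of `T` has a pole of order at most `k` at `z`, then the range of the Riesz
projection is the kernel of `(T - z)^k`. -/
theorem range_rieszProjection [CompleteSpace X] {T : X →L[ℂ] X} {z : ℂ} {r : ℝ} (hr : 0 < r)
    (hres : ∀ ζ ∈ Metric.closedBall z r, ζ ≠ z → ζ ∈ resolventSet ℂ T) {k : ℕ}
    {h : ℂ → X →L[ℂ] X} (hh : DifferentiableOn ℂ h (Metric.closedBall z r))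
    (hpole : ∀ ζ ∈ Metric.closedBall z r, ζ ≠ z → (ζ - z) ^ k • resolvent T ζ = h ζ) :
    LinearMap.range (rieszProjection T z r : X →ₗ[ℂ] X) =
      LinearMap.ker (((T - z • (1 : X →L[ℂ] X)) ^ k : X →L[ℂ] X) : X →ₗ[ℂ] X) := by
  set B : X →L[ℂ] X := T - z • 1 with hB
  have hint := circleIntegrable_resolvent hr hres
  refine le_antisymm ?_ fun v hv => ⟨v, rieszProjection_apply_of_pow_apply_eq_zero hr hres hv⟩
  -- On the circle B^k times the resolvent is h minus a polynomial in ζ, which is holomorphic across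
  -- z, so Cauchy's theorem kills the integral.
  have h1 : B ^ k * (∮ ζ in C(z, r), resolvent T ζ) = 0 := by
    have e1 : B ^ k * (∮ ζ in C(z, r), resolvent T ζ) = ∮ ζ in C(z, r), B ^ k * resolvent T ζ :=
      map_circleIntegral (ContinuousLinearMap.mul ℂ (X →L[ℂ] X) (B ^ k)) hint
    have e2 : (∮ ζ in C(z, r), B ^ k * resolvent T ζ) =
        ∮ ζ in C(z, r), (h ζ - ∑ i ∈ Finset.range k, (ζ - z) ^ i • B ^ (k - 1 - i)) := by
      refine circleIntegral.integral_congr hr.le fun ζ hζ => ?_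
      have hne : ζ ≠ z := Metric.ne_of_mem_sphere hζ hr.ne'
      have hζ' := Metric.sphere_subset_closedBall hζ
      rw [← hpole ζ hζ' hne, sub_pow_smul_resolvent T k (hres ζ hζ' hne), ← hB, add_sub_cancel_right]
    have hd : DifferentiableOn ℂ (fun ζ => h ζ - ∑ i ∈ Finset.range k,
        (ζ - z) ^ i • B ^ (k - 1 - i)) (Metric.closedBall z r) := by
      refine hh.sub (DifferentiableOn.fun_sum fun i _ => ?_)
      exact DifferentiableOn.smul_const (by fun_prop) _
    rw [e1, e2]
    exact DiffContOnCl.circleIntegral_eq_zero hr.le (hd.diffContOnCl_ball subset_rfl)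
  rintro _ ⟨v, rfl⟩
  rw [LinearMap.mem_ker]
  have h2 := DFunLike.congr_fun h1 v
  rw [mul_apply_eq_comp] at h2
  change (B ^ k) (rieszProjection T z r v) = 0
  rw [rieszProjection, _root_.smul_apply, map_smul, h2]
  simp

end Riesz

end Rugh


namespace Rugh

/-! ### Spectrum of `p ∘ T` when `T ∘ p` is a finite rank perturbation -/

section Factorization

theorem ringInverse_eq {A : Type*} [Ring A] {a b : A} (h₁ : a * b = 1) (h₂ : b * a = 1) :
    IsUnit a ∧ Ring.inverse a = b :=
  ⟨⟨⟨a, b, h₁, h₂⟩, rfl⟩, Ring.inverse_unit ⟨a, b, h₁, h₂⟩⟩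

/-- Induction: f maps ker f^(k+1) into ker f^k, and the kernel of this restriction lies in ker f. -/
theorem finiteDimensional_ker_pow {E : Type*} [AddCommGroup E] [Module ℂ E] (f : Module.End ℂ E)
    (h : FiniteDimensional ℂ (LinearMap.ker f)) (k : ℕ) :
    FiniteDimensional ℂ (LinearMap.ker (f ^ k)) := by
  induction k with
  | zero =>
    have : LinearMap.ker (f ^ 0) = ⊥ := by
      rw [pow_zero]; exact LinearMap.ker_eq_bot.2 Function.injective_id
    rw [this]
    infer_instance
  | succ k ih =>
    rw [← Submodule.fg_iff_finiteDimensional] at ih h ⊢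
    refine Submodule.fg_of_fg_map_of_fg_inf_ker f ?_ ?_
    · have hle : (LinearMap.ker (f ^ (k + 1))).map f ≤ LinearMap.ker (f ^ k) := by
        rintro _ ⟨x, hx, rfl⟩
        rw [LinearMap.mem_ker, ← Module.End.mul_apply, ← pow_succ]
        exact hx
      rw [Submodule.fg_iff_finiteDimensional] at ih ⊢
      exact Submodule.finiteDimensional_of_le hle
    · rw [Submodule.fg_iff_finiteDimensional] at h ⊢
      exact Submodule.finiteDimensional_of_le inf_le_right

variable {X Y : Type*} [NormedAddCommGroup X] [NormedSpace ℂ X]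
  [NormedAddCommGroup Y] [NormedSpace ℂ Y] {ι : Type*} [Fintype ι]

/-- If `S` inverts `1 - t T p`, then `1 + t p S T` inverts `1 - t p T`. -/
theorem resolvent_comp {p : Y →L[ℂ] X} {T : X →L[ℂ] Y} {S : Y →L[ℂ] Y} {ζ : ℂ} (hζ : ζ ≠ 0)
    (h₁ : S * (1 - ζ⁻¹ • T.comp p) = 1) (h₂ : (1 - ζ⁻¹ • T.comp p) * S = 1) :
    ζ ∈ resolventSet ℂ (p.comp T) ∧
      resolvent (p.comp T) ζ = ζ⁻¹ • (1 + ζ⁻¹ • p.comp (S.comp T)) := by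
  have e₁ (y : Y) : S y - ζ⁻¹ • S (T (p y)) = y := by simpa using DFunLike.congr_fun h₁ y
  have e₂ (y : Y) : S y - ζ⁻¹ • T (p (S y)) = y := by simpa using DFunLike.congr_fun h₂ y
  refine ringInverse_eq ?_ ?_
  · ext x
    have h := congrArg p (e₂ (T x))
    rw [map_sub, map_smul] at h
    simp only [Algebra.algebraMap_eq_smul_one, mul_apply_eq_comp, _root_.sub_apply,
      _root_.smul_apply, one_apply_eq_self, _root_.add_apply, ContinuousLinearMap.comp_apply,
      map_add, map_smul]
    rw [← h]
    match_scalars <;> field_simp <;> ring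
  · ext x
    have h := congrArg p (e₁ (T x))
    rw [map_sub, map_smul] at h
    simp only [Algebra.algebraMap_eq_smul_one, mul_apply_eq_comp, _root_.sub_apply,
      _root_.smul_apply, one_apply_eq_self, _root_.add_apply, ContinuousLinearMap.comp_apply,
      map_sub, map_smul]
    -- Hidden behind `s` so that rewriting `p (T x)` does not reach inside this term.
    generalize p (S (T (p (T x)))) = s at h ⊢
    rw [← h]
    match_scalars <;> field_simp <;> ring

/-- The determinant of the finite rank perturbation `P + ∑ l_i ⊗ w_i` of `P`. -/
def perturbationDet [DecidableEq ι] (P : Y →L[ℂ] Y) (l : ι → Y →L[ℂ] ℂ) (w : ι → Y) (t : ℂ) : ℂ :=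
  (perturbationMatrix (Ring.inverse (1 - t • P)) l w t).det

variable [DecidableEq ι] {p : Y →L[ℂ] X} {T : X →L[ℂ] Y} {P : Y →L[ℂ] Y} {l : ι → Y →L[ℂ] ℂ}
  {w : ι → Y} {z : ℂ}

theorem resolvent_eq_of_perturbationDet_ne_zero (hTp : T.comp p = P + finiteRank l w) {ζ : ℂ}
    (hζ : ζ ≠ 0) (hu : IsUnit (1 - ζ⁻¹ • P)) (hD : perturbationDet P l w ζ⁻¹ ≠ 0) :
    ζ ∈ resolventSet ℂ (p.comp T) ∧
      resolvent (p.comp T) ζ = ζ⁻¹ • (1 + ζ⁻¹ • p.comp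
        ((perturbedInverse (Ring.inverse (1 - ζ⁻¹ • P)) l w ζ⁻¹
          (perturbationMatrix (Ring.inverse (1 - ζ⁻¹ • P)) l w ζ⁻¹)⁻¹).comp T)) := by
  have hD' := isUnit_iff_ne_zero.2 hD
  refine resolvent_comp hζ ?_ ?_
  · rw [hTp]
    exact perturbedInverse_mul (Ring.inverse_mul_cancel _ hu) (Matrix.nonsing_inv_mul _ hD')
  · rw [hTp]
    exact mul_perturbedInverse (Ring.mul_inverse_cancel _ hu) (Matrix.mul_nonsing_inv _ hD')

/-- A null vector of the matrix gives v ≠ 0 with T p v = z v; then p v is an eigenvector of p T,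
non-zero because z v ≠ 0. -/
theorem isEigenvalue_comp_of_perturbationDet_eq_zero (hTp : T.comp p = P + finiteRank l w)
    (hz : z ≠ 0) (hu : IsUnit (1 - z⁻¹ • P)) (hD : perturbationDet P l w z⁻¹ = 0) :
    IsEigenvalue (p.comp T) z := by
  obtain ⟨v, hv0, hv⟩ := exists_fixed_of_det_eq_zero (Ring.mul_inverse_cancel _ hu) hD
  rw [← hTp] at hv
  have hv' : T (p v) = z • v := by
    have := congrArg (fun x => z • x) hv
    simpa [smul_smul, mul_inv_cancel₀ hz] using this
  refine Module.End.hasEigenvalue_of_hasEigenvector (x := p v)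
    ⟨Module.End.mem_eigenspace_iff.2 ?_, fun h => ?_⟩
  · change p (T (p v)) = z • p v
    rw [hv', map_smul]
  · rw [h, map_zero] at hv'
    exact smul_ne_zero hz hv0 hv'.symm

theorem mem_spectrum_of_isEigenvalue {A : X →L[ℂ] X} (h : IsEigenvalue A z) : z ∈ spectrum ℂ A := by
  obtain ⟨x, hx, hx0⟩ := h.exists_hasEigenvector
  intro hz
  obtain ⟨u, hu⟩ := (hz : IsUnit _)
  have h1 : (algebraMap ℂ (X →L[ℂ] X) z - A) x = 0 := by
    have : A x = z • x := Module.End.mem_eigenspace_iff.1 hx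
    simp [Algebra.algebraMap_eq_smul_one, this]
  have h2 := DFunLike.congr_fun u.inv_mul x
  rw [hu, mul_apply_eq_comp, h1] at h2
  apply hx0
  simpa using h2.symm

/-- Iterated intertwining: (pT - z) p = p (Tp - z). -/
theorem sub_smul_pow_comp (p : Y →L[ℂ] X) (T : X →L[ℂ] Y) (z : ℂ) (k : ℕ) (y : Y) :
    ((p.comp T - z • (1 : X →L[ℂ] X)) ^ k) (p y) = p (((T.comp p - z • (1 : Y →L[ℂ] Y)) ^ k) y) := by
  induction k generalizing y with
  | zero => simp
  | succ k ih =>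
    rw [pow_succ, pow_succ, mul_apply_eq_comp, mul_apply_eq_comp, ← ih]
    simp

theorem sub_smul_pow_apply_of_apply_eq_zero {A : Y →L[ℂ] Y} {y : Y} (h : A y = 0) (z : ℂ) (k : ℕ) :
    ((A - z • (1 : Y →L[ℂ] Y)) ^ k) y = (-z) ^ k • y := by
  induction k with
  | zero => simp
  | succ k ih =>
    rw [pow_succ, mul_apply_eq_comp, pow_succ', mul_smul, ← ih, ← map_smul]
    simp [h]

/-- The map p embeds one generalised eigenspace in the other: on ker p the operator T p vanishes, so
(Tp - z)^k acts there as the non-zero scalar (-z)^k. Exchanging p and T gives the reverse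
inequality. -/
theorem finrank_ker_sub_smul_pow_le (p : Y →L[ℂ] X) (T : X →L[ℂ] Y) (hz : z ≠ 0) (k : ℕ)
    [FiniteDimensional ℂ (LinearMap.ker ((p.comp T - z • (1 : X →L[ℂ] X)) ^ k).toLinearMap)] :
    FiniteDimensional ℂ (LinearMap.ker ((T.comp p - z • (1 : Y →L[ℂ] Y)) ^ k).toLinearMap) ∧
    Module.finrank ℂ (LinearMap.ker ((T.comp p - z • (1 : Y →L[ℂ] Y)) ^ k).toLinearMap) ≤
      Module.finrank ℂ (LinearMap.ker ((p.comp T - z • (1 : X →L[ℂ] X)) ^ k).toLinearMap) := by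
  let f : LinearMap.ker ((T.comp p - z • (1 : Y →L[ℂ] Y)) ^ k).toLinearMap →ₗ[ℂ]
      LinearMap.ker ((p.comp T - z • (1 : X →L[ℂ] X)) ^ k).toLinearMap :=
    p.toLinearMap.restrict fun y hy => by
      rw [LinearMap.mem_ker] at hy ⊢
      exact (sub_smul_pow_comp p T z k y).trans ((congrArg p hy).trans (map_zero p))
  have hf : Function.Injective f := by
    rw [injective_iff_map_eq_zero]
    intro y hy
    have h1 : p (y : Y) = 0 := congrArg Subtype.val hy
    have h2 : ((T.comp p - z • (1 : Y →L[ℂ] Y)) ^ k) (y : Y) = 0 := y.2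
    rw [sub_smul_pow_apply_of_apply_eq_zero (by simp [h1])] at h2
    exact Subtype.ext ((smul_eq_zero.1 h2).resolve_left (pow_ne_zero _ (neg_ne_zero.2 hz)))
  exact ⟨Module.Finite.of_injective f hf, LinearMap.finrank_le_finrank_of_injective hf⟩

theorem isEigenvalue_comp_iff (hTp : T.comp p = P + finiteRank l w)
    (hz : z ≠ 0) (hu : IsUnit (1 - z⁻¹ • P)) :
    IsEigenvalue (p.comp T) z ↔ perturbationDet P l w z⁻¹ = 0 := by
  refine ⟨fun h => ?_, isEigenvalue_comp_of_perturbationDet_eq_zero hTp hz hu⟩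
  by_contra h0
  exact mem_spectrum_of_isEigenvalue h (resolvent_eq_of_perturbationDet_ne_zero hTp hz hu h0).1

variable [CompleteSpace Y]

theorem analyticAt_inverse_one_sub_smul {t₀ : ℂ} (hu : IsUnit (1 - t₀ • P)) :
    AnalyticAt ℂ (fun t => Ring.inverse (1 - t • P)) t₀ := by
  obtain ⟨u, hu⟩ := hu
  have h1 : AnalyticAt ℂ (fun t : ℂ => 1 - t • P) t₀ := by fun_prop
  have h2 : AnalyticAt ℂ Ring.inverse ((fun t : ℂ => 1 - t • P) t₀) := by
    simp only [← hu]
    exact analyticAt_inverse u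
  exact AnalyticAt.comp (g := Ring.inverse) (f := fun t : ℂ => 1 - t • P) h2 h1

theorem eventually_isUnit_one_sub_smul {t₀ : ℂ} (hu : IsUnit (1 - t₀ • P)) :
    ∀ᶠ t in 𝓝 t₀, IsUnit (1 - t • P) := by
  have h1 : ContinuousAt (fun t : ℂ => 1 - t • P) t₀ := by fun_prop
  exact h1.eventually (Units.isOpen.mem_nhds hu)

theorem analyticAt_perturbationDet (l : ι → Y →L[ℂ] ℂ) (w : ι → Y) {t₀ : ℂ}
    (hu : IsUnit (1 - t₀ • P)) : AnalyticAt ℂ (perturbationDet P l w) t₀ :=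
  analyticAt_det fun i j =>
    analyticAt_perturbationMatrix (analyticAt_inverse_one_sub_smul hu) l w i j

/-- The resolvent of `p T` has at most a pole at `z`. -/
theorem exists_pole [CompleteSpace X] (hTp : T.comp p = P + finiteRank l w)
    (hz : z ≠ 0) (hu : IsUnit (1 - z⁻¹ • P))
    (hD : ∀ᶠ t in 𝓝[≠] z⁻¹, perturbationDet P l w t ≠ 0) :
    ∃ (r : ℝ) (k : ℕ) (h : ℂ → X →L[ℂ] X), 0 < r ∧
      (∀ ζ ∈ Metric.closedBall z r, ζ ≠ z → ζ ∈ resolventSet ℂ (p.comp T)) ∧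
      DifferentiableOn ℂ h (Metric.closedBall z r) ∧
      ∀ ζ ∈ Metric.closedBall z r, ζ ≠ z → (ζ - z) ^ k • resolvent (p.comp T) ζ = h ζ := by
  have hDan := analyticAt_perturbationDet l w hu
  -- The order is finite because the determinant is not locally zero; it bounds the order of the
  -- pole.
  obtain ⟨m, hm⟩ : ∃ m : ℕ, analyticOrderAt (perturbationDet P l w) z⁻¹ = m := by
    refine ⟨_, (ENat.natCast_toNat fun htop => ?_).symm⟩
    rw [analyticOrderAt_eq_top] at htop
    obtain ⟨t, h1, h2⟩ := (hD.and (htop.filter_mono nhdsWithin_le_nhds)).exists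
    exact h1 h2
  obtain ⟨g, hgan, hg0, hg⟩ := hDan.analyticOrderAt_eq_natCast.1 hm
  set R : ℂ → Y →L[ℂ] Y := fun t => Ring.inverse (1 - t • P) with hRdef
  have hR : AnalyticAt ℂ R z⁻¹ := analyticAt_inverse_one_sub_smul hu
  set M : ℂ → Matrix ι ι ℂ := fun t => perturbationMatrix (R t) l w t with hM
  -- The correction in `perturbedInverse` with the adjugate in place of the inverse: multiplied by
  -- the determinant it has no singularity at 1/z.
  let J : ℂ → Y →L[ℂ] Y := fun t =>
    ∑ i, ∑ j, (M t).adjugate i j • ((l j).comp (R t)).smulRight (R t (w i))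
  have hJan : AnalyticAt ℂ J z⁻¹ := by
    refine Finset.analyticAt_fun_sum _ fun i _ => Finset.analyticAt_fun_sum _ fun j _ => ?_
    refine (analyticAt_adjugate (fun i j => analyticAt_perturbationMatrix hR l w i j) i j).smul ?_
    have h1 : AnalyticAt ℂ (fun t => (l j).comp (R t)) z⁻¹ :=
      ((ContinuousLinearMap.compL ℂ Y Y ℂ (l j)).analyticAt _).comp hR
    have h2 : AnalyticAt ℂ (fun t => R t (w i)) z⁻¹ :=
      ((ContinuousLinearMap.apply ℂ Y (w i)).analyticAt _).comp hR
    exact ((ContinuousLinearMap.smulRightL ℂ Y Y).analyticAt_bilinear _).comp₂ h1 h2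
  let comp : (Y →L[ℂ] Y) →L[ℂ] (X →L[ℂ] X) :=
    (ContinuousLinearMap.compL ℂ X Y X p).comp ((ContinuousLinearMap.compL ℂ X Y Y).flip T)
  have hcomp (S : Y →L[ℂ] Y) : comp S = p.comp (S.comp T) := rfl
  -- With D(t) = (t - 1/z)^m g(t) and ζ - z = (1/ζ - 1/z)(-ζz), the factor (ζ - z)^m / D(1/ζ)
  -- becomes (-ζz)^m / g(1/ζ). Of the three powers of 1/ζ, two come from the resolvent formula and
  -- one is the t in `perturbedInverse`.
  let h : ℂ → X →L[ℂ] X := fun ζ => ((ζ - z) ^ m * ζ⁻¹) • (1 + ζ⁻¹ • comp (R ζ⁻¹)) +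
    ((-(ζ * z)) ^ m * (g ζ⁻¹)⁻¹ * (ζ⁻¹) ^ 3) • comp (J ζ⁻¹)
  have hinv : AnalyticAt ℂ (fun ζ : ℂ => ζ⁻¹) z := analyticAt_inv hz
  have hhan : AnalyticAt ℂ h z := by
    have a1 : AnalyticAt ℂ (fun ζ => comp (R ζ⁻¹)) z :=
      (comp.analyticAt _).comp (AnalyticAt.comp (g := R) (f := fun ζ : ℂ => ζ⁻¹) hR hinv)
    have a2 : AnalyticAt ℂ (fun ζ => comp (J ζ⁻¹)) z :=
      (comp.analyticAt _).comp (AnalyticAt.comp (g := J) (f := fun ζ : ℂ => ζ⁻¹) hJan hinv)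
    have a3 : AnalyticAt ℂ (fun ζ => (g ζ⁻¹)⁻¹) z := (AnalyticAt.comp hgan hinv).inv hg0
    have a4 : AnalyticAt ℂ (fun ζ : ℂ => (ζ - z) ^ m) z := by fun_prop
    have a5 : AnalyticAt ℂ (fun ζ : ℂ => (-(ζ * z)) ^ m) z := by fun_prop
    exact ((a4.mul hinv).smul (analyticAt_const.add (hinv.smul a1))).add
      (((a5.mul a3).mul (hinv.pow 3)).smul a2)
  have hpunct : ∀ᶠ ζ in 𝓝[≠] z, ζ ∈ resolventSet ℂ (p.comp T) ∧
      (ζ - z) ^ m • resolvent (p.comp T) ζ = h ζ := by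
    have t1 : Tendsto (fun ζ : ℂ => ζ⁻¹) (𝓝 z) (𝓝 z⁻¹) := hinv.continuousAt
    have t2 : Tendsto (fun ζ : ℂ => ζ⁻¹) (𝓝[≠] z) (𝓝[≠] z⁻¹) :=
      tendsto_nhdsWithin_iff.2 ⟨t1.mono_left nhdsWithin_le_nhds, by
        filter_upwards [self_mem_nhdsWithin] with ζ hζ h
        exact hζ (inv_injective h)⟩
    filter_upwards [t2.eventually hD, (t1.eventually hg).filter_mono nhdsWithin_le_nhds,
      (t1.eventually (eventually_isUnit_one_sub_smul hu)).filter_mono nhdsWithin_le_nhds,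
      (eventually_ne_nhds hz).filter_mono nhdsWithin_le_nhds, self_mem_nhdsWithin]
      with ζ h1 h2 h3 h4 h5
    obtain ⟨r1, r2⟩ := resolvent_eq_of_perturbationDet_ne_zero hTp h4 h3 h1
    refine ⟨r1, ?_⟩
    have h6 : g ζ⁻¹ ≠ 0 := fun h => h1 (by rw [h2, h, smul_zero])
    have h7 : perturbedInverse (R ζ⁻¹) l w ζ⁻¹ (M ζ⁻¹)⁻¹ =
        R ζ⁻¹ + (ζ⁻¹ * (perturbationDet P l w ζ⁻¹)⁻¹) • J ζ⁻¹ := by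
      simp only [perturbedInverse, Matrix.inv_def, Ring.inverse_eq_inv', J, Matrix.smul_apply,
        smul_eq_mul, mul_smul, ← Finset.smul_sum]
      rfl
    have h8 : (ζ - z) ^ m * (perturbationDet P l w ζ⁻¹)⁻¹ = (-(ζ * z)) ^ m * (g ζ⁻¹)⁻¹ := by
      have h9 : ζ - z = (ζ⁻¹ - z⁻¹) * (-(ζ * z)) := by field_simp; ring
      have h10 : ζ⁻¹ - z⁻¹ ≠ 0 := fun h => h5 (inv_injective (sub_eq_zero.1 h))
      rw [h2, h9, smul_eq_mul, mul_pow]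
      have h11 := pow_ne_zero m h10
      generalize (ζ⁻¹ - z⁻¹) ^ m = c at h11 ⊢
      field_simp
    rw [r2, ← hcomp]
    simp only [hRdef, hM] at h7
    rw [h7]
    simp only [h, map_add, map_smul]
    rw [← h8]
    module
  obtain ⟨r, hr, hball⟩ := Metric.eventually_nhds_iff_ball.1
    (hhan.eventually_analyticAt.and (eventually_nhdsWithin_iff.1 hpunct))
  have hsub : Metric.closedBall z (r / 2) ⊆ Metric.ball z r :=
    Metric.closedBall_subset_ball (half_lt_self hr)
  exact ⟨r / 2, m, h, half_pos hr, fun ζ hζ hne => ((hball ζ (hsub hζ)).2 hne).1,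
    fun ζ hζ => (hball ζ (hsub hζ)).1.differentiableAt.differentiableWithinAt,
    fun ζ hζ hne => ((hball ζ (hsub hζ)).2 hne).2⟩

/-- The algebraic multiplicity of `z` as an eigenvalue of `p T` is the order of the determinant. -/
theorem exists_hasAlgebraicMultiplicity [CompleteSpace X] (hTp : T.comp p = P + finiteRank l w)
    (hz : z ≠ 0) (hu : IsUnit (1 - z⁻¹ • P))
    (hD : ∀ᶠ t in 𝓝[≠] z⁻¹, perturbationDet P l w t ≠ 0) :
    ∃ m : ℕ, HasAlgebraicMultiplicity (p.comp T) z m ∧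
      analyticOrderAt (perturbationDet P l w) z⁻¹ = m := by
  obtain ⟨r, k, h, hr, hres, hh, hpole⟩ := exists_pole hTp hz hu hD
  have hrange := range_rieszProjection hr hres hh hpole
  have hfin0 : FiniteDimensional ℂ
      (LinearMap.ker (T.comp p - z • (1 : Y →L[ℂ] Y)).toLinearMap) := by
    obtain ⟨V, hV, hVm⟩ := finite_ker_one_sub_smul l w (Ring.inverse_mul_cancel _ hu)
    refine Submodule.finiteDimensional_of_le (S₂ := V) fun y hy => hVm y ?_
    have h1 : T.comp p y - z • y = 0 := by simpa using hy
    rw [← hTp, sub_eq_zero.1 h1, smul_smul, inv_mul_cancel₀ hz, one_smul]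
  have hfinY : FiniteDimensional ℂ
      (LinearMap.ker ((T.comp p - z • (1 : Y →L[ℂ] Y)) ^ k).toLinearMap) := by
    rw [ContinuousLinearMap.toLinearMap_pow]
    exact finiteDimensional_ker_pow _ hfin0 k
  obtain ⟨hfinX, hle⟩ := finrank_ker_sub_smul_pow_le T p hz k
  obtain ⟨-, hle'⟩ := finrank_ker_sub_smul_pow_le p T hz k
  -- The Riesz projection fixes p y, so p y already lies in ker (pT - z)^k. Hence x = (Tp - z)^k y
  -- satisfies p x = 0, and (Tp - z) x = 0 reduces to -z x = 0.
  have hstab : ∀ y, ((P + finiteRank l w - z • (1 : Y →L[ℂ] Y)) ^ (k + 1)) y = 0 →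
      ((P + finiteRank l w - z • (1 : Y →L[ℂ] Y)) ^ k) y = 0 := by
    intro y hy
    rw [← hTp] at hy ⊢
    have h1 : ((p.comp T - z • (1 : X →L[ℂ] X)) ^ (k + 1)) (p y) = 0 := by
      rw [sub_smul_pow_comp, hy, map_zero]
    have h2 : p y ∈ LinearMap.range (rieszProjection (p.comp T) z r : X →ₗ[ℂ] X) :=
      ⟨p y, rieszProjection_apply_of_pow_apply_eq_zero hr hres h1⟩
    rw [hrange] at h2
    have h3 : p (((T.comp p - z • (1 : Y →L[ℂ] Y)) ^ k) y) = 0 := by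
      rw [← sub_smul_pow_comp]
      exact h2
    rw [pow_succ', mul_apply_eq_comp] at hy
    set x := ((T.comp p - z • (1 : Y →L[ℂ] Y)) ^ k) y
    have h4 : -(z • x) = 0 := by simpa [h3] using hy
    exact (smul_eq_zero.1 (neg_eq_zero.1 h4)).resolve_left hz
  have hev := eventually_isUnit_one_sub_smul hu
  have hord := analyticOrderAt_det_perturbationMatrix (l := l) (w := w) (inv_mul_cancel₀ hz)
    (analyticAt_inverse_one_sub_smul hu) (hev.mono fun t ht => Ring.inverse_mul_cancel _ ht)
    (hev.mono fun t ht => Ring.mul_inverse_cancel _ ht) hD (k := k) (by rw [← hTp]; exact hfinY)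
    hstab
  rw [← hTp] at hord
  refine ⟨_, ⟨r, hr, fun ζ hζ => ?_, ?_⟩, hord⟩
  · by_contra hne
    exact hζ.1 (hres ζ hζ.2 hne)
  · rw [hrange, le_antisymm hle' hle, Module.finrank_eq_rank]

theorem isIsolatedEigenvalue_comp [CompleteSpace X] (hTp : T.comp p = P + finiteRank l w)
    (hz : z ≠ 0) (hu : IsUnit (1 - z⁻¹ • P))
    (hD : ∀ᶠ t in 𝓝[≠] z⁻¹, perturbationDet P l w t ≠ 0) (hsp : z ∈ spectrum ℂ (p.comp T)) :
    IsIsolatedEigenvalueOfFiniteMultiplicity (p.comp T) z := by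
  refine ⟨isEigenvalue_comp_of_perturbationDet_eq_zero hTp hz hu ?_, ?_, ?_⟩
  · by_contra h0
    exact hsp (resolvent_eq_of_perturbationDet_ne_zero hTp hz hu h0).1
  · obtain ⟨r, k, h, hr, hres, -⟩ := exists_pole hTp hz hu hD
    refine ⟨r, hr, Subset.antisymm (fun ζ hζ => ?_) ?_⟩
    · by_contra hne
      exact hζ.1 (hres ζ (Metric.ball_subset_closedBall hζ.2) hne)
    · rintro _ rfl
      exact ⟨hsp, Metric.mem_ball_self hr⟩
  · obtain ⟨m, hm, -⟩ := exists_hasAlgebraicMultiplicity hTp hz hu hD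
    exact ⟨m, hm⟩

end Factorization

end Rugh


namespace Rugh

/-! ### Germs as one-sided neighbourhoods -/

/-- The limit is the infimum of the values; strictness keeps every value above it, so the approach
is one-sided. The decreasing and left-hand cases are obtained from this one through order duals. -/
theorem _root_.StrictMonoOn.exists_tendsto_nhdsGT {α β : Type*} [LinearOrder α] [TopologicalSpace α]
    [OrderTopology α] [DenselyOrdered α] [CompleteLinearOrder β] [TopologicalSpace β]
    [OrderTopology β] {f : α → β} {u q : α} (h : u < q) (hf : StrictMonoOn f (Ioo u q)) :
    ∃ L, Tendsto f (𝓝[>] u) (𝓝[>] L) := by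
  refine ⟨sInf (f '' Ioo u q), tendsto_nhdsWithin_iff.2
    ⟨hf.monotoneOn.tendsto_nhdsWithin_Ioo_right (nonempty_Ioo.2 h) (OrderBot.bddBelow _), ?_⟩⟩
  filter_upwards [Ioo_mem_nhdsGT h] with x hx
  obtain ⟨x', hx'⟩ := nonempty_Ioo.2 hx.1
  have hx'' : x' ∈ Ioo u q := ⟨hx'.1, hx'.2.trans hx.2⟩
  exact (sInf_le (mem_image_of_mem f hx'')).trans_lt (hf hx'' hx hx'.2)

namespace PointGerm

/-- The filter of one-sided neighbourhoods of a germ. -/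
def nhds (v : PointGerm) : Filter EReal := if v.dir = 1 then 𝓝[>] v.base else 𝓝[<] v.base

theorem nhds_one (x : EReal) : (⟨x, 1⟩ : PointGerm).nhds = 𝓝[>] x := if_pos rfl

theorem nhds_neg_one (x : EReal) : (⟨x, -1⟩ : PointGerm).nhds = 𝓝[<] x := if_neg (show (-1 : ℤˣ) ≠ 1 by decide)

theorem not_above_iff {v : PointGerm} {x : EReal} : ¬ v.Above x ↔ v.Below x := by
  obtain ⟨u, e⟩ := v
  rcases Int.units_eq_one_or e with rfl | rfl
  · simp [Above, Below, le_iff_lt_or_eq, or_comm, eq_comm, not_or]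
    grind
  · simp [Above, Below, le_iff_lt_or_eq]

theorem sigma_of_above {v : PointGerm} {x : EReal} (h : v.Above x) : sigma x v = 1 / 2 := if_pos h

theorem sigma_of_below {v : PointGerm} {x : EReal} (h : v.Below x) : sigma x v = -(1 / 2) :=
  if_neg (not_above_iff.2 h)

theorem Above.eventually {v : PointGerm} {x : EReal} (h : v.Above x) : ∀ᶠ y in v.nhds, x < y := by
  obtain ⟨u, e⟩ := v
  rcases Int.units_eq_one_or e with rfl | rfl
  · rw [nhds_one]
    filter_upwards [self_mem_nhdsWithin] with y hy
    rcases h with h | h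
    · exact lt_trans h hy
    · exact h.1 ▸ hy
  · rw [nhds_neg_one]
    have : x < u := h.resolve_right fun h => absurd h.2 (show (-1 : ℤˣ) ≠ 1 by decide)
    exact nhdsWithin_le_nhds (Ioi_mem_nhds this)

theorem Below.eventually {v : PointGerm} {x : EReal} (h : v.Below x) : ∀ᶠ y in v.nhds, y < x := by
  obtain ⟨u, e⟩ := v
  rcases Int.units_eq_one_or e with rfl | rfl
  · rw [nhds_one]
    have : u < x := h.resolve_right fun h => absurd h.2 (show (1 : ℤˣ) ≠ -1 by decide)
    exact nhdsWithin_le_nhds (Iio_mem_nhds this)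
  · rw [nhds_neg_one]
    filter_upwards [self_mem_nhdsWithin] with y hy
    rcases h with h | h
    · exact lt_trans hy h
    · exact h.1 ▸ hy

theorem above_iff_eventually {v : PointGerm} [hv : v.nhds.NeBot] {x : EReal} :
    v.Above x ↔ ∀ᶠ y in v.nhds, x < y := by
  refine ⟨Above.eventually, fun h => ?_⟩
  by_contra h'
  obtain ⟨y, h1, h2⟩ := (h.and (not_above_iff.1 h').eventually).exists
  exact lt_asymm h1 h2

theorem below_iff_eventually {v : PointGerm} [hv : v.nhds.NeBot] {x : EReal} :
    v.Below x ↔ ∀ᶠ y in v.nhds, y < x := by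
  refine ⟨Below.eventually, fun h => ?_⟩
  rw [← not_above_iff]
  intro h'
  obtain ⟨y, h1, h2⟩ := (h.and h'.eventually).exists
  exact lt_asymm h1 h2

theorem eventually_mem_Ioo {v : PointGerm} {p q : EReal} (hv : v ∈ interval p q) :
    ∀ᶠ x in v.nhds, x ∈ Ioo p q := hv.1.eventually.and hv.2.eventually

theorem mem_interval_one {u p q : EReal} : (⟨u, 1⟩ : PointGerm) ∈ interval p q ↔ p ≤ u ∧ u < q := by
  simp [interval, Above, Below, le_iff_lt_or_eq, eq_comm]

theorem mem_interval_neg_one {u p q : EReal} :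
    (⟨u, -1⟩ : PointGerm) ∈ interval p q ↔ p < u ∧ u ≤ q := by
  simp [interval, Above, Below, le_iff_lt_or_eq]

theorem nhds_neBot {v : PointGerm} {p q : EReal} (hv : v ∈ interval p q) : v.nhds.NeBot := by
  obtain ⟨u, e⟩ := v
  rcases Int.units_eq_one_or e with rfl | rfl
  · rw [nhds_one]
    exact nhdsGT_neBot_of_exists_gt ⟨q, (mem_interval_one.1 hv).2⟩
  · rw [nhds_neg_one]
    exact nhdsLT_neBot_of_exists_lt ⟨p, (mem_interval_neg_one.1 hv).1⟩

theorem interval_mono {p q p' q' : EReal} (hp : p' ≤ p) (hq : q ≤ q') :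
    interval p q ⊆ interval p' q' := by
  intro v hv
  have := nhds_neBot hv
  refine ⟨above_iff_eventually.2 ?_, below_iff_eventually.2 ?_⟩
  · filter_upwards [hv.1.eventually] with y hy using hp.trans_lt hy
  · filter_upwards [hv.2.eventually] with y hy using hy.trans_le hq

end PointGerm

open PointGerm

/-! ### Branches acting on germs and on steps with one jump -/

namespace Branch

variable {a b : EReal} (B : Branch a b)

/-- The first germ `lo⁺` of a branch. -/
def first : PointGerm := ⟨B.lo, 1⟩

/-- The last germ `hi⁻` of a branch. -/
def last : PointGerm := ⟨B.hi, -1⟩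

theorem first_mem : B.first ∈ interval B.lo B.hi := mem_interval_one.2 ⟨le_rfl, B.lo_lt_hi⟩

theorem last_mem : B.last ∈ interval B.lo B.hi := mem_interval_neg_one.2 ⟨B.lo_lt_hi, le_rfl⟩

theorem sign_of_strictMonoOn (h : StrictMonoOn B.f (Ioo B.lo B.hi)) : B.sign = 1 := if_pos h

theorem sign_of_not_strictMonoOn (h : ¬ StrictMonoOn B.f (Ioo B.lo B.hi)) : B.sign = -1 := if_neg h

theorem strictAntiOn_of_not_strictMonoOn (h : ¬ StrictMonoOn B.f (Ioo B.lo B.hi)) :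
    StrictAntiOn B.f (Ioo B.lo B.hi) := B.strict.resolve_left h

/-- Points close to the germ `v` are mapped to points close to the germ `f̂ v`. -/
theorem tendsto_germMap {v : PointGerm} (hv : v ∈ interval B.lo B.hi) :
    Tendsto B.f v.nhds (B.germMap v).nhds := by
  obtain ⟨u, e⟩ := v
  have hne := nhds_neBot hv
  rcases Int.units_eq_one_or e with rfl | rfl
  · obtain ⟨h1, h2⟩ := mem_interval_one.1 hv
    rw [nhds_one] at hne ⊢
    have hsub : Ioo u B.hi ⊆ Ioo B.lo B.hi := Ioo_subset_Ioo_left h1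
    by_cases hm : StrictMonoOn B.f (Ioo B.lo B.hi)
    · obtain ⟨L, hL⟩ := (hm.mono hsub).exists_tendsto_nhdsGT h2
      have e1 : B.germMap ⟨u, 1⟩ = ⟨L, 1⟩ := by
        simp [germMap, B.sign_of_strictMonoOn hm,
          rightLim_eq_of_tendsto (hL.mono_right nhdsWithin_le_nhds)]
      rwa [e1, nhds_one]
    · obtain ⟨L, hL⟩ := StrictMonoOn.exists_tendsto_nhdsGT (β := ERealᵒᵈ) (f := B.f) h2
        (((B.strictAntiOn_of_not_strictMonoOn hm).mono hsub).dual_right)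
      have hL' : Tendsto B.f (𝓝[>] u) (𝓝[<] (OrderDual.ofDual L)) := hL
      have e1 : B.germMap ⟨u, 1⟩ = ⟨OrderDual.ofDual L, -1⟩ := by
        simp [germMap, B.sign_of_not_strictMonoOn hm,
          rightLim_eq_of_tendsto (hL'.mono_right nhdsWithin_le_nhds)]
      rwa [e1, nhds_neg_one]
  · obtain ⟨h1, h2⟩ := mem_interval_neg_one.1 hv
    rw [nhds_neg_one] at hne ⊢
    have hsub : Ioo B.lo u ⊆ Ioo B.lo B.hi := Ioo_subset_Ioo_right h2
    have hd : OrderDual.ofDual ⁻¹' Ioo B.lo u = Ioo (OrderDual.toDual u) (OrderDual.toDual B.lo) := by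
      ext x
      exact and_comm
    by_cases hm : StrictMonoOn B.f (Ioo B.lo B.hi)
    · have hmd : StrictMonoOn (OrderDual.toDual ∘ B.f ∘ OrderDual.ofDual)
          (OrderDual.ofDual ⁻¹' Ioo B.lo u) := (hm.mono hsub).dual
      rw [hd] at hmd
      obtain ⟨L, hL⟩ := StrictMonoOn.exists_tendsto_nhdsGT
        (show OrderDual.toDual u < OrderDual.toDual B.lo from h1) hmd
      have hL' : Tendsto B.f (𝓝[<] u) (𝓝[<] (OrderDual.ofDual L)) := hL
      have e1 : B.germMap ⟨u, -1⟩ = ⟨OrderDual.ofDual L, -1⟩ := by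
        simp [germMap, B.sign_of_strictMonoOn hm, show (-1 : ℤˣ) ≠ 1 by decide,
          leftLim_eq_of_tendsto (hL'.mono_right nhdsWithin_le_nhds)]
      rwa [e1, nhds_neg_one]
    · have hmd : StrictMonoOn (B.f ∘ OrderDual.ofDual) (OrderDual.ofDual ⁻¹' Ioo B.lo u) :=
        ((B.strictAntiOn_of_not_strictMonoOn hm).mono hsub).dual_left
      rw [hd] at hmd
      obtain ⟨L, hL⟩ := StrictMonoOn.exists_tendsto_nhdsGT
        (show OrderDual.toDual u < OrderDual.toDual B.lo from h1) hmd
      have hL' : Tendsto B.f (𝓝[<] u) (𝓝[>] L) := hL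
      have e1 : B.germMap ⟨u, -1⟩ = ⟨L, 1⟩ := by
        simp [germMap, B.sign_of_not_strictMonoOn hm, show (-1 : ℤˣ) ≠ 1 by decide,
          leftLim_eq_of_tendsto (hL'.mono_right nhdsWithin_le_nhds)]
      rwa [e1, nhds_one]

theorem germMap_above {v : PointGerm} (hv : v ∈ interval B.lo B.hi) {y : EReal}
    (h : ∀ᶠ x in v.nhds, y < B.f x) : (B.germMap v).Above y := by
  have := nhds_neBot hv
  by_contra h'
  obtain ⟨x, h1, h2⟩ :=
    (h.and ((B.tendsto_germMap hv).eventually (not_above_iff.1 h').eventually)).exists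
  exact lt_asymm h1 h2

theorem germMap_below {v : PointGerm} (hv : v ∈ interval B.lo B.hi) {y : EReal}
    (h : ∀ᶠ x in v.nhds, B.f x < y) : (B.germMap v).Below y := by
  have := nhds_neBot hv
  rw [← not_above_iff]
  intro h'
  obtain ⟨x, h1, h2⟩ := (h.and ((B.tendsto_germMap hv).eventually h'.eventually)).exists
  exact lt_asymm h1 h2

theorem germMap_mem {v : PointGerm} (hv : v ∈ interval B.lo B.hi) :
    B.germMap v ∈ interval a b := by
  have h := (eventually_mem_Ioo hv).mono fun x hx => B.mapsTo hx
  exact ⟨B.germMap_above hv (h.mono fun x hx => hx.1), B.germMap_below hv (h.mono fun x hx => hx.2)⟩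

/-- A monotone branch preserves or reverses the order between x and v, and the sign of the branch
records which. -/
theorem sigma_germMap {v : PointGerm} (hv : v ∈ interval B.lo B.hi) {x : EReal}
    (hx : x ∈ Ioo B.lo B.hi) : sigma (B.f x) (B.germMap v) = ((B.sign : ℤ) : ℂ) * sigma x v := by
  have hI := eventually_mem_Ioo hv
  by_cases hm : StrictMonoOn B.f (Ioo B.lo B.hi)
  · rw [B.sign_of_strictMonoOn hm]
    by_cases h : v.Above x
    · rw [sigma_of_above h, sigma_of_above (B.germMap_above hv ?_)]
      · simp
      · filter_upwards [hI, h.eventually] with y hy hxy using hm hx hy hxy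
    · have h := not_above_iff.1 h
      rw [sigma_of_below h, sigma_of_below (B.germMap_below hv ?_)]
      · simp
      · filter_upwards [hI, h.eventually] with y hy hxy using hm hy hx hxy
  · rw [B.sign_of_not_strictMonoOn hm]
    have hm := B.strictAntiOn_of_not_strictMonoOn hm
    by_cases h : v.Above x
    · rw [sigma_of_above h, sigma_of_below (B.germMap_below hv ?_)]
      · simp
      · filter_upwards [hI, h.eventually] with y hy hxy using hm hx hy hxy
    · have h := not_above_iff.1 h
      rw [sigma_of_below h, sigma_of_above (B.germMap_above hv ?_)]
      · simp
      · filter_upwards [hI, h.eventually] with y hy hxy using hm hy hx hxy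

/-- The image of I is an interval, so a point outside it has the whole image, hence the images of
all germs of I, on one side. -/
theorem sigma_germMap_eq_of_notMem {v v' : PointGerm} (hv : v ∈ interval B.lo B.hi)
    (hv' : v' ∈ interval B.lo B.hi) {y : EReal} (hy : y ∉ B.f '' Ioo B.lo B.hi) :
    sigma y (B.germMap v) = sigma y (B.germMap v') := by
  have hI := eventually_mem_Ioo hv
  have hI' := eventually_mem_Ioo hv'
  have hoc : (B.f '' Ioo B.lo B.hi).OrdConnected :=
    (isPreconnected_Ioo.image _ B.continuousOn).ordConnected
  by_cases h : ∃ x ∈ Ioo B.lo B.hi, B.f x < y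
  · obtain ⟨x, hx, hxy⟩ := h
    have hall : ∀ x' ∈ Ioo B.lo B.hi, B.f x' < y := fun x' hx' => by
      by_contra hlt
      exact hy (hoc.out (mem_image_of_mem _ hx) (mem_image_of_mem _ hx') ⟨hxy.le, not_lt.1 hlt⟩)
    rw [sigma_of_below (B.germMap_below hv (hI.mono hall)),
      sigma_of_below (B.germMap_below hv' (hI'.mono hall))]
  · have hall : ∀ x' ∈ Ioo B.lo B.hi, y < B.f x' := fun x' hx' => by
      refine lt_of_le_of_ne (not_lt.1 fun h' => h ⟨x', hx', h'⟩) ?_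
      rintro rfl
      exact hy (mem_image_of_mem _ hx')
    rw [sigma_of_above (B.germMap_above hv (hI.mono hall)),
      sigma_of_above (B.germMap_above hv' (hI'.mono hall))]

open Classical in
/-- The transfer operator of a branch on the step function with a single jump at the germ `v`. -/
theorem transferFun_sigma (v : PointGerm) (y : Ioo a b) :
    B.transferFun (fun x => -sigma x v) y = -(((B.sign : ℤ) : ℂ) * B.g *
      ((if v ∈ interval B.lo B.hi then sigma y (B.germMap v) else 0) -
        sigma B.lo v * sigma y (B.germMap B.first) + sigma B.hi v * sigma y (B.germMap B.last))) := by
  have hs : ((B.sign : ℤ) : ℂ) * ((B.sign : ℤ) : ℂ) = 1 := by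
    rcases Int.units_eq_one_or B.sign with h | h <;> simp [h]
  by_cases hy : ∃ x : Ioo a b, (x : EReal) ∈ Ioo B.lo B.hi ∧ B.f x = y
  · obtain ⟨x, hx, hxy⟩ := hy
    rw [B.transferFun_of_mem _ hx hxy, ← hxy, B.sigma_germMap B.first_mem hx,
      B.sigma_germMap B.last_mem hx, sigma_of_below (v := B.first) (Or.inl hx.1),
      sigma_of_above (v := B.last) (Or.inl hx.2)]
    -- For v inside I the two end values of σ cancel; for v outside, σ is constant over I and equals
    -- their average.
    have key : sigma (x : EReal) v = (if v ∈ interval B.lo B.hi then sigma (x : EReal) v else 0) +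
        (sigma B.lo v + sigma B.hi v) / 2 := by
      by_cases h1 : v.Above B.lo
      · by_cases h2 : v.Above B.hi
        · have h3 : v.Above x := by
            rcases h2 with h | h
            · exact Or.inl (hx.2.trans h)
            · exact Or.inl (h.1 ▸ hx.2)
          rw [if_neg fun h => not_above_iff.2 h.2 h2, sigma_of_above h1, sigma_of_above h2,
            sigma_of_above h3]
          norm_num
        · rw [if_pos ⟨h1, not_above_iff.1 h2⟩, sigma_of_above h1,
            sigma_of_below (not_above_iff.1 h2)]
          ring
      · have h1' := not_above_iff.1 h1
        have h2 : v.Below B.hi := by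
          rcases h1' with h | h
          · exact Or.inl (h.trans B.lo_lt_hi)
          · exact Or.inl (h.1 ▸ B.lo_lt_hi)
        have h3 : v.Below x := by
          rcases h1' with h | h
          · exact Or.inl (h.trans hx.1)
          · exact Or.inl (h.1 ▸ hx.1)
        rw [if_neg fun h => h1 h.1, sigma_of_below h1', sigma_of_below h2, sigma_of_below h3]
        norm_num
    by_cases hv : v ∈ interval B.lo B.hi
    · rw [if_pos hv] at key ⊢
      rw [B.sigma_germMap hv hx]
      linear_combination (B.g * sigma (x : EReal) v + B.g * (sigma B.lo v + sigma B.hi v) / 2) * hs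
        - B.g * key
    · rw [if_neg hv] at key ⊢
      linear_combination (B.g * (sigma B.lo v + sigma B.hi v) / 2) * hs - B.g * key
  · rw [B.transferFun_of_notMem _ hy]
    have hy' : (y : EReal) ∉ B.f '' Ioo B.lo B.hi := fun h => hy ((B.mem_image_iff y).2 h)
    -- Off the image all σ_y factors agree, and their total coefficient vanishes: 1 - 1/2 - 1/2 if v
    -- ∈ Î, and -σ_lo(v) + σ_hi(v) = 0 otherwise.
    rw [B.sigma_germMap_eq_of_notMem B.last_mem B.first_mem hy']
    by_cases hv : v ∈ interval B.lo B.hi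
    · rw [if_pos hv, B.sigma_germMap_eq_of_notMem hv B.first_mem hy', sigma_of_above hv.1,
        sigma_of_below hv.2]
      ring
    · rw [if_neg hv]
      have h : sigma B.lo v = sigma B.hi v := by
        by_cases h1 : v.Above B.lo
        · have h2 : v.Above B.hi := by
            by_contra h2
            exact hv ⟨h1, not_above_iff.1 h2⟩
          rw [sigma_of_above h1, sigma_of_above h2]
        · have h1' := not_above_iff.1 h1
          have h2 : v.Below B.hi := by
            rcases h1' with h | h
            · exact Or.inl (h.trans B.lo_lt_hi)
            · exact Or.inl (h.1 ▸ B.lo_lt_hi)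
          rw [sigma_of_below h1', sigma_of_below h2]
      rw [h]
      ring

end Branch

end Rugh


namespace Rugh

open PointGerm

/-! ### Jumps of simple step functions -/

theorem PointGerm.exists_ordConnected_mem_nhds {v : PointGerm} {p q : EReal}
    (hv : v ∈ interval p q) {s : Set EReal} (hs : s ∈ v.nhds) :
    ∃ t ∈ v.nhds, t ⊆ s ∧ t.OrdConnected := by
  obtain ⟨u, e⟩ := v
  rcases Int.units_eq_one_or e with rfl | rfl
  · rw [nhds_one] at hs ⊢
    obtain ⟨r, hr, hrs⟩ := (mem_nhdsGT_iff_exists_Ioo_subset' (mem_interval_one.1 hv).2).1 hs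
    exact ⟨_, Ioo_mem_nhdsGT hr, hrs, ordConnected_Ioo⟩
  · rw [nhds_neg_one] at hs ⊢
    obtain ⟨r, hr, hrs⟩ := (mem_nhdsLT_iff_exists_Ioo_subset' (mem_interval_neg_one.1 hv).1).1 hs
    exact ⟨_, Ioo_mem_nhdsLT hr, hrs, ordConnected_Ioo⟩

theorem PointGerm.nhds_le_nhdsNE (v : PointGerm) : v.nhds ≤ 𝓝[≠] v.base := by
  rw [PointGerm.nhds]
  split_ifs
  · exact nhdsWithin_mono _ fun x hx => ne_of_gt hx
  · exact nhdsWithin_mono _ fun x hx => ne_of_lt hx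

section Jumps

variable {a b : EReal}

/-- One-sided neighbourhoods of a germ in `(a,b)`. -/
def PointGerm.nhdsIoo (a b : EReal) (v : PointGerm) : Filter (Ioo a b) :=
  comap Subtype.val v.nhds

theorem PointGerm.nhdsIoo_neBot {v : PointGerm} (hv : v ∈ interval a b) :
    (v.nhdsIoo a b).NeBot := by
  refine (nhds_neBot hv).comap_of_range_mem ?_
  rw [Subtype.range_coe]
  exact eventually_mem_Ioo hv

/-- The value of a function at a germ. -/
def germVal (φ : Ioo a b → ℂ) (v : PointGerm) : ℂ := limUnder (v.nhdsIoo a b) φ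

/-- A one-sided neighbourhood omits the base point and, when small and order-connected, avoids the
finite exceptional set. -/
theorem IsSimpleStep.eventually_eq_germVal {φ : Ioo a b → ℂ} (hφ : IsSimpleStep φ) {v : PointGerm}
    (hv : v ∈ interval a b) : ∀ᶠ x in v.nhdsIoo a b, φ x = germVal φ v := by
  have hne := nhdsIoo_neBot hv
  obtain ⟨C, hC, h⟩ := hφ
  have hs : (Subtype.val '' C)ᶜ ∈ v.nhds := by
    refine v.nhds_le_nhdsNE ?_
    have h1 : ((Subtype.val '' C) \ {v.base})ᶜ ∈ 𝓝 v.base :=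
      ((hC.image _).subset sdiff_subset).isClosed.compl_mem_nhds fun h => h.2 rfl
    filter_upwards [nhdsWithin_le_nhds h1, self_mem_nhdsWithin] with x hx hx' hxC
    exact hx ⟨hxC, hx'⟩
  obtain ⟨t, ht, hts, hoc⟩ := exists_ordConnected_mem_nhds hv hs
  have key : ∀ x y : Ioo a b, (x : EReal) ∈ t → (y : EReal) ∈ t → φ x = φ y := by
    have aux : ∀ x y : Ioo a b, x ≤ y → (x : EReal) ∈ t → (y : EReal) ∈ t → φ x = φ y :=
      fun x y hxy hx hy => h x y hxy (Set.disjoint_left.2 fun c hc hcC =>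
        hts (hoc.out hx hy (show (c : EReal) ∈ Icc (x : EReal) y from ⟨hc.1, hc.2⟩))
          (mem_image_of_mem _ hcC))
    intro x y hx hy
    rcases le_total x y with hxy | hxy
    · exact aux x y hxy hx hy
    · exact (aux y x hxy hy hx).symm
  have ht' : ∀ᶠ x : Ioo a b in v.nhdsIoo a b, (x : EReal) ∈ t := preimage_mem_comap ht
  obtain ⟨x₀, hx₀⟩ := ht'.exists
  have hconst : ∀ᶠ x in v.nhdsIoo a b, φ x = φ x₀ := ht'.mono fun x hx => key x x₀ hx hx₀
  have hlim : germVal φ v = φ x₀ := (tendsto_const_nhds.congr' (hconst.mono fun _ h => h.symm) :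
    Tendsto φ (v.nhdsIoo a b) (𝓝 (φ x₀))).limUnder_eq
  rw [hlim]
  exact hconst

theorem germVal_eq_of_eventually {φ : Ioo a b → ℂ} {v : PointGerm} (hv : v ∈ interval a b) {c : ℂ}
    (h : ∀ᶠ x in v.nhdsIoo a b, φ x = c) : germVal φ v = c := by
  have hne := nhdsIoo_neBot hv
  exact (tendsto_const_nhds.congr' (h.mono fun _ h => h.symm) :
    Tendsto φ (v.nhdsIoo a b) (𝓝 c)).limUnder_eq

open Classical in
/-- The jump of `φ` at a germ: `φ(x⁺) - φ(x)` at `x⁺` and `φ(x) - φ(x⁻)` at `x⁻` for `x ∈ (a,b)`,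
`∂φ` at `a⁺` and `0` at `b⁻`. -/
def jump (φ : Ioo a b → ℂ) (v : PointGerm) : ℂ :=
  if h : v.base ∈ Ioo a b then ((v.dir : ℤ) : ℂ) * (germVal φ v - φ ⟨v.base, h⟩)
  else if v.dir = 1 then boundary φ else 0

theorem mem_interval_of_base_notMem {v : PointGerm} (hv : v ∈ interval a b)
    (h : v.base ∉ Ioo a b) : v = ⟨a, 1⟩ ∨ v = ⟨b, -1⟩ := by
  obtain ⟨u, e⟩ := v
  rcases Int.units_eq_one_or e with rfl | rfl
  · obtain ⟨h1, h2⟩ := mem_interval_one.1 hv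
    left
    rcases h1.eq_or_lt with rfl | h1
    · rfl
    · exact absurd ⟨h1, h2⟩ h
  · obtain ⟨h1, h2⟩ := mem_interval_neg_one.1 hv
    right
    rcases h2.eq_or_lt with rfl | h2
    · rfl
    · exact absurd ⟨h1, h2⟩ h

theorem jump_first (φ : Ioo a b → ℂ) : jump φ ⟨a, 1⟩ = boundary φ := by
  rw [jump, dif_neg (fun h => lt_irrefl _ h.1), if_pos rfl]

theorem jump_last (φ : Ioo a b → ℂ) : jump φ ⟨b, -1⟩ = 0 := by
  rw [jump, dif_neg (fun h => lt_irrefl _ h.2), if_neg (show (-1 : ℤˣ) ≠ 1 by decide)]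

theorem IsSimpleStep.finite_jump_ne_zero {φ : Ioo a b → ℂ} (hφ : IsSimpleStep φ) :
    {v : interval a b | jump φ v ≠ 0}.Finite := by
  have hev := fun v : interval a b => hφ.eventually_eq_germVal v.2
  obtain ⟨C, hC, h⟩ := hφ
  -- The point a is added because the boundary value is stored as the jump at a⁺.
  set D : Set EReal := insert a (Subtype.val '' C)
  have hD : D.Finite := (hC.image _).insert a
  have hfin : ((fun v : PointGerm => (v.base, v.dir)) ⁻¹' (D ×ˢ (univ : Set ℤˣ))).Finite :=
    (hD.prod finite_univ).preimage fun v _ w _ h => PointGerm.ext (congrArg Prod.fst h)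
      (congrArg Prod.snd h)
  refine (hfin.preimage Subtype.val_injective.injOn).subset fun v hv => ?_
  refine ⟨?_, mem_univ _⟩
  by_contra hvD
  refine hv ?_
  have hb : v.1.base ∈ Ioo a b := by
    by_contra hb
    rcases mem_interval_of_base_notMem v.2 hb with h' | h'
    · exact hvD (Or.inl (congrArg base h'))
    · exact hv (by rw [h', jump_last])
  have hs : (Subtype.val '' C)ᶜ ∈ 𝓝 v.1.base :=
    (hC.image _).isClosed.compl_mem_nhds fun h => hvD (Or.inr h)
  obtain ⟨t, ht, hxt, hts⟩ : ∃ t : Set EReal, t ∈ 𝓝 v.1.base ∧ t.OrdConnected ∧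
      t ⊆ (Subtype.val '' C)ᶜ := by
    obtain ⟨l, u, hlu, hsub⟩ := (mem_nhds_iff_exists_Ioo_subset' ⟨a, hb.1⟩ ⟨b, hb.2⟩).1 hs
    exact ⟨_, Ioo_mem_nhds hlu.1 hlu.2, ordConnected_Ioo, hsub⟩
  have hne := nhdsIoo_neBot v.2
  have ht' : ∀ᶠ x : Ioo a b in v.1.nhdsIoo a b, (x : EReal) ∈ t :=
    preimage_mem_comap (v.1.nhds_le_nhdsNE (nhdsWithin_le_nhds ht))
  obtain ⟨x, hx1, hx2⟩ := ((hev v).and ht').exists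
  have hbt : v.1.base ∈ t := mem_of_mem_nhds ht
  have aux : ∀ x y : Ioo a b, x ≤ y → (x : EReal) ∈ t → (y : EReal) ∈ t → φ x = φ y :=
    fun x y hxy hx hy => h x y hxy (Set.disjoint_left.2 fun c hc hcC =>
      hts (hxt.out hx hy (show (c : EReal) ∈ Icc (x : EReal) y from ⟨hc.1, hc.2⟩))
        (mem_image_of_mem _ hcC))
  rw [jump, dif_pos hb, ← hx1]
  rcases le_total x ⟨v.1.base, hb⟩ with hxy | hxy
  · rw [aux _ _ hxy hx2 hbt, sub_self, mul_zero]
  · rw [aux _ _ hxy hbt hx2, sub_self, mul_zero]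

/-- Jumps are dominated by the increments of a function that dominates those of `φ`. -/
theorem IsSimpleStep.norm_jump_le {φ : Ioo a b → ℂ} (hφ : IsSimpleStep φ) {W : Ioo a b → ℝ}
    (hW : ∀ x y, x ≤ y → ‖φ y - φ x‖ ≤ W y - W x) {v : PointGerm} (hv : v ∈ interval a b)
    (hb : v.base ∈ Ioo a b) {x y : Ioo a b} (hx : (x : EReal) < v.base) (hy : v.base < y) :
    ‖jump φ v‖ ≤ W y - W x := by
  have hmono : Monotone W := fun p q hpq => by linarith [norm_nonneg (φ q - φ p), hW p q hpq]
  have hev := hφ.eventually_eq_germVal hv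
  have hne := nhdsIoo_neBot hv
  rw [jump, dif_pos hb, norm_mul]
  obtain ⟨u, e⟩ := v
  simp only at hb hx hy ⊢
  set c : Ioo a b := ⟨u, hb⟩
  rcases Int.units_eq_one_or e with rfl | rfl
  · have h1 : ∀ᶠ z : Ioo a b in nhdsIoo a b ⟨u, 1⟩, (z : EReal) ∈ Ioo u y := by
      refine preimage_mem_comap ?_
      rw [nhds_one]
      exact Ioo_mem_nhdsGT hy
    obtain ⟨z, hz1, hz2⟩ := (hev.and h1).exists
    rw [← hz1]
    have h2 := hW c z hz2.1.le
    have h3 := hmono (show z ≤ y from hz2.2.le)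
    have h4 := hmono (show x ≤ c from hx.le)
    simp only [Units.val_one, Int.cast_one, norm_one, one_mul]
    linarith
  · have h1 : ∀ᶠ z : Ioo a b in nhdsIoo a b ⟨u, -1⟩, (z : EReal) ∈ Ioo (x : EReal) u := by
      refine preimage_mem_comap ?_
      rw [nhds_neg_one]
      exact Ioo_mem_nhdsLT hx
    obtain ⟨z, hz1, hz2⟩ := (hev.and h1).exists
    rw [← hz1, norm_sub_rev]
    have h2 := hW z c hz2.2.le
    have h3 := hmono (show x ≤ z from hz2.1.le)
    have h4 := hmono (show c ≤ y from hy.le)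
    simp only [Units.val_neg, Units.val_one, Int.cast_neg, Int.cast_one, norm_neg, norm_one,
      one_mul]
    linarith

/-! ### Step functions with a single jump -/

/-- The step function with value `-1/2` before and `1/2` after the germ `v`. -/
def stepGerm (v : PointGerm) : SimpleStep a b :=
  ⟨fun x => -sigma x v, by
    refine ⟨{x | (x : EReal) = v.base}, Set.Subsingleton.finite fun x hx y hy =>
      Subtype.ext (Eq.trans hx (Eq.symm hy)), fun x y hxy hd => ?_⟩
    have hxy' : (x : EReal) ≤ y := hxy
    have hno : ¬ ((x : EReal) ≤ v.base ∧ v.base ≤ y) := fun h =>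
      Set.disjoint_left.1 hd (show (⟨v.base, x.2.1.trans_le h.1, h.2.trans_lt y.2.2⟩ : Ioo a b) ∈
        Icc x y from ⟨h.1, h.2⟩) rfl
    change -sigma x v = -sigma y v
    rcases lt_or_ge v.base (x : EReal) with h | h
    · rw [sigma_of_below (Or.inl h), sigma_of_below (Or.inl (h.trans_le hxy'))]
    · have h' : (y : EReal) < v.base := not_le.1 fun h' => hno ⟨h, h'⟩
      rw [sigma_of_above (Or.inl h'), sigma_of_above (Or.inl (hxy'.trans_lt h'))]⟩

theorem stepGerm_fn (v : PointGerm) (x : Ioo a b) : (stepGerm v : SimpleStep a b).fn x = -sigma x v :=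
  rfl

/-- Both end germs give constants, -1/2 and 1/2. This is the redundancy of the coding by jumps. -/
theorem stepGerm_last : (stepGerm ⟨b, -1⟩ : SimpleStep a b) = -stepGerm ⟨a, 1⟩ := by
  rw [← neg_one_smul ℂ]
  refine SimpleStep.ext (funext fun x => ?_)
  rw [SimpleStep.fn_smul, Pi.smul_apply, stepGerm_fn, stepGerm_fn, sigma_of_above (Or.inl x.2.2),
    sigma_of_below (Or.inl x.2.1)]
  simp

/-- Telescoping from left to right: remove the germ with the largest base point and insert a point x
just to its left. The direction is fixed so that distinct germs have distinct base points. -/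
theorem IsSimpleStep.sum_norm_jump_le_aux {φ : Ioo a b → ℂ} (hφ : IsSimpleStep φ)
    {W : Ioo a b → ℝ} (hW0 : ∀ x, 0 ≤ W x) (hW : ∀ x y, x ≤ y → ‖φ y - φ x‖ ≤ W y - W x) (e : ℤˣ)
    (F : Finset (interval a b)) (hF : ∀ v ∈ F, v.1.base ∈ Ioo a b ∧ v.1.dir = e) (y : Ioo a b)
    (hy : ∀ v ∈ F, v.1.base < (y : EReal)) : ∑ v ∈ F, ‖jump φ v‖ ≤ W y := by
  classical
  revert hF y
  refine Finset.induction_on_max_value (fun v : interval a b => v.1.base) F ?_ ?_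
  · intro _ y _
    simpa using hW0 y
  · intro v F hvF hmax ih hF y hy
    obtain ⟨hvb, hve⟩ := hF v (Finset.mem_insert_self _ _)
    have hlt : ∀ w ∈ F, w.1.base < v.1.base := fun w hw => by
      refine lt_of_le_of_ne (hmax w hw) fun h => hvF ?_
      have : w = v := Subtype.ext (PointGerm.ext h
        ((hF w (Finset.mem_insert_of_mem hw)).2.trans hve.symm))
      exact this ▸ hw
    obtain ⟨x, hx, hxv⟩ : ∃ x : Ioo a b, (∀ w ∈ F, w.1.base < (x : EReal)) ∧
        (x : EReal) < v.1.base := by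
      have h1 : ∀ᶠ x in 𝓝[<] v.1.base, ∀ w ∈ F, w.1.base < x :=
        (Filter.eventually_all_finset F).2 fun w hw => nhdsWithin_le_nhds (Ioi_mem_nhds (hlt w hw))
      have hne : (𝓝[<] v.1.base).NeBot := nhdsLT_neBot_of_exists_lt ⟨a, hvb.1⟩
      obtain ⟨x, h2, h3⟩ := (h1.and (Ioo_mem_nhdsLT hvb.1)).exists
      exact ⟨⟨x, h3.1, h3.2.trans hvb.2⟩, h2, h3.2⟩
    rw [Finset.sum_insert hvF]
    have h4 := ih (fun w hw => hF w (Finset.mem_insert_of_mem hw)) x hx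
    have h5 := hφ.norm_jump_le hW v.2 hvb hxv (hy v (Finset.mem_insert_self _ _))
    linarith

variable [hab : Fact (a < b)]

theorem first_mem_interval : (⟨a, 1⟩ : PointGerm) ∈ interval a b :=
  mem_interval_one.2 ⟨le_rfl, hab.out⟩

theorem last_mem_interval : (⟨b, -1⟩ : PointGerm) ∈ interval a b :=
  mem_interval_neg_one.2 ⟨hab.out, le_rfl⟩

/-- The germs of each direction contribute at most the variation and the end germs at most |∂φ|; the
factor 2 counts the two directions. -/
theorem SimpleStep.sum_norm_jump_le (φ : SimpleStep a b) (F : Finset (interval a b)) :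
    ∑ v ∈ F, ‖jump φ.fn v‖ ≤ 2 * ‖φ‖ := by
  classical
  have hφ := φ.isSimpleStep
  obtain ⟨W, hW0, hW1, hW⟩ := exists_increments hφ.boundedVariationOn
  have key (e : ℤˣ) : ∑ v ∈ F with v.1.base ∈ Ioo a b ∧ v.1.dir = e, ‖jump φ.fn v‖ ≤
      variation φ.fn := by
    obtain ⟨y, hy⟩ : ∃ y : Ioo a b, ∀ v ∈ F.filter (fun v : interval a b => v.1.base ∈ Ioo a b ∧ v.1.dir = e),
        v.1.base < (y : EReal) := by
      have h1 : ∀ᶠ x in 𝓝[<] b, ∀ v ∈ F.filter (fun v : interval a b => v.1.base ∈ Ioo a b ∧ v.1.dir = e),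
          v.1.base < x := (Filter.eventually_all_finset _).2 fun w hw =>
        nhdsWithin_le_nhds (Ioi_mem_nhds (Finset.mem_filter.1 hw).2.1.2)
      have hne : (𝓝[<] b).NeBot := nhdsLT_neBot_of_exists_lt ⟨a, hab.out⟩
      obtain ⟨x, h2, h3⟩ := (h1.and (Ioo_mem_nhdsLT hab.out)).exists
      exact ⟨⟨x, h3⟩, h2⟩
    exact (hφ.sum_norm_jump_le_aux hW0 hW e _ (fun v hv => (Finset.mem_filter.1 hv).2) y hy).trans
      (hW1 y)
  have hends : ∑ v ∈ F with v.1.base ∉ Ioo a b, ‖jump φ.fn v‖ ≤ ‖boundary φ.fn‖ := by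
    have h1 : ∀ v ∈ F.filter (fun v : interval a b => v.1.base ∉ Ioo a b), ‖jump φ.fn v‖ =
        if v = ⟨⟨a, 1⟩, first_mem_interval⟩ then ‖boundary φ.fn‖ else 0 := fun v hv => by
      rcases mem_interval_of_base_notMem v.2 (Finset.mem_filter.1 hv).2 with h | h
      · rw [if_pos (Subtype.ext h), h, jump_first]
      · rw [if_neg, h, jump_last, norm_zero]
        intro h'
        rw [h'] at h
        exact absurd (congrArg dir h) (show (1 : ℤˣ) ≠ -1 by decide)
    rw [Finset.sum_congr rfl h1, Finset.sum_ite_eq']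
    split_ifs
    · exact le_rfl
    · exact norm_nonneg _
  have hsplit : ∑ v ∈ F, ‖jump φ.fn v‖ =
      ∑ v ∈ F with v.1.base ∈ Ioo a b ∧ v.1.dir = 1, ‖jump φ.fn v‖ +
      ∑ v ∈ F with v.1.base ∈ Ioo a b ∧ v.1.dir = -1, ‖jump φ.fn v‖ +
      ∑ v ∈ F with v.1.base ∉ Ioo a b, ‖jump φ.fn v‖ := by
    simp only [Finset.sum_filter, ← Finset.sum_add_distrib]
    refine Finset.sum_congr rfl fun v _ => ?_
    by_cases h : v.1.base ∈ Ioo a b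
    · rcases Int.units_eq_one_or v.1.dir with h' | h' <;>
        simp [h, h', show (1 : ℤˣ) ≠ -1 by decide, show (-1 : ℤˣ) ≠ 1 by decide]
    · simp [h]
  rw [hsplit, SimpleStep.norm_def]
  linarith [key 1, key (-1), norm_nonneg (boundary φ.fn)]

theorem jump_add (φ ψ : SimpleStep a b) (v : interval a b) :
    jump (φ + ψ).fn v = jump φ.fn v + jump ψ.fn v := by
  have h : germVal (φ + ψ).fn v = germVal φ.fn v + germVal ψ.fn v := by
    refine germVal_eq_of_eventually v.2 ?_
    filter_upwards [φ.isSimpleStep.eventually_eq_germVal v.2,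
      ψ.isSimpleStep.eventually_eq_germVal v.2] with x h1 h2
    rw [SimpleStep.fn_add, Pi.add_apply, h1, h2]
  simp only [jump, h]
  split_ifs
  · rw [SimpleStep.fn_add, Pi.add_apply]
    ring
  · rw [SimpleStep.fn_add, φ.isSimpleStep.boundary_add ψ.isSimpleStep]
  · simp

theorem jump_smul (t : ℂ) (φ : SimpleStep a b) (v : interval a b) :
    jump (t • φ).fn v = t * jump φ.fn v := by
  have h : germVal (t • φ).fn v = t * germVal φ.fn v := by
    refine germVal_eq_of_eventually v.2 ?_
    filter_upwards [φ.isSimpleStep.eventually_eq_germVal v.2] with x h1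
    rw [SimpleStep.fn_smul, Pi.smul_apply, h1, smul_eq_mul]
  simp only [jump, h]
  split_ifs
  · rw [SimpleStep.fn_smul, Pi.smul_apply, smul_eq_mul]
    ring
  · rw [SimpleStep.fn_smul, φ.isSimpleStep.boundary_smul]
  · simp

/-- The jump at a germ as a linear functional. -/
def jumpLinear (v : interval a b) : SimpleStep a b →ₗ[ℂ] ℂ where
  toFun φ := jump φ.fn v
  map_add' φ ψ := jump_add φ ψ v
  map_smul' t φ := jump_smul t φ v

theorem jumpLinear_apply (v : interval a b) (φ : SimpleStep a b) :
    jumpLinear v φ = jump φ.fn v := rfl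

/-- A simple step function without jumps vanishes. -/
theorem SimpleStep.eq_zero_of_jump_eq_zero {φ : SimpleStep a b}
    (h : ∀ v : interval a b, jump φ.fn v = 0) : φ = 0 := by
  -- Vanishing jumps at x⁺ and x⁻ make φ constant near x, so φ is constant on the connected
  -- interval; the jump at a⁺ is then twice that constant.
  have hloc : IsLocallyConstant φ.fn := by
    rw [IsLocallyConstant.iff_eventually_eq]
    intro x
    have hx : ∀ e : ℤˣ, (⟨x, e⟩ : PointGerm) ∈ interval a b := fun e => by
      rcases Int.units_eq_one_or e with rfl | rfl
      · exact mem_interval_one.2 ⟨x.2.1.le, x.2.2⟩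
      · exact mem_interval_neg_one.2 ⟨x.2.1, x.2.2.le⟩
    have hval : ∀ e : ℤˣ, ∀ᶠ y in nhdsIoo a b ⟨x, e⟩, φ.fn y = φ.fn x := fun e => by
      have h1 := h ⟨_, hx e⟩
      rw [jump, dif_pos (show _ ∈ Ioo a b from x.2)] at h1
      have h2 := (mul_eq_zero.1 h1).resolve_left (by
        rcases Int.units_eq_one_or e with rfl | rfl <;> simp)
      filter_upwards [φ.isSimpleStep.eventually_eq_germVal (hx e)] with y hy
      rw [hy]
      exact sub_eq_zero.1 h2
    have h1 := hval 1
    have h2 := hval (-1)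
    rw [nhdsIoo, nhds_one, eventually_comap] at h1
    rw [nhdsIoo, nhds_neg_one, eventually_comap] at h2
    rw [nhds_subtype_eq_comap, eventually_comap]
    rw [← nhdsNE_sup_pure, ← nhdsLT_sup_nhdsGT, eventually_sup, eventually_sup]
    refine ⟨⟨h2, h1⟩, ?_⟩
    rw [eventually_pure]
    intro y hy
    rw [Subtype.ext hy]
  have hpre : PreconnectedSpace (Ioo a b) := Subtype.preconnectedSpace isPreconnected_Ioo
  set x₀ : Ioo a b := Classical.arbitrary _
  have hconst : ∀ x, φ.fn x = φ.fn x₀ := fun x => hloc.apply_eq_of_preconnectedSpace x x₀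
  have hb : boundary φ.fn = φ.fn x₀ + φ.fn x₀ := by
    have h1 : Tendsto φ.fn atBot (𝓝 (φ.fn x₀)) :=
      tendsto_const_nhds.congr fun x => (hconst x).symm
    have h2 : Tendsto φ.fn atTop (𝓝 (φ.fn x₀)) :=
      tendsto_const_nhds.congr fun x => (hconst x).symm
    rw [boundary, h1.limUnder_eq, h2.limUnder_eq]
  have h0 := h ⟨_, first_mem_interval⟩
  rw [jump_first, hb, ← two_mul] at h0
  have h0 := (mul_eq_zero.1 h0).resolve_left two_ne_zero
  refine SimpleStep.ext (funext fun x => ?_)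
  rw [hconst x, h0]
  rfl

theorem norm_sigma (v : PointGerm) (x : EReal) : ‖sigma x v‖ = 1 / 2 := by
  rw [sigma]
  split_ifs <;> simp

theorem norm_stepGerm_le (v : PointGerm) : ‖(stepGerm v : SimpleStep a b)‖ ≤ 2 := by
  classical
  have h1 : variation (stepGerm v : SimpleStep a b).fn ≤ 1 := by
    refine variation_le_of_increments (fun x => if v.Above x then 0 else 1) 1 (fun x => ?_)
      (fun x => ?_) fun x y hxy => ?_
    · split_ifs <;> norm_num
    · split_ifs <;> norm_num
    · rw [stepGerm_fn, stepGerm_fn]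
      by_cases hx : v.Above x <;> by_cases hy : v.Above y
      · simp [hx, hy, sigma_of_above]
      · simp only [hx, hy, sigma_of_above hx, sigma_of_below (not_above_iff.1 hy), if_true, if_false]
        norm_num
      · exfalso
        have hxy' : (x : EReal) ≤ y := hxy
        rcases not_above_iff.1 hx with h | h <;> rcases hy with h' | h'
        · exact lt_asymm (h'.trans h) (lt_of_le_of_ne hxy' (h'.trans h).ne')
        · exact (h'.1 ▸ h).not_ge hxy'
        · exact (h.1 ▸ h').not_ge hxy'
        · exact absurd (h.2.symm.trans h'.2) (by decide)
      · simp [hx, hy, sigma_of_below (not_above_iff.1 hx), sigma_of_below (not_above_iff.1 hy)]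
  obtain ⟨c, hc⟩ := (stepGerm v : SimpleStep a b).isSimpleStep.exists_eventually_atBot
  obtain ⟨e, he⟩ := (stepGerm v : SimpleStep a b).isSimpleStep.exists_eventually_atTop
  have hb : ∀ x, ‖(stepGerm v : SimpleStep a b).fn x‖ ≤ 1 / 2 := fun x => by
    rw [stepGerm_fn, norm_neg, norm_sigma]
  have h2 : ‖c‖ ≤ 1 / 2 := le_of_tendsto hc.norm (Eventually.of_forall hb)
  have h3 : ‖e‖ ≤ 1 / 2 := le_of_tendsto he.norm (Eventually.of_forall hb)
  rw [SimpleStep.norm_def, boundary, hc.limUnder_eq, he.limUnder_eq]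
  linarith [norm_add_le c e]

open Classical in
-- The germ b⁻ is excluded: its step is minus that of a⁺, so its only jump sits at a⁺ with value -1.
theorem jump_stepGerm (v w : interval a b) (hw : w.1 ≠ ⟨b, -1⟩) :
    jump (stepGerm w.1 : SimpleStep a b).fn v = if v = w then 1 else 0 := by
  obtain ⟨w, hwm⟩ := w
  obtain ⟨v, hvm⟩ := v
  simp only [Subtype.mk.injEq] at hw ⊢
  have hwb : w.base < b := by
    rcases hwm.2 with h | h
    · exact h
    · exact absurd (PointGerm.ext h.1 h.2) hw
  have hgerm (c : ℂ) (h : ∀ᶠ x in v.nhds, -sigma x w = c) :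
      germVal (stepGerm w : SimpleStep a b).fn v = c :=
    germVal_eq_of_eventually hvm ((eventually_comap.2 (h.mono fun x hx y hy => by
      rw [stepGerm_fn, hy, hx])))
  by_cases hb : v.base ∈ Ioo a b
  · rw [jump, dif_pos hb, stepGerm_fn]
    obtain ⟨x, e⟩ := v
    simp only at hb ⊢
    rcases Int.units_eq_one_or e with rfl | rfl
    · rw [nhds_one] at hgerm
      rcases lt_trichotomy w.base x with h | h | h
      · rw [hgerm (1 / 2), sigma_of_below (Or.inl h), if_neg]
        · norm_num
        · rintro rfl
          exact lt_irrefl _ h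
        · filter_upwards [self_mem_nhdsWithin] with y hy
          rw [sigma_of_below (Or.inl (h.trans hy)), neg_neg]
      · rw [hgerm (1 / 2)]
        · rcases Int.units_eq_one_or w.dir with h' | h'
          · rw [sigma_of_above (Or.inr ⟨h, h'⟩), if_pos (PointGerm.ext h.symm h'.symm)]
            norm_num
          · rw [sigma_of_below (Or.inr ⟨h, h'⟩), if_neg]
            · norm_num
            · rintro rfl
              exact absurd h' (show (1 : ℤˣ) ≠ -1 by decide)
        · filter_upwards [self_mem_nhdsWithin] with y hy
          rw [sigma_of_below (Or.inl (h ▸ hy)), neg_neg]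
      · rw [hgerm (-(1 / 2)), sigma_of_above (Or.inl h), if_neg]
        · norm_num
        · rintro rfl
          exact lt_irrefl _ h
        · filter_upwards [nhdsWithin_le_nhds (Iio_mem_nhds h)] with y hy
          rw [sigma_of_above (Or.inl hy)]
    · rw [nhds_neg_one] at hgerm
      rcases lt_trichotomy w.base x with h | h | h
      · rw [hgerm (1 / 2), sigma_of_below (Or.inl h), if_neg]
        · norm_num
        · rintro rfl
          exact lt_irrefl _ h
        · filter_upwards [nhdsWithin_le_nhds (Ioi_mem_nhds h)] with y hy
          rw [sigma_of_below (Or.inl hy), neg_neg]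
      · rw [hgerm (-(1 / 2))]
        · rcases Int.units_eq_one_or w.dir with h' | h'
          · rw [sigma_of_above (Or.inr ⟨h, h'⟩), if_neg]
            · norm_num
            · rintro rfl
              exact absurd h' (show (-1 : ℤˣ) ≠ 1 by decide)
          · rw [sigma_of_below (Or.inr ⟨h, h'⟩), if_pos (PointGerm.ext h.symm h'.symm)]
            norm_num
        · filter_upwards [self_mem_nhdsWithin] with y hy
          rw [sigma_of_above (Or.inl (h ▸ hy))]
      · rw [hgerm (-(1 / 2)), sigma_of_above (Or.inl h), if_neg]
        · norm_num
        · rintro rfl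
          exact lt_irrefl _ h
        · filter_upwards [self_mem_nhdsWithin] with y hy
          rw [sigma_of_above (Or.inl (lt_trans hy h))]
  · rcases mem_interval_of_base_notMem hvm hb with rfl | rfl
    · have htop : Tendsto (stepGerm w : SimpleStep a b).fn atTop (𝓝 (1 / 2)) := by
        obtain ⟨y, hy1, hy2⟩ := exists_between (max_lt hwb hab.out)
        refine tendsto_const_nhds.congr' ?_
        filter_upwards [eventually_ge_atTop (⟨y, (le_max_right _ _).trans_lt hy1, hy2⟩ : Ioo a b)]
          with z hz
        have hz' : y ≤ z := hz
        rw [stepGerm_fn, sigma_of_below (Or.inl (((le_max_left _ _).trans_lt hy1).trans_le hz')),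
          neg_neg]
      rw [jump_first]
      by_cases hwa : w = ⟨a, 1⟩
      · have hbot : Tendsto (stepGerm w : SimpleStep a b).fn atBot (𝓝 (1 / 2)) := by
          refine tendsto_const_nhds.congr fun z => ?_
          rw [stepGerm_fn, hwa, sigma_of_below (Or.inl z.2.1), neg_neg]
        rw [boundary, hbot.limUnder_eq, htop.limUnder_eq, if_pos hwa.symm]
        norm_num
      · have hwa' : a < w.base := by
          rcases hwm.1 with h | h
          · exact h
          · exact absurd (PointGerm.ext h.1 h.2) hwa
        have hbot : Tendsto (stepGerm w : SimpleStep a b).fn atBot (𝓝 (-(1 / 2))) := by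
          obtain ⟨y, hy1, hy2⟩ := exists_between (lt_min hwa' hab.out)
          refine tendsto_const_nhds.congr' ?_
          filter_upwards [eventually_le_atBot (⟨y, hy1, hy2.trans_le (min_le_right _ _)⟩ : Ioo a b)]
            with z hz
          have hz' : (z : EReal) ≤ y := hz
          rw [stepGerm_fn, sigma_of_above (Or.inl (hz'.trans_lt (hy2.trans_le (min_le_left _ _))))]
        rw [boundary, hbot.limUnder_eq, htop.limUnder_eq, if_neg (Ne.symm hwa)]
        norm_num
    · rw [jump_last, if_neg (Ne.symm hw)]

/-- A simple step function is the sum of its jumps. -/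
theorem SimpleStep.eq_sum_jump (φ : SimpleStep a b) {F : Finset (interval a b)}
    (hF : ∀ v : interval a b, jump φ.fn v ≠ 0 → v ∈ F) :
    φ = ∑ v ∈ F, jump φ.fn v • (stepGerm v.1 : SimpleStep a b) := by
  classical
  rw [← sub_eq_zero]
  refine SimpleStep.eq_zero_of_jump_eq_zero fun u => ?_
  rw [← jumpLinear_apply, map_sub, map_sum]
  have h : ∀ v ∈ F, jumpLinear u (jump φ.fn v • (stepGerm v.1 : SimpleStep a b)) =
      if u = v then jump φ.fn u else 0 := fun v _ => by
    rw [map_smul, jumpLinear_apply, smul_eq_mul]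
    by_cases hv : v.1 = ⟨b, -1⟩
    · have h0 : jump φ.fn v = 0 := by rw [hv, jump_last]
      rw [h0, zero_mul]
      split_ifs with huv
      · rw [huv, h0]
      · rfl
    · rw [jump_stepGerm u v hv]
      split_ifs with huv
      · rw [huv, mul_one]
      · rw [mul_zero]
  rw [Finset.sum_congr rfl h, Finset.sum_ite_eq, jumpLinear_apply]
  split_ifs with hu
  · exact sub_self _
  · rw [sub_zero]
    by_contra h0
    exact hu (hF u h0)

end Jumps

end Rugh


namespace Rugh

open PointGerm

/-! ### Bounded operators on `ℓ¹` -/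

section EllOne

variable {α : Type*}

/-- The space `ℓ¹(α)` of summable families of complex numbers. -/
abbrev EllOne (α : Type*) : Type _ := lp (fun _ : α => ℂ) 1

variable {E : Type*} [NormedAddCommGroup E] [NormedSpace ℂ E]

theorem EllOne.hasSum_norm (f : EllOne α) : HasSum (fun i => ‖f i‖) ‖f‖ := by
  simpa using lp.hasSum_norm (p := 1) (by simp) f

open Classical in
/-- The standard basis of `ℓ¹`. -/
def ellBasis (i : α) : EllOne α := lp.single 1 i 1

theorem norm_ellBasis (i : α) : ‖(ellBasis i : EllOne α)‖ = 1 := by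
  classical
  rw [ellBasis, lp.norm_single one_pos, norm_one]

open Classical in
theorem ellBasis_apply (i j : α) : (ellBasis i : EllOne α) j = if j = i then 1 else 0 := by
  rw [ellBasis, lp.single_apply, Pi.single_apply]

theorem EllOne.hasSum_ellBasis (f : EllOne α) : HasSum (fun i => f i • ellBasis i) f := by
  classical
  have h := lp.hasSum_single (p := 1) (by simp) f
  convert h using 2 with i
  rw [ellBasis, ← lp.single_smul, smul_eq_mul, mul_one]

theorem EllOne.ext_clm {A B : EllOne α →L[ℂ] E} (h : ∀ i, A (ellBasis i) = B (ellBasis i)) :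
    A = B := by
  ext f
  have h1 := (EllOne.hasSum_ellBasis f).mapL A
  have h2 := (EllOne.hasSum_ellBasis f).mapL B
  simp only [map_smul, h] at h1 h2
  exact h1.unique h2

/-- On ℓ¹ an operator norm is controlled by the basis vectors alone; this is what will identify the
norms of the powers of `transport`. -/
theorem EllOne.opNorm_le {A : EllOne α →L[ℂ] E} {C : ℝ} (hC : 0 ≤ C)
    (h : ∀ i, ‖A (ellBasis i)‖ ≤ C) : ‖A‖ ≤ C := by
  refine A.opNorm_le_bound hC fun f => ?_
  have h1 := (EllOne.hasSum_ellBasis f).mapL A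
  simp only [map_smul] at h1
  refine (h1.norm_le_of_bounded ((EllOne.hasSum_norm f).mul_left C) fun i => ?_)
  rw [norm_smul, mul_comm]
  exact mul_le_mul_of_nonneg_right (h i) (norm_nonneg _)

variable [CompleteSpace E]

theorem EllOne.summable_smul {v : α → E} {C : ℝ} (hv : ∀ i, ‖v i‖ ≤ C) (f : EllOne α) :
    Summable fun i => f i • v i := by
  refine Summable.of_norm_bounded ((EllOne.hasSum_norm f).summable.mul_left C) fun i => ?_
  rw [norm_smul, mul_comm]
  exact mul_le_mul_of_nonneg_right (hv i) (norm_nonneg _)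

/-- The bounded operator on `ℓ¹` with given bounded values on the standard basis. -/
def ellLift (v : α → E) (C : ℝ) (hv : ∀ i, ‖v i‖ ≤ C) : EllOne α →L[ℂ] E :=
  LinearMap.mkContinuous
    { toFun := fun f => ∑' i, f i • v i
      map_add' := fun f g => by
        rw [← (EllOne.summable_smul hv f).tsum_add (EllOne.summable_smul hv g)]
        simp only [lp.coeFn_add, Pi.add_apply, add_smul]
      map_smul' := fun t f => by
        simp only [lp.coeFn_smul, Pi.smul_apply, smul_eq_mul, mul_smul, RingHom.id_apply]
        exact (EllOne.summable_smul hv f).tsum_const_smul t } C fun f => by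
    refine tsum_of_norm_bounded ((EllOne.hasSum_norm f).mul_left C) fun i => ?_
    rw [norm_smul, mul_comm]
    exact mul_le_mul_of_nonneg_right (hv i) (norm_nonneg _)

theorem ellLift_apply (v : α → E) (C : ℝ) (hv : ∀ i, ‖v i‖ ≤ C) (f : EllOne α) :
    ellLift v C hv f = ∑' i, f i • v i := rfl

theorem ellLift_ellBasis (v : α → E) (C : ℝ) (hv : ∀ i, ‖v i‖ ≤ C) (i : α) :
    ellLift v C hv (ellBasis i) = v i := by
  classical
  rw [ellLift_apply, tsum_eq_single i]
  · simp [ellBasis_apply]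
  · intro j hj
    simp [ellBasis_apply, hj]

end EllOne

/-! ### Step functions and `ℓ¹` of the germs -/

section StepEll

variable {a b : EReal} [hab : Fact (a < b)]

/-- The operator `ℓ¹([a⁺, b⁻]) → SBV(a,b)` that maps a family of jumps to a step function. -/
def ofJumps (a b : EReal) [Fact (a < b)] : EllOne (interval a b) →L[ℂ] SBV a b :=
  ellLift (fun v => ((stepGerm v.1 : SimpleStep a b) : SBV a b)) 2 fun v => by
    rw [UniformSpace.Completion.norm_coe]
    exact norm_stepGerm_le v.1

theorem ofJumps_ellBasis (v : interval a b) :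
    ofJumps a b (ellBasis v) = ((stepGerm v.1 : SimpleStep a b) : SBV a b) :=
  ellLift_ellBasis _ _ _ v

/-- The family of jumps of a simple step function. -/
def stepJumps : SimpleStep a b →ₗ[ℂ] EllOne (interval a b) where
  toFun φ := ⟨fun v => jump φ.fn v, memℓp_gen' (C := 2 * ‖φ‖) fun s => by
    simpa using φ.sum_norm_jump_le s⟩
  map_add' φ ψ := lp.ext (funext fun v => jump_add φ ψ v)
  map_smul' t φ := lp.ext (funext fun v => jump_smul t φ v)

theorem stepJumps_apply (φ : SimpleStep a b) (v : interval a b) :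
    stepJumps φ v = jump φ.fn v := rfl

theorem norm_stepJumps_le (φ : SimpleStep a b) : ‖stepJumps φ‖ ≤ 2 * ‖φ‖ :=
  lp.norm_le_of_forall_sum_le (by simp) (by positivity) fun s => by
    simpa [stepJumps_apply] using φ.sum_norm_jump_le s

/-- The jumps of an element of `SBV(a,b)`. -/
def jumps (a b : EReal) [Fact (a < b)] : SBV a b →L[ℂ] EllOne (interval a b) :=
  (stepJumps.mkContinuous 2 norm_stepJumps_le).extend
    (UniformSpace.Completion.toComplL (𝕜 := ℂ) (E := SimpleStep a b))

theorem jumps_coe (φ : SimpleStep a b) : jumps a b (φ : SBV a b) = stepJumps φ := by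
  have h := ContinuousLinearMap.extend_eq (stepJumps.mkContinuous 2 norm_stepJumps_le)
    (e := UniformSpace.Completion.toComplL (𝕜 := ℂ) (E := SimpleStep a b))
    UniformSpace.Completion.denseRange_coe
    (UniformSpace.Completion.isUniformInducing_coe (SimpleStep a b)) φ
  rw [LinearMap.mkContinuous_apply] at h
  exact h

theorem SBV.ext_clm {E : Type*} [NormedAddCommGroup E] [NormedSpace ℂ E] {A B : SBV a b →L[ℂ] E}
    (h : ∀ φ : SimpleStep a b, A (φ : SBV a b) = B (φ : SBV a b)) : A = B :=
  DFunLike.coe_injective (UniformSpace.Completion.denseRange_coe.equalizer A.continuous B.continuous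
    (funext h))

/-- By density it suffices to treat simple step functions, which are finite sums of their jumps. -/
theorem ofJumps_comp_jumps : (ofJumps a b).comp (jumps a b) = ContinuousLinearMap.id ℂ _ := by
  refine SBV.ext_clm fun φ => ?_
  rw [ContinuousLinearMap.comp_apply, jumps_coe, ofJumps, ellLift_apply]
  have hF := φ.isSimpleStep.finite_jump_ne_zero
  rw [tsum_eq_sum (s := hF.toFinset)]
  · have h := φ.eq_sum_jump (F := hF.toFinset) fun v hv => hF.mem_toFinset.2 hv
    have h' := congrArg (UniformSpace.Completion.toComplL (𝕜 := ℂ) (E := SimpleStep a b)) h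
    rw [map_sum] at h'
    simp only [map_smul] at h'
    exact h'.symm
  · intro v hv
    have : jump φ.fn v = 0 := by
      by_contra h0
      exact hv (hF.mem_toFinset.2 h0)
    rw [stepJumps_apply, this, zero_smul]

theorem stepJumps_stepGerm (w : interval a b) (hw : w.1 ≠ ⟨b, -1⟩) :
    stepJumps (stepGerm w.1 : SimpleStep a b) = ellBasis w := by
  classical
  refine lp.ext (funext fun v => ?_)
  rw [stepJumps_apply, jump_stepGerm v w hw, ellBasis_apply]
  split_ifs <;> rfl

theorem jumps_ofJumps_ellBasis (w : interval a b) (hw : w.1 ≠ ⟨b, -1⟩) :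
    jumps a b (ofJumps a b (ellBasis w)) = ellBasis w := by
  rw [ofJumps_ellBasis, jumps_coe, stepJumps_stepGerm w hw]

/-- The one basis vector on which `jumps` does not undo `ofJumps`. -/
theorem jumps_ofJumps_last :
    jumps a b (ofJumps a b (ellBasis ⟨⟨b, -1⟩, last_mem_interval⟩)) =
      -ellBasis ⟨⟨a, 1⟩, first_mem_interval⟩ := by
  rw [ofJumps_ellBasis, jumps_coe, stepGerm_last, map_neg]
  congr 1
  exact stepJumps_stepGerm ⟨⟨a, 1⟩, first_mem_interval⟩ fun h =>
    absurd (congrArg dir h) (show (1 : ℤˣ) ≠ -1 by decide)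

end StepEll

end Rugh


namespace Rugh

open PointGerm

theorem PointGerm.Above.of_le {v : PointGerm} {x y : EReal} (h : v.Above y) (hxy : x ≤ y) :
    v.Above x := by
  rcases hxy.eq_or_lt with rfl | hxy
  · exact h
  · exact Or.inl (h.elim hxy.trans fun h => h.1 ▸ hxy)

/-! ### The pieces of a monotone system -/

namespace MonotoneSystem

variable {a b : EReal} {d : ℕ} (F : MonotoneSystem a b d)

theorem inPiece_iff {k : Fin (d + 1)} {v : PointGerm} :
    F.InPiece k v ↔ v.Above (F.cut k.castSucc) ∧ v.Below (F.cut k.succ) := by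
  rw [InPiece, F.lo_eq, F.hi_eq]
  rfl

theorem exists_inPiece {v : PointGerm} (hv : v ∈ interval a b) : ∃ k, F.InPiece k v := by
  by_contra! h
  -- A germ in no piece passes every cutting point in turn, and finally b.
  have key (j : Fin (d + 2)) : v.Above (F.cut j) := by
    induction j using Fin.induction with
    | zero => rw [F.cut_zero]; exact hv.1
    | succ k ih =>
      by_contra h'
      exact h k (F.inPiece_iff.2 ⟨ih, not_above_iff.1 h'⟩)
  have h := key (Fin.last _)
  rw [F.cut_last] at h
  exact not_above_iff.2 hv.2 h

theorem InPiece.eq {F : MonotoneSystem a b d} {j k : Fin (d + 1)} {v : PointGerm}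
    (hj : F.InPiece j v) (hk : F.InPiece k v) : j = k := by
  have key {j k : Fin (d + 1)} (hj : F.InPiece j v) (hk : F.InPiece k v) : ¬ j < k := fun hlt => by
    rw [inPiece_iff] at hj hk
    exact not_above_iff.2 hj.2 (hk.1.of_le (F.strictMono.monotone (Fin.succ_le_castSucc_iff.2 hlt)))
  exact le_antisymm (not_lt.1 (key hk hj)) (not_lt.1 (key hj hk))

theorem sum_inPiece {E : Type*} [AddCommMonoid E] {k : Fin (d + 1)} {v : PointGerm}
    (hk : F.InPiece k v) (x : Fin (d + 1) → E) [∀ j, Decidable (F.InPiece j v)] :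
    ∑ j, (if F.InPiece j v then x j else 0) = x k := by
  rw [Finset.sum_eq_single k, if_pos hk]
  · exact fun j _ hj => if_neg fun h => hj (h.eq hk)
  · exact fun h => absurd (Finset.mem_univ k) h

open Classical in
theorem weight_eq {k : Fin (d + 1)} {v : PointGerm} (hk : F.InPiece k v) :
    F.weight v = (F.branch k).g := F.sum_inPiece hk fun k => (F.branch k).g

open Classical in
theorem sign_eq {k : Fin (d + 1)} {v : PointGerm} (hk : F.InPiece k v) :
    F.sign v = (((F.branch k).sign : ℤ) : ℂ) :=
  F.sum_inPiece hk fun k => (((F.branch k).sign : ℤ) : ℂ)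

theorem germMap_eq {k : Fin (d + 1)} {v : PointGerm} (hk : F.InPiece k v) :
    F.germMap v = (F.branch k).germMap v := by
  have h : ∃ k, F.InPiece k v := ⟨k, hk⟩
  rw [germMap, dif_pos h, h.choose_spec.eq hk]

theorem germMap_mem {v : PointGerm} (hv : v ∈ interval a b) : F.germMap v ∈ interval a b := by
  obtain ⟨k, hk⟩ := F.exists_inPiece hv
  rw [F.germMap_eq hk]
  exact (F.branch k).germMap_mem hk

theorem norm_sign {v : PointGerm} (hv : v ∈ interval a b) : ‖F.sign v‖ = 1 := by
  obtain ⟨k, hk⟩ := F.exists_inPiece hv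
  rw [F.sign_eq hk]
  rcases Int.units_eq_one_or (F.branch k).sign with h | h <;> simp [h]

theorem iterate_germMap_mem {v : PointGerm} (hv : v ∈ interval a b) (n : ℕ) :
    F.germMap^[n] v ∈ interval a b := by
  induction n with
  | zero => exact hv
  | succ n ih => rw [Function.iterate_succ_apply']; exact F.germMap_mem ih

theorem norm_signProd {v : PointGerm} (hv : v ∈ interval a b) (n : ℕ) : ‖F.signProd n v‖ = 1 := by
  rw [signProd, norm_prod]
  exact Finset.prod_eq_one fun i _ => F.norm_sign (F.iterate_germMap_mem hv i)

theorem norm_weight_le {v : PointGerm} (hv : v ∈ interval a b) :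
    ‖F.weight v‖ ≤ ∑ k, ‖(F.branch k).g‖ := by
  obtain ⟨k, hk⟩ := F.exists_inPiece hv
  rw [F.weight_eq hk]
  exact Finset.single_le_sum (f := fun k => ‖(F.branch k).g‖) (fun _ _ => norm_nonneg _)
    (Finset.mem_univ k)

theorem first_inPiece (k : Fin (d + 1)) : F.InPiece k ⟨F.cut k.castSucc, 1⟩ := by
  rw [← F.lo_eq]
  exact (F.branch k).first_mem

theorem last_inPiece (k : Fin (d + 1)) : F.InPiece k ⟨F.cut k.succ, -1⟩ := by
  rw [← F.hi_eq]
  exact (F.branch k).last_mem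

theorem InPiece.mem_interval {F : MonotoneSystem a b d} {k : Fin (d + 1)} {v : PointGerm}
    (hk : F.InPiece k v) : v ∈ interval a b :=
  interval_mono (F.branch k).le_lo (F.branch k).hi_le hk

end MonotoneSystem

/-! ### The basis of germs -/

section GermBasis

variable {a b : EReal}

open Classical in
/-- The basis vector of `ℓ¹([a⁺, b⁻])` of a germ in `[a⁺, b⁻]`. -/
def germBasis (v : PointGerm) : EllOne (interval a b) :=
  if h : v ∈ interval a b then ellBasis ⟨v, h⟩ else 0

theorem germBasis_of_mem {v : PointGerm} (hv : v ∈ interval a b) :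
    (germBasis v : EllOne (interval a b)) = ellBasis ⟨v, hv⟩ := dif_pos hv

theorem norm_germBasis {v : PointGerm} (hv : v ∈ interval a b) :
    ‖(germBasis v : EllOne (interval a b))‖ = 1 := by
  rw [germBasis_of_mem hv, norm_ellBasis]

theorem norm_germBasis_le (v : PointGerm) : ‖(germBasis v : EllOne (interval a b))‖ ≤ 1 := by
  by_cases hv : v ∈ interval a b
  · exact (norm_germBasis hv).le
  · rw [germBasis, dif_neg hv, norm_zero]
    exact zero_le_one

theorem ext_germBasis {E : Type*} [NormedAddCommGroup E] [NormedSpace ℂ E]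
    {A B : EllOne (interval a b) →L[ℂ] E}
    (h : ∀ v ∈ interval a b, A (germBasis v) = B (germBasis v)) : A = B :=
  EllOne.ext_clm fun v => by simpa only [germBasis_of_mem v.2] using h v v.2

variable [Fact (a < b)]

theorem ofJumps_germBasis {v : PointGerm} (hv : v ∈ interval a b) :
    ofJumps a b (germBasis v) = ((stepGerm v : SimpleStep a b) : SBV a b) := by
  rw [germBasis_of_mem hv, ofJumps_ellBasis]

theorem jumps_ofJumps_germBasis {v : PointGerm} (hv : v ∈ interval a b) (hb : v ≠ ⟨b, -1⟩) :
    jumps a b (ofJumps a b (germBasis v)) = germBasis v := by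
  rw [germBasis_of_mem hv, jumps_ofJumps_ellBasis _ hb]

theorem jumps_ofJumps_germBasis_last :
    jumps a b (ofJumps a b (germBasis ⟨b, -1⟩)) = -germBasis ⟨a, 1⟩ := by
  rw [germBasis_of_mem last_mem_interval, germBasis_of_mem first_mem_interval, jumps_ofJumps_last]

end GermBasis

/-! ### The transfer operator on germs -/

namespace MonotoneSystem

variable {a b : EReal} {d : ℕ} (F : MonotoneSystem a b d)

theorem norm_sign_mul_weight_smul_le (v : interval a b) :
    ‖(F.sign v * F.weight v) • (germBasis (F.germMap v) : EllOne (interval a b))‖ ≤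
      ∑ k, ‖(F.branch k).g‖ := by
  rw [norm_smul, norm_germBasis (F.germMap_mem v.2), norm_mul, F.norm_sign v.2, one_mul, mul_one]
  exact F.norm_weight_le v.2

/-- The transport of jumps, `δ_v ↦ s(v) g(v) δ_{f̂ v}`. -/
def transport : EllOne (interval a b) →L[ℂ] EllOne (interval a b) :=
  ellLift (fun v => (F.sign v * F.weight v) • germBasis (F.germMap v)) (∑ k, ‖(F.branch k).g‖)
    F.norm_sign_mul_weight_smul_le

theorem transport_germBasis {v : PointGerm} (hv : v ∈ interval a b) :
    F.transport (germBasis v) = (F.sign v * F.weight v) • germBasis (F.germMap v) := by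
  rw [germBasis_of_mem hv]
  exact ellLift_ellBasis _ _ F.norm_sign_mul_weight_smul_le ⟨v, hv⟩

theorem transport_germBasis_of_inPiece {k : Fin (d + 1)} {v : PointGerm} (hk : F.InPiece k v) :
    F.transport (germBasis v) = ((((F.branch k).sign : ℤ) : ℂ) * (F.branch k).g) •
      germBasis ((F.branch k).germMap v) := by
  rw [F.transport_germBasis hk.mem_interval, F.sign_eq hk, F.weight_eq hk, F.germMap_eq hk]

theorem transport_pow_germBasis {v : PointGerm} (hv : v ∈ interval a b) (n : ℕ) :
    (F.transport ^ n) (germBasis v) =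
      (F.signProd n v * F.weightProd n v) • germBasis (F.germMap^[n] v) := by
  induction n with
  | zero => simp [signProd, weightProd]
  | succ n ih =>
    rw [pow_succ', mul_apply_eq_comp, ih, map_smul,
      F.transport_germBasis (F.iterate_germMap_mem hv n), smul_smul, signProd, weightProd,
      signProd, weightProd, Finset.prod_range_succ, Finset.prod_range_succ,
      Function.iterate_succ_apply']
    congr 1
    ring

theorem norm_transport_pow_germBasis {v : PointGerm} (hv : v ∈ interval a b) (n : ℕ) :
    ‖(F.transport ^ n) (germBasis v)‖ = ‖F.weightProd n v‖ := by
  rw [F.transport_pow_germBasis hv, norm_smul, norm_mul, F.norm_signProd hv,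
    norm_germBasis (F.iterate_germMap_mem hv n), one_mul, mul_one]

/-- The limit of `‖g^{(n)}‖_∞ ^ (1/n)`. -/
def weightRadius : ℝ := (spectralRadius ℂ F.transport).toReal

theorem weightRadius_nonneg : 0 ≤ F.weightRadius := ENNReal.toReal_nonneg

variable [hab : Fact (a < b)]

/-- Each basis vector goes to a basis vector times a scalar of modulus |g^{(n)}(v)|, so the supremum
over the basis is the operator norm. -/
theorem norm_transport_pow (n : ℕ) : ‖F.transport ^ n‖ = F.weightNorm n := by
  have h (v : interval a b) : ‖F.weightProd n v‖ ≤ ‖F.transport ^ n‖ := by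
    rw [← F.norm_transport_pow_germBasis v.2]
    exact (F.transport ^ n).unit_le_opNorm _ (norm_germBasis_le _)
  have : Nonempty (interval a b) := ⟨⟨_, first_mem_interval⟩⟩
  refine le_antisymm (EllOne.opNorm_le ?_ fun v => ?_) (ciSup_le h)
  · exact Real.iSup_nonneg fun v => norm_nonneg _
  · rw [← germBasis_of_mem v.2, F.norm_transport_pow_germBasis v.2]
    exact le_ciSup (f := fun v : interval a b => ‖F.weightProd n v‖)
      ⟨_, forall_mem_range.2 h⟩ v

/-- Gelfand's formula for `transport`. -/
theorem tendsto_weightNorm :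
    Tendsto (fun n : ℕ => F.weightNorm n ^ (1 / (n : ℝ))) atTop (𝓝 F.weightRadius) := by
  have h := spectrum.pow_norm_pow_one_div_tendsto_nhds_spectralRadius F.transport
  have hfin : spectralRadius ℂ F.transport ≠ ⊤ := by
    have : Nontrivial (EllOne (interval a b)) :=
      ⟨⟨germBasis ⟨a, 1⟩, 0, fun h => one_ne_zero (α := ℝ) (by
        rw [← norm_germBasis (first_mem_interval (a := a) (b := b)), h, norm_zero])⟩⟩
    exact ne_top_of_le_ne_top ENNReal.coe_ne_top (spectrum.spectralRadius_le_nnnorm F.transport)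
  refine ((ENNReal.tendsto_toReal hfin).comp h).congr fun n => ?_
  rw [Function.comp_apply, ENNReal.toReal_ofReal (Real.rpow_nonneg (norm_nonneg _) _),
    F.norm_transport_pow]

/-- Root test: the terms are eventually dominated by r^n for some r between |t| ρ_∞ and 1. -/
theorem summable_smul_transport_pow {t : ℂ} (ht : ‖t‖ * F.weightRadius < 1) :
    Summable fun n : ℕ => (t • F.transport) ^ n := by
  obtain ⟨r, hr, hr1⟩ := exists_between ht
  have hr0 : 0 ≤ r := (mul_nonneg (norm_nonneg t) F.weightRadius_nonneg).trans hr.le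
  refine (summable_geometric_of_lt_one hr0 hr1).of_norm_bounded_eventually_nat ?_
  filter_upwards [(F.tendsto_weightNorm.const_mul ‖t‖).eventually (gt_mem_nhds hr),
    eventually_ge_atTop 1] with n hn hn1
  have hn0 : n ≠ 0 := by omega
  have hw : 0 ≤ F.weightNorm n := F.norm_transport_pow n ▸ norm_nonneg _
  calc ‖(t • F.transport) ^ n‖ = ‖t‖ ^ n * F.weightNorm n := by
        rw [smul_pow, norm_smul, norm_pow, F.norm_transport_pow]
    _ = (‖t‖ * F.weightNorm n ^ (1 / (n : ℝ))) ^ n := by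
        rw [mul_pow, one_div, Real.rpow_inv_natCast_pow hw hn0]
    _ ≤ r ^ n := pow_le_pow_left₀ (by positivity) hn.le n

theorem isUnit_one_sub_smul_transport {t : ℂ} (ht : ‖t‖ * F.weightRadius < 1) :
    IsUnit (1 - t • F.transport) :=
  (ringInverse_eq (F.summable_smul_transport_pow ht).one_sub_mul_tsum_pow
    (F.summable_smul_transport_pow ht).tsum_pow_mul_one_sub).1

theorem hasSum_inverse_germBasis {t : ℂ} (ht : ‖t‖ * F.weightRadius < 1) {v : PointGerm}
    (hv : v ∈ interval a b) :
    HasSum (fun n : ℕ => (t ^ n * (F.signProd n v * F.weightProd n v)) •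
      (germBasis (F.germMap^[n] v) : EllOne (interval a b)))
      (Ring.inverse (1 - t • F.transport) (germBasis v)) := by
  have hs := F.summable_smul_transport_pow ht
  rw [(ringInverse_eq hs.one_sub_mul_tsum_pow hs.tsum_pow_mul_one_sub).2]
  have h := hs.hasSum.mapL (ContinuousLinearMap.apply ℂ (EllOne (interval a b))
    (germBasis v : EllOne (interval a b)))
  refine h.congr_fun fun n => ?_
  rw [ContinuousLinearMap.apply_apply, smul_pow, _root_.smul_apply, F.transport_pow_germBasis hv,
    smul_smul]

end MonotoneSystem

end Rugh


/-! ### Factorization of the transfer operator through jumps -/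

namespace Rugh

open PointGerm

/-- Regrouping a sum over pieces as a sum over cutting points. The opposite values of s at the two
ends merge the last B term into the jump at index 0. -/
theorem sum_smul_jumps_eq {E : Type*} [AddCommGroup E] [Module ℂ E] {d : ℕ} (A B D : Fin (d + 1) → E)
    (s : Fin (d + 2) → ℂ) (h0 : D 0 = A 0 + B (Fin.last d))
    (h1 : ∀ i : Fin d, D i.succ = A i.succ - B i.castSucc) (hs : s (Fin.last (d + 1)) = -s 0) :
    ∑ j, -s j.castSucc • D j = ∑ k, (s k.succ • B k - s k.castSucc • A k) := by
  rw [Finset.sum_sub_distrib, Fin.sum_univ_succ, Fin.sum_univ_castSucc (fun k => s k.succ • B k),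
    Fin.sum_univ_succ (fun k => s k.castSucc • A k), Fin.succ_last, hs, h0]
  simp only [h1, smul_sub, Finset.sum_sub_distrib, Fin.castSucc_zero, neg_smul, smul_add,
    Finset.sum_neg_distrib, Fin.castSucc_succ]
  abel

theorem Branch.stepTransfer_stepGerm {a b : EReal} [Fact (a < b)] (B : Branch a b) (v : PointGerm)
    [Decidable (v ∈ interval B.lo B.hi)] :
    B.stepTransfer (stepGerm v) = (((B.sign : ℤ) : ℂ) * B.g) •
      ((if v ∈ interval B.lo B.hi then (stepGerm (B.germMap v) : SimpleStep a b) else 0) +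
        sigma B.hi v • stepGerm (B.germMap B.last) -
        sigma B.lo v • stepGerm (B.germMap B.first)) := by
  refine SimpleStep.ext (funext fun y => (B.transferFun_sigma v y).trans ?_)
  have hsub (φ ψ : SimpleStep a b) : (φ - ψ).fn = φ.fn - ψ.fn := rfl
  rw [SimpleStep.fn_smul, hsub, SimpleStep.fn_add, SimpleStep.fn_smul, SimpleStep.fn_smul]
  simp only [Pi.smul_apply, Pi.sub_apply, Pi.add_apply, stepGerm_fn, smul_eq_mul]
  split_ifs
  · rw [stepGerm_fn]
    ring
  · rw [SimpleStep.fn_zero, Pi.zero_apply]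
    ring

namespace MonotoneSystem

variable {a b : EReal} {d : ℕ} (F : MonotoneSystem a b d)

theorem norm_neg_sigma_le (x : EReal) (v : PointGerm) : ‖-sigma x v‖ ≤ 1 / 2 := by
  rw [sigma]
  split_ifs <;> norm_num

/-- The functional `δ_v ↦ -σ_{c_k}(v)`. -/
def cutFunctional (k : Fin (d + 1)) : EllOne (interval a b) →L[ℂ] ℂ :=
  ellLift (fun v => -sigma (F.cut k.castSucc) v) (1 / 2) fun _ => norm_neg_sigma_le _ _

theorem cutFunctional_germBasis (k : Fin (d + 1)) {v : PointGerm} (hv : v ∈ interval a b) :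
    F.cutFunctional k (germBasis v) = -sigma (F.cut k.castSucc) v := by
  rw [germBasis_of_mem hv]
  exact ellLift_ellBasis (fun v : interval a b => -sigma (F.cut k.castSucc) v) _ _ ⟨v, hv⟩

/-- The difference of the basis vectors of the germs at a cutting point (the sum for `c_0`). -/
def cutJump (j : Fin (d + 1)) : EllOne (interval a b) :=
  if j = 0 then germBasis ⟨a, 1⟩ + germBasis ⟨b, -1⟩
  else germBasis ⟨F.cut j.castSucc, 1⟩ - germBasis ⟨F.cut j.castSucc, -1⟩

theorem cutJump_zero : F.cutJump 0 = germBasis ⟨a, 1⟩ + germBasis ⟨b, -1⟩ := if_pos rfl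

theorem cutJump_of_ne {j : Fin (d + 1)} (hj : j ≠ 0) : F.cutJump j =
    germBasis ⟨F.cut j.castSucc, 1⟩ - germBasis ⟨F.cut j.castSucc, -1⟩ := if_neg hj

theorem right_mem_interval (j : Fin (d + 1)) :
    (⟨F.cut j.castSucc, 1⟩ : PointGerm) ∈ interval a b := (F.first_inPiece j).mem_interval

theorem left_mem_interval {j : Fin (d + 1)} (hj : j ≠ 0) :
    (⟨F.cut j.castSucc, -1⟩ : PointGerm) ∈ interval a b := by
  obtain ⟨i, rfl⟩ := Fin.exists_succ_eq.2 hj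
  obtain ⟨d, rfl⟩ := Nat.exists_eq_succ_of_ne_zero (n := d) (by have := i.2; omega)
  rw [← Fin.succ_castSucc]
  exact (F.last_inPiece i.castSucc).mem_interval

/-- The action of the transfer operator on jumps. -/
def jumpTransfer : EllOne (interval a b) →L[ℂ] EllOne (interval a b) :=
  F.transport + finiteRank F.cutFunctional fun j => F.transport (F.cutJump j)

/-- Regroups the finite rank part by pieces, so that each piece carries the two truncation terms of
`Branch.stepTransfer_stepGerm`. -/
theorem jumpTransfer_germBasis {v : PointGerm} (hv : v ∈ interval a b) :
    F.jumpTransfer (germBasis v) = F.transport (germBasis v) +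
      ∑ k, (sigma (F.branch k).hi v • F.transport (germBasis (F.branch k).last) -
        sigma (F.branch k).lo v • F.transport (germBasis (F.branch k).first)) := by
  rw [jumpTransfer, _root_.add_apply, finiteRank_apply]
  simp only [F.cutFunctional_germBasis _ hv, Branch.first, Branch.last, F.lo_eq, F.hi_eq]
  congr 1
  refine sum_smul_jumps_eq (fun k => F.transport (germBasis ⟨F.cut k.castSucc, 1⟩))
    (fun k => F.transport (germBasis ⟨F.cut k.succ, -1⟩)) (fun j => F.transport (F.cutJump j))
    (fun i => sigma (F.cut i) v) ?_ (fun i => ?_) ?_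
  · simp only [cutJump_zero, map_add, Fin.castSucc_zero, F.cut_zero, Fin.succ_last, F.cut_last]
  · simp only [F.cutJump_of_ne (Fin.succ_ne_zero i), map_sub, Fin.castSucc_succ]
  · simp only [F.cut_last, F.cut_zero]
    -- Every germ lies above a and below b, so σ_b = -σ_a: the reason for the sum, not a difference,
    -- in row 0.
    rw [sigma_of_above hv.1, sigma_of_below hv.2]

theorem norm_inv_mul_weightRadius_lt {z : ℂ} (hz : F.weightRadius < ‖z‖) :
    ‖z⁻¹‖ * F.weightRadius < 1 := by
  rw [norm_inv, inv_mul_lt_one₀ (F.weightRadius_nonneg.trans_lt hz)]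
  exact hz

theorem isOpen_setOf_norm_mul_lt : IsOpen {t : ℂ | ‖t‖ * F.weightRadius < 1} :=
  isOpen_lt (by fun_prop) continuous_const

variable [Fact (a < b)]

/-- The function σ_{c_i} changes value only across c_i. For j = 0, b⁻ is above every c_i, while a⁺
is above c_0 and below the others. -/
theorem cutFunctional_cutJump (i j : Fin (d + 1)) :
    F.cutFunctional i (F.cutJump j) = if i = j then -1 else 0 := by
  rcases eq_or_ne j 0 with rfl | hj
  · rw [cutJump_zero, map_add, F.cutFunctional_germBasis i first_mem_interval,
      F.cutFunctional_germBasis i last_mem_interval, sigma_of_above (v := ⟨b, -1⟩) (Or.inl ?_)]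
    · split_ifs with h
      · rw [h, Fin.castSucc_zero, F.cut_zero, sigma_of_above (v := ⟨_, 1⟩) (Or.inr ⟨rfl, rfl⟩)]
        norm_num
      · rw [sigma_of_below (Or.inl ?_)]
        · norm_num
        · exact F.cut_zero.symm.trans_lt
            (F.strictMono (Fin.castSucc_pos (Fin.pos_iff_ne_zero.2 h)))
    · exact (F.strictMono (Fin.castSucc_lt_last i)).trans_eq F.cut_last
  · rw [cutJump_of_ne _ hj, map_sub, F.cutFunctional_germBasis i (F.right_mem_interval j),
      F.cutFunctional_germBasis i (F.left_mem_interval hj)]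
    rcases lt_trichotomy i j with h | rfl | h
    · have hlt := F.strictMono (Fin.castSucc_lt_castSucc_iff.2 h)
      rw [if_neg h.ne, sigma_of_above (Or.inl hlt), sigma_of_above (Or.inl hlt), sub_self]
    · rw [if_pos rfl, sigma_of_above (v := ⟨_, 1⟩) (Or.inr ⟨rfl, rfl⟩),
        sigma_of_below (v := ⟨_, -1⟩) (Or.inr ⟨rfl, rfl⟩)]
      norm_num
    · have hlt := F.strictMono (Fin.castSucc_lt_castSucc_iff.2 h)
      rw [if_neg h.ne', sigma_of_below (Or.inl hlt), sigma_of_below (Or.inl hlt), sub_self]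

theorem jumpTransfer_cutJump_zero : F.jumpTransfer (F.cutJump 0) = 0 := by
  rw [jumpTransfer, _root_.add_apply, finiteRank_apply]
  simp only [cutFunctional_cutJump, ite_smul, zero_smul, Finset.sum_ite_eq', Finset.mem_univ,
    if_true, neg_one_smul, add_neg_cancel]

/-- Compared on basis vectors, piece by piece: jumps inside a piece are transported, and its end
germs carry the truncation jumps. -/
theorem transfer_comp_ofJumps :
    F.transfer.comp (ofJumps a b) = (ofJumps a b).comp F.jumpTransfer := by
  classical
  have h1 {k : Fin (d + 1)} {v : PointGerm} (hk : F.InPiece k v) :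
      ofJumps a b (F.transport (germBasis v)) = (((((F.branch k).sign : ℤ) : ℂ) * (F.branch k).g) •
        (stepGerm ((F.branch k).germMap v) : SimpleStep a b) : SimpleStep a b) := by
    rw [F.transport_germBasis_of_inPiece hk, map_smul,
      ofJumps_germBasis ((F.branch k).germMap_mem hk), UniformSpace.Completion.coe_smul]
  refine ext_germBasis fun v hv => ?_
  rw [ContinuousLinearMap.comp_apply, ContinuousLinearMap.comp_apply, ofJumps_germBasis hv,
    F.jumpTransfer_germBasis hv, map_add, map_sum, transfer, _root_.sum_apply]
  obtain ⟨j, hj⟩ := F.exists_inPiece hv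
  rw [← F.sum_inPiece hj fun _ => ofJumps a b (F.transport (germBasis v)),
    ← Finset.sum_add_distrib]
  refine Finset.sum_congr rfl fun k _ => ?_
  rw [Branch.transfer_coe, Branch.stepTransfer_stepGerm, map_sub, map_smul, map_smul,
    h1 (F.branch k).last_mem, h1 (F.branch k).first_mem, smul_sub, smul_add, smul_comm _ (sigma _ _),
    smul_comm _ (sigma _ _), UniformSpace.Completion.coe_sub, UniformSpace.Completion.coe_add,
    UniformSpace.Completion.coe_smul (sigma _ _), UniformSpace.Completion.coe_smul (sigma _ _),
    ← add_sub_assoc]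
  congr 2
  by_cases hk : F.InPiece k v
  · rw [if_pos hk, if_pos (show v ∈ _ from hk), h1 hk]
  · rw [if_neg hk, if_neg (show v ∉ _ from hk), smul_zero, UniformSpace.Completion.coe_zero]

theorem ofJumps_comp_jumpTransfer_comp_jumps :
    (ofJumps a b).comp (F.jumpTransfer.comp (jumps a b)) = F.transfer := by
  rw [← ContinuousLinearMap.comp_assoc, ← F.transfer_comp_ofJumps, ContinuousLinearMap.comp_assoc,
    ofJumps_comp_jumps, ContinuousLinearMap.comp_id]

/-- `jumps` fails to undo `ofJumps` only at b⁻, by a multiple of `cutJump 0`, which `jumpTransfer`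
kills. This is the second half of the factorization L = p T, T p = P + K. -/
theorem jumpTransfer_comp_jumps_comp_ofJumps :
    (F.jumpTransfer.comp (jumps a b)).comp (ofJumps a b) = F.jumpTransfer := by
  refine ext_germBasis fun v hv => ?_
  rw [ContinuousLinearMap.comp_apply, ContinuousLinearMap.comp_apply]
  by_cases hb : v = ⟨b, -1⟩
  · rw [hb, jumps_ofJumps_germBasis_last, map_neg, neg_eq_iff_add_eq_zero, ← map_add,
      ← cutJump_zero F, jumpTransfer_cutJump_zero]
  · rw [jumps_ofJumps_germBasis hv hb]

/-! ### The kneading matrix -/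

/-- The kneading series is the functional -ℓ_k applied term by term to the Neumann series. -/
theorem kneading_eq (k : Fin (d + 1)) {t : ℂ} (ht : ‖t‖ * F.weightRadius < 1) {v : PointGerm}
    (hv : v ∈ interval a b) : F.kneading k v t =
      -F.cutFunctional k (Ring.inverse (1 - t • F.transport) (germBasis v)) := by
  have h := ((F.hasSum_inverse_germBasis ht hv).mapL (F.cutFunctional k)).neg
  rw [← h.tsum_eq, kneading]
  refine tsum_congr fun n => ?_
  rw [map_smul, F.cutFunctional_germBasis k (F.iterate_germMap_mem hv n), smul_eq_mul, mul_neg,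
    neg_neg]

/-- Substituting t R P = R - 1 in the perturbation matrix leaves -ℓ_k(R e_j), because ℓ_k(e_j)
cancels the identity matrix. -/
theorem kneadingMatrix_eq {t : ℂ} (ht : ‖t‖ * F.weightRadius < 1) : F.kneadingMatrix t =
    (perturbationMatrix (Ring.inverse (1 - t • F.transport)) F.cutFunctional
      (fun j => F.transport (F.cutJump j)) t).transpose := by
  set R := Ring.inverse (1 - t • F.transport) with hR
  have hRP (y : EllOne (interval a b)) : t • R (F.transport y) = R y - y := by
    have h := DFunLike.congr_fun
      (Ring.inverse_mul_cancel _ (F.isUnit_one_sub_smul_transport ht)) y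
    rw [← hR, mul_apply_eq_comp, one_apply_eq_self, _root_.sub_apply, one_apply_eq_self,
      _root_.smul_apply, map_sub, map_smul] at h
    exact (sub_eq_of_eq_add' (sub_eq_iff_eq_add.1 h)).symm
  ext j k
  have h1 : F.kneadingMatrix t j k = -F.cutFunctional k (R (F.cutJump j)) := by
    rw [kneadingMatrix, Matrix.of_apply]
    split_ifs with hj
    · rw [hj, cutJump_zero, F.kneading_eq k ht first_mem_interval,
        F.kneading_eq k ht last_mem_interval, map_add, map_add, neg_add]
    · rw [F.cutJump_of_ne hj, F.kneading_eq k ht (F.right_mem_interval j),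
        F.kneading_eq k ht (F.left_mem_interval hj), map_sub, map_sub, neg_sub, neg_sub_neg]
  rw [h1, Matrix.transpose_apply, perturbationMatrix, Matrix.sub_apply, Matrix.smul_apply,
    Matrix.of_apply, ← map_smul, hRP, map_sub, cutFunctional_cutJump, Matrix.one_apply]
  split_ifs <;> ring

theorem mtDet_eq {t : ℂ} (ht : ‖t‖ * F.weightRadius < 1) : F.mtDet t =
    perturbationDet F.transport F.cutFunctional (fun j => F.transport (F.cutJump j)) t := by
  rw [mtDet, F.kneadingMatrix_eq ht, Matrix.det_transpose, perturbationDet]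

theorem eventually_mtDet_eq {t₀ : ℂ} (ht : ‖t₀‖ * F.weightRadius < 1) : F.mtDet =ᶠ[𝓝 t₀]
    perturbationDet F.transport F.cutFunctional fun j => F.transport (F.cutJump j) :=
  (F.isOpen_setOf_norm_mul_lt.eventually_mem ht).mono fun _ h => F.mtDet_eq h

/-- The determinant is 1 at t = 0, so the identity theorem on the domain |t| ρ_∞ < 1 forbids zeros
accumulating at t₀. -/
theorem eventually_perturbationDet_ne_zero {t₀ : ℂ} (ht : ‖t₀‖ * F.weightRadius < 1) :
    ∀ᶠ t in 𝓝[≠] t₀, perturbationDet F.transport F.cutFunctional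
      (fun j => F.transport (F.cutJump j)) t ≠ 0 := by
  by_contra h
  have han : AnalyticOnNhd ℂ (perturbationDet F.transport F.cutFunctional
      fun j => F.transport (F.cutJump j)) {t : ℂ | ‖t‖ * F.weightRadius < 1} := fun t ht =>
    analyticAt_perturbationDet _ _ (F.isUnit_one_sub_smul_transport ht)
  -- Treated as a sublevel set of ρ_∞ |t|, which also covers ρ_∞ = 0, where the domain is the whole
  -- plane.
  have hconv : Convex ℝ {t : ℂ | ‖t‖ * F.weightRadius < 1} := by
    have h := (convexOn_univ_norm (E := ℂ)).smul F.weightRadius_nonneg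
    simpa [mul_comm] using h.convex_lt 1
  have h0 := han.eqOn_zero_of_preconnected_of_frequently_eq_zero hconv.isPreconnected ht
    h (show (0 : ℂ) ∈ _ by simp)
  rw [perturbationDet, perturbationMatrix, zero_smul, sub_zero, Matrix.det_one] at h0
  exact one_ne_zero h0

end MonotoneSystem

end Rugh

end

theorem mainTheorem1 {a b : EReal} [Fact (a < b)] {d : ℕ} (F : Rugh.MonotoneSystem a b d) :
    ∃ ρ : ℝ, Tendsto (fun n : ℕ => F.weightNorm n ^ (1 / (n : ℝ))) atTop (𝓝 ρ) ∧
      (∀ z ∈ spectrum ℂ F.transfer, ρ < ‖z‖ →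
        Rugh.IsIsolatedEigenvalueOfFiniteMultiplicity F.transfer z) ∧
      ∀ z : ℂ, ρ < ‖z‖ →
        AnalyticAt ℂ F.mtDet z⁻¹ ∧
        (Rugh.IsEigenvalue F.transfer z ↔ F.mtDet z⁻¹ = 0) ∧
        (Rugh.IsEigenvalue F.transfer z →
          ∃ m : ℕ, Rugh.HasAlgebraicMultiplicity F.transfer z m ∧
            analyticOrderAt F.mtDet z⁻¹ = m) := by
  have hTp := F.jumpTransfer_comp_jumps_comp_ofJumps
  -- Writes L as p T, so that the spectral results for factorized operators apply.
  rw [← F.ofJumps_comp_jumpTransfer_comp_jumps]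
  refine ⟨F.weightRadius, F.tendsto_weightNorm, fun z hsp hz => ?_, fun z hz => ?_⟩
  all_goals
    have hz0 : z ≠ 0 := norm_pos_iff.1 (F.weightRadius_nonneg.trans_lt hz)
    have ht := F.norm_inv_mul_weightRadius_lt hz
    have hu := F.isUnit_one_sub_smul_transport ht
    have hD := F.eventually_perturbationDet_ne_zero ht
  · exact Rugh.isIsolatedEigenvalue_comp hTp hz0 hu hD hsp
  · have hev := F.eventually_mtDet_eq ht
    refine ⟨(Rugh.analyticAt_perturbationDet _ _ hu).congr hev.symm, ?_, fun _ => ?_⟩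
    · rw [F.mtDet_eq ht]
      exact Rugh.isEigenvalue_comp_iff hTp hz0 hu
    · rw [analyticOrderAt_congr hev]
      exact Rugh.exists_hasAlgebraicMultiplicity hTp hz0 hu hD
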